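/- **Setup.** Let $G$ be $\mathrm{SO}_e(p,q)$ (the identity component of $\mathrm{SO}(p,q)$), $1\le p\le q$, or $\mathrm{SO}(m,\mathbb C)$, $m\ge 2$, regarded as a real Lie group. * If $G=\mathrm{SO}_e(p,q)$, let $G_{\mathbb C}=\mathrm{SO}(p,q;\mathbb C)\cong\mathrm{SO}(p+q,\mathbb C)$ be the group of complex matrices of determinant $1$ preserving the symmetric bilinear form $I_{p,q}=\mathrm{diag}(1_p,-1_q)$, and $K_{\mathbb C}=\mathrm{SO}(p,\mathbb C)\times\mathrm{SO}(q,\mathbb C)\subseteq G_{\mathbb C}$. Let $\mathfrak a=\bigoplus_{j=1}^p\mathbb R e_j$ with $e_j=E_{j,p+q+1-j}+E_{p+q+1-j,j}$, and $\mathfrak s=\mathfrak{su}(p,q)\supseteq\mathfrak{so}(p,q)\supseteq\mathfrak a$. * If $G=\mathrm{SO}(m,\mathbb C)$, let $G_{\mathbb C}=G\times G$, with $G$ embedded by $g\mapsto(g,\bar g)$, and let $K_{\mathbb C}$ be the diagonal subgroup. Let $\mathfrak a\subseteq\mathfrak g=\mathfrak{so}(m,\mathbb C)$ be the real space of block diagonal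 matrices with $\lfloor m/2\rfloor$ blocks $\begin{pmatrix}0&it_j\\-it_j&0\end{pmatrix}$, $t_j\in\mathbb R$ (and a last entry $0$ if $m$ is odd), and $\mathfrak s=\mathfrak{so}^*(2m)\supseteq\mathfrak{so}(m,\mathbb C)$, embedded by $A\mapsto\mathrm{diag}(A,\bar A)$. Here $\exp(iY)$, for $Y\in\mathfrak a$, means $(\exp(iY),\exp(i\bar Y))\in G_{\mathbb C}$. Let $\widehat\Sigma=\Sigma(\mathfrak s,\mathfrak a)$ be the doubly restricted root system: the set of nonzero linear forms $\alpha$ on $\mathfrak a$ for which there is $0\ne Z\in\mathfrak s$ with $[H,Z]=\alpha(H)Z$ for all $H\in\mathfrak a$. Let $$\Omega_0=\{X\in\mathfrak a:\ |\alpha(X)|<\tfrac{\pi}{2}\ \text{ for all }\alpha\in\widehat\Sigma\},\qquad \Xi_0=G\exp(i\Omega_0)K_{\mathbb C}/K_{\mathbb C}\subseteq G_{\mathbb C}/K_{\mathbb C},$$ let $\partial_e\Omega_0$ be the set of extreme points of $\overline{\Omega_0}$, and define the distinguished boundary of $\Xi_0$ by $$\partial_d\Xi_0=G\exp(i\,\partial_e\Omega_0)K_{\mathbb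 C}/K_{\mathbb C}\subseteq G_{\mathbb C}/K_{\mathbb C}.$$ For a subgroup $H$ of the linear group $G$, $\mathrm{Lie}(H)$ is the real Lie algebra of all matrices $X$ with $\exp(tX)\in H$ for all $t\in\mathbb R$. Below, $\cong$ means isomorphic as a topological $G$-space, respectively as a real Lie algebra. **Theorem 5.1.** (i) Let $G=\mathrm{SO}_e(n,n)$ or $G=\mathrm{SO}(2n,\mathbb C)$, $n\ge1$. There are subgroups $H_1,H_2$ of $G$ with $$\partial_d\Xi_0\cong G/H_1\amalg G/H_2,$$ where $H_2=\kappa(H_1)$ for an automorphism $\kappa$ of the topological group $G$, and both $\mathrm{Lie}(H_1)$ and $\mathrm{Lie}(H_2)$ are isomorphic to $$\mathfrak{so}(n,\mathbb C)\ \text{ if } G=\mathrm{SO}_e(n,n),\qquad \mathfrak{so}^*(2n)\ \text{ if } G=\mathrm{SO}(2n,\mathbb C).$$ If $n$ is odd, one can take $H_1=H_2$. (ii) Let $G=\mathrm{SO}_e(p,q)$ with $1\le p<q$, or $G=\mathrm{SO}(2n+1,\mathbb C)$ with $n\ge1$. There is a subgroup $H$ of $G$ with $$\partial_d\Xi_0\cong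 G/H,$$ where $\mathrm{Lie}(H)$ is isomorphic to $$\mathfrak{so}(p,\mathbb C)\oplus\mathfrak{so}(q-p)\ \text{ if } G=\mathrm{SO}_e(p,q),\qquad \mathfrak{so}^*(2n)\ \text{ if } G=\mathrm{SO}(2n+1,\mathbb C).$$ -/

import Mathlib

open Matrix

attribute [local instance] LieRing.ofAssociativeRing

noncomputable section

/-! ### General notions -/

/-- The (doubly) restricted roots of a real matrix Lie algebra `𝔰` with respect to an abelian
subspace `𝔞`.  The space `𝔞` is given by a coordinate map `a : ℝ ^ r → 𝔰`; a root is a nonzero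
linear form `α` on `𝔞` such that `[H, Z] = α(H) Z` for all `H ∈ 𝔞` has a solution
`0 ≠ Z ∈ 𝔰`. -/
def restrictedRoots {ι : Type*} [Fintype ι] [DecidableEq ι] {r : ℕ}
    (𝔰 : LieSubalgebra ℝ (Matrix ι ι ℂ)) (a : (Fin r → ℝ) →ₗ[ℝ] Matrix ι ι ℂ) :
    Set (Module.Dual ℝ (Fin r → ℝ)) :=
  {α | α ≠ 0 ∧ ∃ Z ∈ 𝔰, Z ≠ 0 ∧ ∀ t, ⁅a t, Z⁆ = α t • Z}

/-- The polyhedral domain `{X ∈ 𝔞 : |α(X)| < π / 2 for all roots α}`. -/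
def crownPolytope {r : ℕ} (R : Set (Module.Dual ℝ (Fin r → ℝ))) : Set (Fin r → ℝ) :=
  {t | ∀ α ∈ R, |α t| < Real.pi / 2}

/-- The set `G · E · K_ℂ / K_ℂ` in `G_ℂ / K_ℂ`, for a homomorphism `φ : G → G_ℂ` and
`E ⊆ G_ℂ`. -/
def orbitSet {G GC : Type*} [Group G] [Group GC] (φ : G →* GC) (KC : Subgroup GC)
    (E : Set GC) : Set (GC ⧸ KC) :=
  {x | ∃ g : G, ∃ z ∈ E, x = QuotientGroup.mk (φ g * z)}

/-- `B ⊆ G_ℂ / K_ℂ` is isomorphic to `G / H` as a topological `G`-space. -/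
def IsoHomogeneous {G GC : Type*} [Group G] [Group GC] [TopologicalSpace G]
    [TopologicalSpace GC] (φ : G →* GC) {KC : Subgroup GC} (B : Set (GC ⧸ KC))
    (H : Subgroup G) : Prop :=
  ∃ e : (G ⧸ H) ≃ₜ B, ∀ (g : G) (x : G ⧸ H), (e (g • x) : GC ⧸ KC) = φ g • (e x : GC ⧸ KC)

/-- `B ⊆ G_ℂ / K_ℂ` is isomorphic to the disjoint sum `G / H₁ ⨿ G / H₂` as a topological
`G`-space. -/
def IsoHomogeneousSum {G GC : Type*} [Group G] [Group GC] [TopologicalSpace G]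
    [TopologicalSpace GC] (φ : G →* GC) {KC : Subgroup GC} (B : Set (GC ⧸ KC))
    (H₁ H₂ : Subgroup G) : Prop :=
  ∃ e : ((G ⧸ H₁) ⊕ (G ⧸ H₂)) ≃ₜ B,
    (∀ (g : G) (x : G ⧸ H₁),
      (e (Sum.inl (g • x)) : GC ⧸ KC) = φ g • (e (Sum.inl x) : GC ⧸ KC)) ∧
    (∀ (g : G) (x : G ⧸ H₂),
      (e (Sum.inr (g • x)) : GC ⧸ KC) = φ g • (e (Sum.inr x) : GC ⧸ KC))

/-- For a subgroup `H` of a linear group `G`, the set `Lie(H)` of all matrices `X` with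
`exp(tX) ∈ H` for all real `t` is a real Lie algebra, and it is isomorphic to `L`. -/
def HasLieAlgebra {ι 𝕜 : Type*} [Fintype ι] [DecidableEq ι] [RCLike 𝕜]
    {G : Subgroup (GL ι 𝕜)} (H : Subgroup G) (L : Type*) [LieRing L] [LieAlgebra ℝ L] : Prop :=
  ∃ 𝔥 : LieSubalgebra ℝ (Matrix ι ι 𝕜),
    (∀ X : Matrix ι ι 𝕜, X ∈ 𝔥 ↔
      ∀ t : ℝ, ∃ h : G, h ∈ H ∧ h.val.val = NormedSpace.exp (t • X)) ∧
    Nonempty (𝔥 ≃ₗ⁅ℝ⁆ L)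

/-! ### The Lie algebras -/

/-- `𝔰𝔬(n, 𝕜)`, the skew-symmetric matrices, as a real Lie algebra. -/
def soAlg (𝕜 : Type*) [RCLike 𝕜] (n : ℕ) : LieSubalgebra ℝ (Matrix (Fin n) (Fin n) 𝕜) where
  carrier := {X | Xᵀ = -X}
  zero_mem' := by simp
  add_mem' := by
    intro X Y hX hY
    simp only [Set.mem_ofPred_eq] at *
    rw [transpose_add, hX, hY, neg_add]
  smul_mem' := by
    intro c X hX
    simp only [Set.mem_ofPred_eq] at *
    rw [transpose_smul, hX, smul_neg]
  lie_mem' := by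
    intro X Y hX hY
    simp only [Set.mem_ofPred_eq, Ring.lie_def] at *
    rw [transpose_sub, transpose_mul, transpose_mul, hX, hY]
    noncomm_ring

/-- `𝔰𝔬*(2n)`: the complex skew-symmetric `2n × 2n` matrices that are infinitesimally unitary for
the skew-Hermitian form with matrix `(0, -1; 1, 0)`, i.e. the matrices
`(Z₁, Z₂; -conj Z₂, conj Z₁)` with `Z₁` skew-symmetric and `Z₂` Hermitian. -/
def soStarAlg (n : ℕ) : LieSubalgebra ℝ (Matrix (Fin n ⊕ Fin n) (Fin n ⊕ Fin n) ℂ) where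
  carrier := {X | Xᵀ = -X ∧ Xᴴ * J (Fin n) ℂ + J (Fin n) ℂ * X = 0}
  zero_mem' := by simp
  add_mem' := by
    rintro X Y ⟨hX, hX'⟩ ⟨hY, hY'⟩
    refine ⟨by rw [transpose_add, hX, hY, neg_add], ?_⟩
    rw [conjTranspose_add, add_mul, mul_add, add_add_add_comm, hX', hY', add_zero]
  smul_mem' := by
    rintro c X ⟨hX, hX'⟩
    refine ⟨by rw [transpose_smul, hX, smul_neg], ?_⟩
    rw [conjTranspose_smul, star_trivial, smul_mul_assoc, mul_smul_comm, ← smul_add, hX',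
      smul_zero]
  lie_mem' := by
    rintro X Y ⟨hX, hX'⟩ ⟨hY, hY'⟩
    have h1 := eq_neg_of_add_eq_zero_left hX'
    have h2 := eq_neg_of_add_eq_zero_left hY'
    refine ⟨?_, ?_⟩
    · rw [Ring.lie_def, transpose_sub, transpose_mul, transpose_mul, hX, hY]
      noncomm_ring
    · rw [Ring.lie_def, conjTranspose_sub, conjTranspose_mul, conjTranspose_mul, sub_mul,
        mul_assoc, mul_assoc, h1, h2, mul_neg, mul_neg, ← mul_assoc, ← mul_assoc, h1, h2]
      noncomm_ring

/-- The diagonal matrix `I_{p,q} = diag(1, …, 1, -1, …, -1)`. -/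
def signMatrix (p q : ℕ) (𝕜 : Type*) [RCLike 𝕜] : Matrix (Fin p ⊕ Fin q) (Fin p ⊕ Fin q) 𝕜 :=
  fromBlocks 1 0 0 (-1)

/-- `𝔰𝔲(p, q)`. -/
def suAlg (p q : ℕ) : LieSubalgebra ℝ (Matrix (Fin p ⊕ Fin q) (Fin p ⊕ Fin q) ℂ) where
  carrier := {X | Xᴴ * signMatrix p q ℂ + signMatrix p q ℂ * X = 0 ∧ X.trace = 0}
  zero_mem' := by simp
  add_mem' := by
    rintro X Y ⟨hX, hX'⟩ ⟨hY, hY'⟩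
    refine ⟨?_, by rw [trace_add, hX', hY', add_zero]⟩
    rw [conjTranspose_add, add_mul, mul_add, add_add_add_comm, hX, hY, add_zero]
  smul_mem' := by
    rintro c X ⟨hX, hX'⟩
    refine ⟨?_, by rw [trace_smul, hX', smul_zero]⟩
    rw [conjTranspose_smul, star_trivial, smul_mul_assoc, mul_smul_comm, ← smul_add, hX,
      smul_zero]
  lie_mem' := by
    rintro X Y ⟨hX, hX'⟩ ⟨hY, hY'⟩
    have h1 := eq_neg_of_add_eq_zero_left hX
    have h2 := eq_neg_of_add_eq_zero_left hY
    refine ⟨?_, ?_⟩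
    · rw [Ring.lie_def, conjTranspose_sub, conjTranspose_mul, conjTranspose_mul, sub_mul,
        mul_assoc, mul_assoc, h1, h2, mul_neg, mul_neg, ← mul_assoc, ← mul_assoc, h1, h2]
      noncomm_ring
    · rw [Ring.lie_def, trace_sub, trace_mul_comm, sub_self]

/-! ### The case `G = SO_e(p, q)` -/

/-- `SO(p, q; 𝕜)`: the matrices of determinant `1` preserving the symmetric bilinear form
`I_{p,q}`.  For `𝕜 = ℝ` this is `SO(p, q)`; for `𝕜 = ℂ` it is a copy of `SO(p + q, ℂ)`. -/
def SOpq (p q : ℕ) (𝕜 : Type*) [RCLike 𝕜] : Subgroup (GL (Fin p ⊕ Fin q) 𝕜) where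
  carrier := {g | g.valᵀ * signMatrix p q 𝕜 * g.val = signMatrix p q 𝕜 ∧
    g.val.det = 1}
  one_mem' := by simp
  mul_mem' := by
    rintro g h ⟨hg, hg'⟩ ⟨hh, hh'⟩
    refine ⟨?_, by rw [Units.val_mul, det_mul, hg', hh', one_mul]⟩
    rw [Units.val_mul, transpose_mul]
    calc _ = h.valᵀ * (g.valᵀ * signMatrix p q 𝕜 * g.val) *
          h.val := by simp only [mul_assoc]
      _ = _ := by rw [hg, hh]
  inv_mem' := by
    rintro g ⟨hg, hg'⟩
    have hr : g.val * (g⁻¹).val = 1 := g.mul_inv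
    refine ⟨?_, ?_⟩
    · have ht := congrArg transpose hr
      rw [transpose_mul, transpose_one] at ht
      nth_rewrite 1 [← hg]
      calc _ = ((g⁻¹).valᵀ * g.valᵀ) * signMatrix p q 𝕜 *
            (g.val * (g⁻¹).val) := by simp only [mul_assoc]
        _ = _ := by rw [ht, hr, one_mul, mul_one]
    · have hd := congrArg det hr
      rwa [det_mul, hg', one_mul, det_one] at hd

/-- `SO_e(p, q)`, the identity component of `SO(p, q)`. -/
def SOe (p q : ℕ) : Subgroup (GL (Fin p ⊕ Fin q) ℝ) :=
  (Subgroup.connectedComponentOfOne (SOpq p q ℝ)).map (SOpq p q ℝ).subtype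

/-- `K_ℂ = SO(p, ℂ) × SO(q, ℂ)`, block diagonally embedded in `G_ℂ = SO(p, q; ℂ)`; it is the
complexification of the maximal compact subgroup `K = SO(p) × SO(q)` of `SO_e(p, q)`. -/
def KCpq (p q : ℕ) : Subgroup (SOpq p q ℂ) where
  carrier := {g | ∃ (A : Matrix (Fin p) (Fin p) ℂ) (D : Matrix (Fin q) (Fin q) ℂ),
    A.det = 1 ∧ D.det = 1 ∧ g.val.val = fromBlocks A 0 0 D}
  one_mem' := ⟨1, 1, by simp⟩
  mul_mem' := by
    rintro g h ⟨A, D, hA, hD, hg⟩ ⟨A', D', hA', hD', hh⟩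
    refine ⟨A * A', D * D', by rw [det_mul, hA, hA', one_mul], by rw [det_mul, hD, hD', one_mul],
      ?_⟩
    rw [Subgroup.coe_mul, Units.val_mul, hg, hh, fromBlocks_multiply]
    simp
  inv_mem' := by
    rintro g ⟨A, D, hA, hD, hg⟩
    refine ⟨A⁻¹, D⁻¹, by rw [det_nonsing_inv, hA, Ring.inverse_one],
      by rw [det_nonsing_inv, hD, Ring.inverse_one], ?_⟩
    have hr : g.val.val * ((g.val)⁻¹).val = 1 :=
      g.val.mul_inv
    have hl : ((g.val)⁻¹).val * g.val.val = 1 :=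
      g.val.inv_mul
    have h2 : g.val.val * fromBlocks A⁻¹ 0 0 D⁻¹ = 1 := by
      rw [hg, fromBlocks_multiply]
      simp [mul_nonsing_inv, hA, hD]
    rw [Subgroup.coe_inv]
    calc ((g.val)⁻¹).val
        = ((g.val)⁻¹).val *
            (g.val.val * fromBlocks A⁻¹ 0 0 D⁻¹) := by rw [h2, mul_one]
      _ = fromBlocks A⁻¹ 0 0 D⁻¹ := by rw [← mul_assoc, hl, one_mul]

theorem SOe_map_mem (p q : ℕ) (g : SOe p q) :
    GeneralLinearGroup.map (n := Fin p ⊕ Fin q) (algebraMap ℝ ℂ) g.val ∈ SOpq p q ℂ := by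
  obtain ⟨_, ⟨x, -, rfl⟩⟩ := g
  obtain ⟨hx, hx'⟩ := x.2
  have hs : (signMatrix p q ℝ).map (algebraMap ℝ ℂ) = signMatrix p q ℂ := by
    rw [signMatrix, signMatrix, fromBlocks_map]
    congr 1 <;> ext i j <;> rcases eq_or_ne i j with rfl | h <;> simp [*]
  refine ⟨?_, ?_⟩
  · have h := congrArg (fun M : Matrix _ _ ℝ => M.map (algebraMap ℝ ℂ)) hx
    simp only [Matrix.map_mul, hs] at h
    exact h
  · have h := congrArg (algebraMap ℝ ℂ) hx'
    rw [RingHom.map_det, map_one] at h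
    exact h

/-- The inclusion of `G = SO_e(p, q)` in its complexification `G_ℂ`. -/
def SOeToComplex (p q : ℕ) : SOe p q →* SOpq p q ℂ :=
  ((GeneralLinearGroup.map (algebraMap ℝ ℂ)).comp (SOe p q).subtype).codRestrict (SOpq p q ℂ)
    (SOe_map_mem p q)

/-- The maximal abelian subspace `𝔞` of `𝔭 ⊆ 𝔰𝔬(p, q)`, spanned by
`e_j = E_{j, n+1-j} + E_{n+1-j, j}` with `n = p + q` and `1 ≤ j ≤ p`. -/
def aPQ (p q : ℕ) (h : p ≤ q) :
    (Fin p → ℝ) →ₗ[ℝ] Matrix (Fin p ⊕ Fin q) (Fin p ⊕ Fin q) ℂ :=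
  Fintype.linearCombination ℝ fun j : Fin p =>
    single (Sum.inl j) (Sum.inr (Fin.castLE h j).rev) (1 : ℂ) +
      single (Sum.inr (Fin.castLE h j).rev) (Sum.inl j) (1 : ℂ)

/-- The domain `Ω₀ ⊆ 𝔞` for `G = SO_e(p, q)`: the roots are those of `𝔰 = 𝔰𝔲(p, q)`. -/
def OmegaPQ (p q : ℕ) (h : p ≤ q) : Set (Fin p → ℝ) :=
  crownPolytope (restrictedRoots (suAlg p q) (aPQ p q h))

/-- The distinguished boundary `G exp(i ∂_e Ω₀) K_ℂ / K_ℂ` for `G = SO_e(p, q)`, where `∂_e Ω₀`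
is the set of extreme points of the closure of `Ω₀`. -/
def boundaryPQ (p q : ℕ) (h : p ≤ q) : Set (SOpq p q ℂ ⧸ KCpq p q) :=
  orbitSet (SOeToComplex p q) (KCpq p q)
    {z | ∃ t ∈ (closure (OmegaPQ p q h)).extremePoints ℝ,
      z.val.val = NormedSpace.exp (Complex.I • aPQ p q h t)}

/-! ### The case `G = SO(m, ℂ)` -/

/-- `SO(m, ℂ)`. -/
def SOC (m : ℕ) : Subgroup (GL (Fin m) ℂ) where
  carrier := {g | g.valᵀ * g.val = 1 ∧ g.val.det = 1}
  one_mem' := by simp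
  mul_mem' := by
    rintro g h ⟨hg, hg'⟩ ⟨hh, hh'⟩
    refine ⟨?_, by rw [Units.val_mul, det_mul, hg', hh', one_mul]⟩
    rw [Units.val_mul, transpose_mul]
    calc _ = h.valᵀ * (g.valᵀ * g.val) *
          h.val := by simp only [mul_assoc]
      _ = _ := by rw [hg, mul_one, hh]
  inv_mem' := by
    rintro g ⟨hg, hg'⟩
    have hr : g.val * (g⁻¹).val = 1 := g.mul_inv
    refine ⟨?_, ?_⟩
    · have ht := congrArg transpose hr
      rw [transpose_mul, transpose_one] at ht
      calc _ = (g⁻¹).valᵀ * 1 * (g⁻¹).val := by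
            rw [mul_one]
        _ = ((g⁻¹).valᵀ * g.valᵀ) *
            (g.val * (g⁻¹).val) := by
            rw [← hg]; simp only [mul_assoc]
        _ = _ := by rw [ht, hr, one_mul]
    · have hd := congrArg det hr
      rwa [det_mul, hg', one_mul, det_one] at hd

theorem SOC_conj_mem (m : ℕ) (g : SOC m) :
    GeneralLinearGroup.map (n := Fin m) (starRingEnd ℂ) g.val ∈ SOC m := by
  obtain ⟨hx, hx'⟩ := g.2
  refine ⟨?_, ?_⟩
  · have h := congrArg (fun M : Matrix _ _ ℂ => M.map (starRingEnd ℂ)) hx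
    simp only [Matrix.map_mul] at h
    rw [Matrix.map_one _ (map_zero _) (map_one _)] at h
    exact h
  · have h := congrArg (starRingEnd ℂ) hx'
    rw [RingHom.map_det, map_one] at h
    exact h

/-- The conjugation `g ↦ conj g` of `SO(m, ℂ)` with respect to its compact real form `SO(m)`. -/
def SOCconj (m : ℕ) : SOC m →* SOC m :=
  ((GeneralLinearGroup.map (starRingEnd ℂ)).comp (SOC m).subtype).codRestrict (SOC m)
    (SOC_conj_mem m)

/-- The inclusion `g ↦ (g, conj g)` of `G = SO(m, ℂ)`, regarded as a real group, in its
complexification `G_ℂ = G × G`. -/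
def SOCToComplex (m : ℕ) : SOC m →* SOC m × SOC m :=
  (MonoidHom.id (SOC m)).prod (SOCconj m)

/-- `K_ℂ = Δ(G)`, the diagonal subgroup of `G_ℂ = G × G`. -/
def KCdiag (m : ℕ) : Subgroup (SOC m × SOC m) :=
  ((MonoidHom.id (SOC m)).prod (MonoidHom.id (SOC m))).range

/-- The maximal abelian subspace `𝔞` of `𝔭 = i 𝔰𝔬(m) ⊆ 𝔰𝔬(m, ℂ)`: block diagonal matrices with
blocks `(0, i t_j; -i t_j, 0)`, followed by a zero entry if `m` is odd. -/
def aC (m : ℕ) : (Fin (m / 2) → ℝ) →ₗ[ℝ] Matrix (Fin m) (Fin m) ℂ :=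
  Fintype.linearCombination ℝ fun j : Fin (m / 2) =>
    single ⟨2 * j, by omega⟩ ⟨2 * j + 1, by omega⟩ Complex.I -
      single ⟨2 * j + 1, by omega⟩ ⟨2 * j, by omega⟩ Complex.I

/-- The embedding `𝔰𝔬(m, ℂ) → 𝔰𝔬*(2m)`, `A ↦ (A, 0; 0, conj A)`. -/
def toSoStar (m : ℕ) :
    Matrix (Fin m) (Fin m) ℂ →ₗ[ℝ] Matrix (Fin m ⊕ Fin m) (Fin m ⊕ Fin m) ℂ where
  toFun A := fromBlocks A 0 0 (A.map (starRingEnd ℂ))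
  map_add' A B := by
    rw [fromBlocks_add, Matrix.map_add _ (map_add _)]
    simp
  map_smul' c A := by
    rw [RingHom.id_apply, fromBlocks_smul]
    congr 1
    · simp
    · simp
    · ext i j; simp

/-- The domain `Ω₀ ⊆ 𝔞` for `G = SO(m, ℂ)`: the roots are those of `𝔰 = 𝔰𝔬*(2m)`. -/
def OmegaC (m : ℕ) : Set (Fin (m / 2) → ℝ) :=
  crownPolytope (restrictedRoots (soStarAlg m) (toSoStar m ∘ₗ aC m))

/-- The distinguished boundary `G exp(i ∂_e Ω₀) K_ℂ / K_ℂ` for `G = SO(m, ℂ)`.  Multiplication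
by `i` in the complexification `𝔤_ℂ = 𝔤 ⊕ 𝔤`, in which `𝔤` is embedded by `X ↦ (X, conj X)`,
takes `Y ∈ 𝔞` to `(iY, i conj Y)`. -/
def boundaryC (m : ℕ) : Set ((SOC m × SOC m) ⧸ KCdiag m) :=
  orbitSet (SOCToComplex m) (KCdiag m)
    {z | ∃ t ∈ (closure (OmegaC m)).extremePoints ℝ,
      z.1.val.val = NormedSpace.exp (Complex.I • aC m t) ∧
      z.2.val.val =
        NormedSpace.exp (Complex.I • (aC m t).map (starRingEnd ℂ))}

end

open Filter Topology

noncomputable section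

/-! ### Local rigidity of involutions that commute with their conjugate, in a real Banach algebra.
-/

section Symmetries

attribute [-instance] LieRing.ofAssociativeRing

section BanachAlgebra

variable {𝒜 : Type*} [NormedRing 𝒜] [NormedAlgebra ℝ 𝒜] [CompleteSpace 𝒜]

/-! The symmetric space `G_ℂ / K_ℂ` is studied through symmetries: the point `z K_ℂ` is sent to the
involution `J = ρ(z) θ ρ(z)⁻¹` in a matrix algebra, where `θ` is `I_{p,q}` for `SO_e(p,q)` and the
exchange of the two copies of `ℂ ^ m` for `SO(m,ℂ)`. Near the identity, commuting with `θ` is the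
same as lying in `K_ℂ`.

The domain `Ω₀` is the open cube `|t_j| < π/4`. The forms `2 e_j` are roots of `𝔰`, which gives one
inclusion (`exists_root_vector_suAlg`, `exists_root_vector_soStarAlg`). Every root is bounded by
twice the operator norm of `a t`, which gives the other (`crownPolytope_eq_cube`). So the extreme
points are the vertices, and the corresponding `z` are `exp(π/4 N)` with `N³ = -N`, `σ N = -N` and
`θ N = -N θ`. Hence `J = exp(π/2 N) θ`, and `J σ(J) = exp(π N) = exp(-π N) = σ(J) J`: at
distinguished boundary points the symmetry commutes with its conjugate.

This closed condition is locally rigid: a symmetry with this property that is close to another one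
is conjugate to it by a small element of `G` (`SymmetryData.eventually_conj`). Therefore every
`G`-orbit in the boundary is open in the boundary, and each orbit map `G / G_x → G x` is open. This
yields the topological isomorphisms with `G / H` and `G / H₁ ⨿ G / H₂`.

The orbits are counted with sign matrices. All vertices are conjugate under diagonal sign matrices,
and those of determinant `1` lie in `G` and in `K_ℂ`. If some coordinate does not enter `𝔞` (`p <
q`, or `m` odd), its sign corrects the determinant and there is one orbit. Otherwise there are at
most two. They are distinct because a `g` carrying one to the other, multiplied by a sign matrix of
determinant `-1`, would commute with a quaternionic structure, and such a matrix has nonnegative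
determinant (`LinearMap.det_nonneg_of_quaternionic`). The two stabilizers are exchanged by
conjugation with the sign matrix. In the odd case that matrix can be chosen to replace `N` by `-N`,
and a conjugation argument shows that the stabilizer does not change.

Finally, the Lie algebra of the stabilizer is the centralizer of `J` in `𝔤`, computed in blocks in
`mem_range_blockLieHom_iff` and `mem_range_pairLieHom_iff`. -/

theorem Real.exp_add_of_commute {X Y : 𝒜} (h : Commute X Y) :
    NormedSpace.exp (X + Y) = NormedSpace.exp X * NormedSpace.exp Y :=
  letI := NormedAlgebra.restrictScalars ℚ ℝ 𝒜
  NormedSpace.exp_add_of_commute h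

theorem Real.exp_mul_exp_neg (X : 𝒜) : NormedSpace.exp X * NormedSpace.exp (-X) = 1 := by
  rw [← Real.exp_add_of_commute (Commute.refl X).neg_right, add_neg_cancel, NormedSpace.exp_zero]

theorem Real.exp_neg_mul_exp (X : 𝒜) : NormedSpace.exp (-X) * NormedSpace.exp X = 1 := by
  simpa using Real.exp_mul_exp_neg (-X)

theorem Real.continuous_normedSpaceExp : Continuous (NormedSpace.exp : 𝒜 → 𝒜) :=
  letI := NormedAlgebra.restrictScalars ℚ ℝ 𝒜
  NormedSpace.exp_continuous

theorem Real.map_exp (f : 𝒜 →ₐ[ℝ] 𝒜) (hf : Continuous f) (X : 𝒜) :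
    f (NormedSpace.exp X) = NormedSpace.exp (f X) :=
  letI := NormedAlgebra.restrictScalars ℚ ℝ 𝒜
  NormedSpace.map_exp f hf X

/-- Powers of a single element do not see the reversal of products, so the exponential series is
preserved term by term. -/
theorem Real.map_exp_of_antiHom (f : 𝒜 →ₗ[ℝ] 𝒜) (hf : Continuous f) (h1 : f 1 = 1)
    (hmul : ∀ X Y, f (X * Y) = f Y * f X) (X : 𝒜) :
    f (NormedSpace.exp X) = NormedSpace.exp (f X) := by
  have hpow : ∀ n : ℕ, f (X ^ n) = f X ^ n := by
    intro n
    induction n with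
    | zero => simpa using h1
    | succ n ih => rw [pow_succ, hmul, ih, pow_succ']
  have h := (NormedSpace.exp_series_hasSum_exp' (𝕂 := ℝ) X).map f hf
  have h' := NormedSpace.exp_series_hasSum_exp' (𝕂 := ℝ) (f X)
  refine h.unique ?_
  convert h' using 2 with n
  simp [hpow]

theorem Real.exp_neg_conj {T X : 𝒜} (h : T * X = -(X * T)) :
    NormedSpace.exp X * T = T * NormedSpace.exp (-X) := by
  let := NormedAlgebra.restrictScalars ℚ ℝ 𝒜
  have : SemiconjBy T (-X) X := by
    rw [SemiconjBy, mul_neg, h, neg_neg]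
  exact (this.exp_right).symm

/-- The exponential series of an element with `N ^ 3 = -N`. -/
theorem exp_smul_of_cube_eq_neg {N : 𝒜} (hN : N * N * N = -N) (θ : ℝ) :
    NormedSpace.exp (θ • N) = 1 + Real.sin θ • N + (1 - Real.cos θ) • (N * N) := by
  -- Rodrigues' formula. The candidate `c` solves `c' = c N` with `c 0 = 1`, so `c θ * exp(-θ N)` is
  -- constant.
  set c : ℝ → 𝒜 := fun θ => 1 + Real.sin θ • N + (1 - Real.cos θ) • (N * N) with hc
  have hcd : ∀ θ, HasDerivAt c (c θ * N) θ := by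
    intro θ
    have h1 : HasDerivAt (fun θ => Real.sin θ • N) (Real.cos θ • N) θ :=
      (Real.hasDerivAt_sin θ).smul_const N
    have h2 : HasDerivAt (fun θ => (1 - Real.cos θ) • (N * N)) (Real.sin θ • (N * N)) θ := by
      simpa using ((Real.hasDerivAt_cos θ).const_sub 1).smul_const (N * N)
    have h3 := (h1.const_add 1).add h2
    have he : c θ * N = Real.cos θ • N + Real.sin θ • (N * N) := by
      simp only [hc, add_mul, one_mul, smul_mul_assoc, hN]
      module
    rw [he]
    exact h3
  have hed : ∀ θ : ℝ, HasDerivAt (fun θ : ℝ => NormedSpace.exp (θ • -N))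
      (-N * NormedSpace.exp (θ • -N)) θ := fun θ => hasDerivAt_exp_smul_const' (-N) θ
  have hprod : ∀ θ, HasDerivAt (fun θ => c θ * NormedSpace.exp (θ • -N)) 0 θ := by
    intro θ
    have h := (hcd θ).mul (hed θ)
    rwa [neg_mul, mul_neg, mul_assoc, add_neg_cancel] at h
  have hconst := is_const_of_deriv_eq_zero (fun θ => (hprod θ).differentiableAt)
    (fun θ => (hprod θ).deriv) θ 0
  simp only [hc, Real.sin_zero, Real.cos_zero, zero_smul, sub_self, add_zero, one_mul,
    NormedSpace.exp_zero] at hconst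
  rw [smul_neg] at hconst
  calc NormedSpace.exp (θ • N)
      = (c θ * NormedSpace.exp (-(θ • N))) * NormedSpace.exp (θ • N) := by rw [hconst, one_mul]
    _ = c θ := by rw [mul_assoc, Real.exp_neg_mul_exp, mul_one]

theorem exp_pi_div_two_smul {N : 𝒜} (hN : N * N * N = -N) :
    NormedSpace.exp ((Real.pi / 2) • N) = 1 + N + N * N := by
  simp [exp_smul_of_cube_eq_neg hN]

variable (𝒜) in
-- The derivative of the exponential at `0` is the identity, so the inverse function theorem
-- applies.
theorem exists_local_log : ∃ log : 𝒜 → 𝒜, Tendsto log (𝓝 1) (𝓝 0) ∧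
    (∀ᶠ g in 𝓝 1, NormedSpace.exp (log g) = g) ∧ ∀ᶠ Y in 𝓝 0, log (NormedSpace.exp Y) = Y := by
  have h : HasStrictFDerivAt (NormedSpace.exp : 𝒜 → 𝒜)
      ((ContinuousLinearEquiv.refl ℝ 𝒜 : 𝒜 ≃L[ℝ] 𝒜) : 𝒜 →L[ℝ] 𝒜) 0 :=
    hasStrictFDerivAt_exp_zero
  refine ⟨h.localInverse _ _ _, ?_, ?_, h.eventually_left_inverse⟩
  · simpa [NormedSpace.exp_zero] using h.localInverse_tendsto
  · simpa [NormedSpace.exp_zero] using h.eventually_right_inverse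

omit [NormedAlgebra ℝ 𝒜] [CompleteSpace 𝒜] in
-- Small logarithms are unique. With `α` equal to `σ`, `δ`, `-τ` or `X ↦ -R X R`, this turns an
-- identity satisfied by a group element near `1` into the linear identity satisfied by its
-- logarithm.
theorem eventually_log_fixed {log : 𝒜 → 𝒜} (h0 : Tendsto log (𝓝 1) (𝓝 0))
    (hl : ∀ᶠ Y in 𝓝 0, log (NormedSpace.exp Y) = Y) {α : 𝒜 → 𝒜} (hα : Tendsto α (𝓝 0) (𝓝 0)) :
    ∀ᶠ g in 𝓝 1, NormedSpace.exp (α (log g)) = g → α (log g) = log g := by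
  filter_upwards [(hα.comp h0).eventually hl] with g hg h
  rw [Function.comp_apply, h] at hg
  exact hg.symm

variable (𝒜) in
/-- Two endomorphisms `σ`, `δ` and an anti-endomorphism `τ` of a real Banach algebra, together
with a sign `c`. -/
structure SymmetryData where
  /-- the real structure -/
  σ : 𝒜 →ₐ[ℝ] 𝒜
  /-- the grading -/
  δ : 𝒜 →ₐ[ℝ] 𝒜
  /-- the transposition -/
  τ : 𝒜 →ₗ[ℝ] 𝒜
  /-- the degree of the symmetries -/
  c : ℝ
  continuous_σ : Continuous σ
  continuous_δ : Continuous δ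
  continuous_τ : Continuous τ
  σ_σ : ∀ X, σ (σ X) = X
  τ_σ : ∀ X, τ (σ X) = σ (τ X)
  δ_σ : ∀ X, δ (σ X) = σ (δ X)
  τ_one : τ 1 = 1
  τ_mul : ∀ X Y, τ (X * Y) = τ Y * τ X
  c_mul_c : c * c = 1

namespace SymmetryData

variable (D : SymmetryData 𝒜)

/-- The Lie algebra attached to `D`. -/
def IsInfinitesimal (Y : 𝒜) : Prop := D.σ Y = Y ∧ D.τ Y = -Y ∧ D.δ Y = Y

/-- The symmetries `J` which commute with their conjugate. -/
def IsSymmetry (J : 𝒜) : Prop :=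
  J * J = 1 ∧ D.τ J = J ∧ D.δ J = D.c • J ∧ J * D.σ J = D.σ J * J

/-- Local square roots in the group attached to `D`. -/
theorem exists_half_log {T S : 𝒜} (hT : T * T = 1) (hS : S * S = 1) :
    ∃ L : 𝒜 → 𝒜, Tendsto L (𝓝 1) (𝓝 0) ∧ ∀ᶠ g in 𝓝 1,
      (D.σ g = g → D.τ g * g = 1 → D.δ g = g → D.IsInfinitesimal (L g)) ∧
      (T * g * T * g = 1 → NormedSpace.exp (L g) * T = g * T * NormedSpace.exp (L g)) ∧
      (S * g * S * g = 1 → NormedSpace.exp (L g) * S = g * S * NormedSpace.exp (L g)) := by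
  obtain ⟨log, h0, hr, hl⟩ := exists_local_log 𝒜
  -- The hypothesis says that the involution `R` inverts `g`, so `R` anticommutes with `log g`. For
  -- the square root `h = exp(½ log g)` this gives `h R = h (R h⁻¹) h = h (h R) h = g R h`: the
  -- element `h` conjugates `R` to `g R`.
  have key : ∀ {R : 𝒜}, R * R = 1 → ∀ᶠ g in 𝓝 1, R * g * R * g = 1 →
      NormedSpace.exp ((2⁻¹ : ℝ) • log g) * R = g * R * NormedSpace.exp ((2⁻¹ : ℝ) • log g) := by
    intro R hR
    have hα : Tendsto (fun X : 𝒜 => -(R * X * R)) (𝓝 0) (𝓝 0) := by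
      have : Continuous (fun X : 𝒜 => -(R * X * R)) := by fun_prop
      simpa using this.tendsto 0
    filter_upwards [hr, eventually_log_fixed h0 hl hα] with g hg hfix h
    have hanti : R * -log g = -(-log g * R) → _ := Real.exp_neg_conj
    have hexp : NormedSpace.exp (-(R * log g * R)) = g := by
      have hs : SemiconjBy R (-log g) (-(R * log g * R)) := by
        rw [SemiconjBy]
        simp only [mul_neg, neg_mul, mul_assoc, hR, mul_one]
      let := NormedAlgebra.restrictScalars ℚ ℝ 𝒜
      have h1 := hs.exp_right
      have h2 : NormedSpace.exp (-log g) = R * g * R := by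
        calc NormedSpace.exp (-log g) = R * g * R * g * NormedSpace.exp (-log g) := by
              rw [h, one_mul]
          _ = R * g * R * (NormedSpace.exp (log g) * NormedSpace.exp (-log g)) := by
              rw [hg, mul_assoc]
          _ = R * g * R := by rw [Real.exp_mul_exp_neg, mul_one]
      rw [h2, SemiconjBy] at h1
      calc _ = NormedSpace.exp (-(R * log g * R)) * (R * R) := by rw [hR, mul_one]
        _ = NormedSpace.exp (-(R * log g * R)) * R * R := by rw [← mul_assoc]
        _ = R * R * g * (R * R) := by rw [← h1]; simp only [mul_assoc]
        _ = g := by rw [hR, one_mul, mul_one]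
    have hfix := hfix hexp
    have hc : R * ((2⁻¹ : ℝ) • log g) = -(((2⁻¹ : ℝ) • log g) * R) := by
      rw [mul_smul_comm, smul_mul_assoc, ← smul_neg]
      congr 1
      conv_rhs => rw [← hfix]
      simp only [neg_mul, neg_neg, mul_assoc, hR, mul_one]
    have h2 : NormedSpace.exp ((2⁻¹ : ℝ) • log g) * NormedSpace.exp ((2⁻¹ : ℝ) • log g) = g := by
      rw [← Real.exp_add_of_commute (Commute.refl _), ← add_smul]
      norm_num
      exact hg
    have h3 := Real.exp_neg_conj hc
    calc _ = NormedSpace.exp ((2⁻¹ : ℝ) • log g) * (R * (NormedSpace.exp (-((2⁻¹ : ℝ) • log g)) *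
            NormedSpace.exp ((2⁻¹ : ℝ) • log g))) := by rw [Real.exp_neg_mul_exp, mul_one]
      _ = NormedSpace.exp ((2⁻¹ : ℝ) • log g) * (R * NormedSpace.exp (-((2⁻¹ : ℝ) • log g))) *
            NormedSpace.exp ((2⁻¹ : ℝ) • log g) := by simp only [mul_assoc]
      _ = _ := by rw [← h3, ← mul_assoc, h2]
  refine ⟨fun g => (2⁻¹ : ℝ) • log g, by simpa using h0.const_smul (2⁻¹ : ℝ), ?_⟩
  have hσ := eventually_log_fixed h0 hl (α := D.σ) (by simpa using D.continuous_σ.tendsto 0)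
  have hδ := eventually_log_fixed h0 hl (α := D.δ) (by simpa using D.continuous_δ.tendsto 0)
  have hτ := eventually_log_fixed h0 hl (α := fun X => -D.τ X)
    (by simpa using (D.continuous_τ.tendsto 0).neg)
  filter_upwards [hr, key hT, key hS, hσ, hδ, hτ] with g hg h1 h2 hσ hδ hτ
  refine ⟨fun hgσ hgτ hgδ => ⟨?_, ?_, ?_⟩, h1, h2⟩
  · rw [map_smul, hσ (by rw [← Real.map_exp _ D.continuous_σ, hg, hgσ])]
  · have hfix : -D.τ (log g) = log g := by
      apply hτ
      have : NormedSpace.exp (D.τ (log g)) = D.τ g := by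
        rw [← Real.map_exp_of_antiHom _ D.continuous_τ D.τ_one D.τ_mul, hg]
      calc NormedSpace.exp (-D.τ (log g))
          = NormedSpace.exp (-D.τ (log g)) * (D.τ g * g) := by rw [hgτ, mul_one]
        _ = g := by rw [← this, ← mul_assoc, Real.exp_neg_mul_exp, one_mul]
    rw [map_smul, ← smul_neg]
    conv_rhs => rw [← hfix, neg_neg]
  · rw [map_smul, hδ (by rw [← Real.map_exp _ D.continuous_δ, hg, hgδ])]

/-- Symmetries close to a given one are conjugate to it under small elements of the group attached
to `D`. -/
theorem eventually_conj {J₀ : 𝒜} (hJ₀ : D.IsSymmetry J₀) {U : Set 𝒜} (hU : U ∈ 𝓝 0) :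
    ∀ᶠ J in 𝓝 J₀, D.IsSymmetry J → ∃ Y ∈ U, ∃ Z ∈ U, D.IsInfinitesimal Y ∧ D.IsInfinitesimal Z ∧
      NormedSpace.exp Y * NormedSpace.exp Z * J₀ = J * (NormedSpace.exp Y * NormedSpace.exp Z) := by
  have sq : ∀ {J : 𝒜}, D.IsSymmetry J → (J * D.σ J) * (J * D.σ J) = 1 := fun {J} h => by
    have hs : D.σ J * D.σ J = 1 := by rw [← map_mul, h.1, map_one]
    nth_rewrite 2 [h.2.2.2]
    rw [mul_assoc, ← mul_assoc (D.σ J), hs, one_mul, h.1]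
  have σT : ∀ {J : 𝒜}, D.IsSymmetry J → D.σ (J * D.σ J) = J * D.σ J := fun h => by
    rw [map_mul, D.σ_σ, h.2.2.2]
  have τT : ∀ {J : 𝒜}, D.IsSymmetry J → D.τ (J * D.σ J) = J * D.σ J := fun h => by
    rw [D.τ_mul, D.τ_σ, h.2.1, h.2.2.2]
  have δT : ∀ {J : 𝒜}, D.IsSymmetry J → D.δ (J * D.σ J) = J * D.σ J := fun h => by
    rw [map_mul, D.δ_σ, h.2.2.1, map_smul, smul_mul_smul_comm, D.c_mul_c, one_smul]
  -- The conjugation is done in two steps. The involutions `J σ(J)` and `T` are fixed by `σ`, so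
  -- their quotient lies in the group and its square root `exp Y` carries `T` to `J σ(J)`. After
  -- this, `J₁ = exp(-Y) J exp(Y)` has the same product with its conjugate as `J₀`. This makes `J₁
  -- J₀` fixed by `σ`, so its square root `exp Z` lies in the group and carries `J₀` to `J₁`.
  obtain ⟨T, hTdef⟩ : ∃ T, T = J₀ * D.σ J₀ := ⟨_, rfl⟩
  have hTT : T * T = 1 := hTdef ▸ sq hJ₀
  obtain ⟨L, hL0, hL⟩ := D.exists_half_log hTT hJ₀.1
  have hσc := D.continuous_σ
  have t1 : Tendsto (fun J => J * D.σ J * T) (𝓝 J₀) (𝓝 1) := by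
    have : Continuous (fun J => J * D.σ J * T) := by fun_prop
    simpa only [← hTdef, hTT] using this.tendsto J₀
  have t2 := hL0.comp t1
  have t3 : Tendsto (fun J => NormedSpace.exp (-L (J * D.σ J * T)) * J *
      NormedSpace.exp (L (J * D.σ J * T)) * J₀) (𝓝 J₀) (𝓝 1) := by
    have e1 := (Real.continuous_normedSpaceExp.tendsto _).comp t2
    have e2 := (Real.continuous_normedSpaceExp.tendsto _).comp t2.neg
    have := ((e2.mul tendsto_id).mul e1).mul_const J₀
    simpa only [neg_zero, NormedSpace.exp_zero, one_mul, mul_one, hJ₀.1] using! this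
  have t4 := hL0.comp t3
  filter_upwards [t1.eventually hL, t3.eventually hL, t2.eventually hU, t4.eventually hU] with
    J h1 h2 h3 h4 hJ
  rw [Function.comp_apply] at h3 h4
  generalize hY : L (J * D.σ J * T) = Y at *
  generalize hg : NormedSpace.exp (-Y) * J * NormedSpace.exp Y * J₀ = g at *
  obtain ⟨E, hE⟩ : ∃ E, E = NormedSpace.exp Y := ⟨_, rfl⟩
  obtain ⟨F, hF⟩ : ∃ F, F = NormedSpace.exp (-Y) := ⟨_, rfl⟩
  have hEF : E * F = 1 := by rw [hE, hF, Real.exp_mul_exp_neg]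
  have hFE : F * E = 1 := by rw [hE, hF, Real.exp_neg_mul_exp]
  have hYi : D.IsInfinitesimal Y := by
    refine h1.1 ?_ ?_ ?_
    · rw [map_mul, σT hJ, hTdef, σT hJ₀]
    · rw [D.τ_mul, τT hJ, hTdef, τT hJ₀, mul_assoc, ← mul_assoc (J * D.σ J), sq hJ, one_mul,
        sq hJ₀]
    · rw [map_mul, δT hJ, hTdef, δT hJ₀]
  have hET : E * T = J * D.σ J * E := by
    rw [hE, h1.2.1 ?_, mul_assoc (J * D.σ J), hTT, mul_one]
    calc T * (J * D.σ J * T) * T * (J * D.σ J * T)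
        = T * (J * D.σ J) * (T * T) * (J * D.σ J) * T := by simp only [mul_assoc]
      _ = T * ((J * D.σ J) * (J * D.σ J)) * T := by rw [hTT]; simp only [mul_assoc, one_mul]
      _ = 1 := by rw [sq hJ, mul_one, hTT]
  have hg' : g = F * J * E * J₀ := by rw [← hg, hE, hF]
  have hJ1 : (F * J * E) * (F * J * E) = 1 := by
    calc _ = F * J * (E * F) * J * E := by simp only [mul_assoc]
      _ = F * (J * J) * E := by rw [hEF]; simp only [mul_assoc, one_mul]
      _ = 1 := by rw [hJ.1, mul_one, hFE]
  have hσE : D.σ E = E := by rw [hE, Real.map_exp _ D.continuous_σ, hYi.1]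
  have hσF : D.σ F = F := by rw [hF, Real.map_exp _ D.continuous_σ, map_neg, hYi.1]
  have hδE : D.δ E = E := by rw [hE, Real.map_exp _ D.continuous_δ, hYi.2.2]
  have hδF : D.δ F = F := by rw [hF, Real.map_exp _ D.continuous_δ, map_neg, hYi.2.2]
  have hτE : D.τ E = F := by
    rw [hE, hF, Real.map_exp_of_antiHom _ D.continuous_τ D.τ_one D.τ_mul, hYi.2.1]
  have hτF : D.τ F = E := by
    rw [hE, hF, Real.map_exp_of_antiHom _ D.continuous_τ D.τ_one D.τ_mul, map_neg, hYi.2.1, neg_neg]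
  -- From `J₁ σ(J₁) = T` and `J₁² = 1` one reads off `σ(J₁) = J₁ T`. Together with `T σ(J₀) = J₀`
  -- this gives `σ(J₁ J₀) = J₁ J₀`.
  have hσJ1 : D.σ (F * J * E) = F * J * E * T := by
    have h : (F * J * E) * D.σ (F * J * E) = T := by
      calc _ = F * J * (E * F) * D.σ J * E := by
            simp only [map_mul, hσE, hσF, mul_assoc]
        _ = F * (J * D.σ J * E) := by rw [hEF]; simp only [mul_assoc, one_mul]
        _ = T := by rw [← hET, ← mul_assoc, hFE, one_mul]
    calc _ = (F * J * E) * (F * J * E) * D.σ (F * J * E) := by rw [hJ1, one_mul]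
      _ = _ := by rw [mul_assoc (F * J * E), h]
  have hZi : D.IsInfinitesimal (L g) := by
    refine h2.1 ?_ ?_ ?_
    · have hσJ₀ : T * D.σ J₀ = J₀ := by
        rw [hTdef, mul_assoc, ← map_mul, hJ₀.1, map_one, mul_one]
      rw [hg', map_mul, hσJ1, mul_assoc _ T, hσJ₀]
    · have hτ1 : D.τ (F * J * E) = F * J * E := by
        rw [D.τ_mul, D.τ_mul, hτE, hτF, hJ.2.1, mul_assoc]
      rw [hg', D.τ_mul, hτ1, hJ₀.2.1, mul_assoc, ← mul_assoc (F * J * E), hJ1, one_mul, hJ₀.1]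
    · rw [hg', map_mul, map_mul, map_mul, hδE, hδF, hJ.2.2.1, hJ₀.2.2.1, mul_smul_comm,
        mul_smul_comm, smul_mul_assoc, smul_mul_assoc, smul_smul, D.c_mul_c, one_smul]
  have hZJ : NormedSpace.exp (L g) * J₀ = F * J * E * NormedSpace.exp (L g) := by
    rw [h2.2.2 ?_, hg', mul_assoc _ J₀ J₀, hJ₀.1, mul_one]
    calc J₀ * g * J₀ * g = J₀ * (F * J * E) * (J₀ * J₀) * (F * J * E) * J₀ := by
          rw [hg']; simp only [mul_assoc]
      _ = J₀ * ((F * J * E) * (F * J * E)) * J₀ := by rw [hJ₀.1]; simp only [mul_assoc, one_mul]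
      _ = 1 := by rw [hJ1, mul_one, hJ₀.1]
  refine ⟨Y, h3, L g, h4, hYi, hZi, ?_⟩
  rw [mul_assoc, hZJ, ← hE]
  calc E * (F * J * E * NormedSpace.exp (L g)) = (E * F) * J * (E * NormedSpace.exp (L g)) := by
        simp only [mul_assoc]
    _ = _ := by rw [hEF, one_mul]

end SymmetryData

end BanachAlgebra

end Symmetries

/-! ### Orbits in `G_ℂ / K_ℂ` and their realization by symmetries. -/

section Homogeneous

attribute [-instance] LieRing.ofAssociativeRing

variable {G GC : Type*} [Group G] [Group GC] [TopologicalSpace G] [TopologicalSpace GC]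
  [IsTopologicalGroup G] [IsTopologicalGroup GC]

/-- The stabilizer in `G` of a point of `G_ℂ / K_ℂ`. -/
def stabilizerOf {G GC : Type*} [Group G] [Group GC] (φ : G →* GC) {KC : Subgroup GC}
    (x : GC ⧸ KC) : Subgroup G :=
  (MulAction.stabilizer GC x).comap φ

theorem mem_stabilizerOf {G GC : Type*} [Group G] [Group GC] (φ : G →* GC) {KC : Subgroup GC}
    (x : GC ⧸ KC) (g : G) : g ∈ stabilizerOf φ x ↔ φ g • x = x := Iff.rfl

theorem mem_stabilizerOf_mk {G GC : Type*} [Group G] [Group GC] (φ : G →* GC) {KC : Subgroup GC}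
    (z : GC) (g : G) : g ∈ stabilizerOf φ (z : GC ⧸ KC) ↔ z⁻¹ * φ g * z ∈ KC := by
  rw [mem_stabilizerOf, MulAction.Quotient.smul_coe, smul_eq_mul, eq_comm, QuotientGroup.eq,
    mul_assoc]

/-- The orbit map `G / G_x → G_ℂ / K_ℂ`. -/
def orbitMap {G GC : Type*} [Group G] [Group GC] (φ : G →* GC) {KC : Subgroup GC} (x : GC ⧸ KC) :
    G ⧸ stabilizerOf φ x → GC ⧸ KC :=
  Quotient.lift (fun g => φ g • x) fun a b hab => by
    have h : φ (a⁻¹ * b) • x = x := QuotientGroup.leftRel_apply.mp hab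
    rw [map_mul, map_inv, mul_smul, inv_smul_eq_iff] at h
    exact h.symm

theorem orbitMap_mk {G GC : Type*} [Group G] [Group GC] (φ : G →* GC) {KC : Subgroup GC}
    (x : GC ⧸ KC) (g : G) : orbitMap φ x (g : G ⧸ stabilizerOf φ x) = φ g • x := rfl

theorem orbitMap_smul {G GC : Type*} [Group G] [Group GC] (φ : G →* GC) {KC : Subgroup GC}
    (x : GC ⧸ KC) (g : G) (y : G ⧸ stabilizerOf φ x) :
    orbitMap φ x (g • y) = φ g • orbitMap φ x y := by
  obtain ⟨a, rfl⟩ := QuotientGroup.mk_surjective y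
  rw [MulAction.Quotient.smul_coe, orbitMap_mk, orbitMap_mk, smul_eq_mul, map_mul, mul_smul]

theorem orbitMap_injective {G GC : Type*} [Group G] [Group GC] (φ : G →* GC) {KC : Subgroup GC}
    (x : GC ⧸ KC) : Function.Injective (orbitMap φ x) := by
  intro y y' h
  obtain ⟨a, rfl⟩ := QuotientGroup.mk_surjective y
  obtain ⟨b, rfl⟩ := QuotientGroup.mk_surjective y'
  rw [orbitMap_mk, orbitMap_mk] at h
  rw [QuotientGroup.eq, mem_stabilizerOf, map_mul, map_inv, mul_smul, ← h, inv_smul_smul]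

/-- Points of `B` close to `x` are reached from `x` by small elements of `G`. -/
def LocallyTransitiveAt (φ : G →* GC) {KC : Subgroup GC} (B : Set (GC ⧸ KC)) (x : GC ⧸ KC) :
    Prop :=
  ∀ U ∈ 𝓝 (1 : G), ∀ᶠ y in 𝓝[B] x, ∃ h ∈ U, φ h • x = y

omit [IsTopologicalGroup G] in
theorem continuous_orbitMap {φ : G →* GC} (hφ : Continuous φ) {KC : Subgroup GC} (x : GC ⧸ KC) :
    Continuous (orbitMap φ x) := by
  refine continuous_quot_lift _ ?_
  obtain ⟨z, rfl⟩ := QuotientGroup.mk_surjective x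
  have : Continuous fun g => ((φ g * z : GC) : GC ⧸ KC) :=
    continuous_quotient_mk'.comp (hφ.mul continuous_const)
  exact this

/-- Openness of the orbit map onto `B`. Local transitivity gives it at the base point, and
translation by `g`, which preserves `B`, carries it to any other point of the orbit. -/
theorem image_orbitMap_mem_nhdsWithin {φ : G →* GC} {KC : Subgroup GC} {B : Set (GC ⧸ KC)}
    (hB : ∀ g, ∀ y ∈ B, φ g • y ∈ B) {x : GC ⧸ KC} (hx : LocallyTransitiveAt φ B x)
    {V : Set (G ⧸ stabilizerOf φ x)} (hV : IsOpen V) {v : G ⧸ stabilizerOf φ x} (hv : v ∈ V) :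
    orbitMap φ x '' V ∈ 𝓝[B] (orbitMap φ x v) := by
  obtain ⟨g, rfl⟩ := QuotientGroup.mk_surjective v
  have hU : {h : G | ((g * h : G) : G ⧸ stabilizerOf φ x) ∈ V} ∈ 𝓝 1 := by
    have : Continuous fun h : G => ((g * h : G) : G ⧸ stabilizerOf φ x) :=
      continuous_quotient_mk'.comp (continuous_const.mul continuous_id)
    exact this.continuousAt.preimage_mem_nhds (hV.mem_nhds (by simpa using hv))
  have ht : Tendsto (fun y => (φ g)⁻¹ • y) (𝓝[B] (orbitMap φ x g)) (𝓝[B] x) := by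
    refine tendsto_nhdsWithin_iff.mpr ⟨?_, ?_⟩
    · have : Tendsto (fun y : GC ⧸ KC => (φ g)⁻¹ • y) (𝓝 (φ g • x)) (𝓝 ((φ g)⁻¹ • φ g • x)) :=
        (continuous_const_smul _).tendsto _
      rw [inv_smul_smul] at this
      exact this.mono_left nhdsWithin_le_nhds
    · filter_upwards [self_mem_nhdsWithin] with y hy
      rw [← map_inv]
      exact hB _ _ hy
  filter_upwards [ht.eventually (hx _ hU)] with y ⟨h, hh, hy⟩
  refine ⟨_, hh, ?_⟩
  rw [orbitMap_mk, map_mul, mul_smul, hy, smul_inv_smul]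

theorem isoHomogeneous_of_locallyTransitive {φ : G →* GC} (hφ : Continuous φ) {KC : Subgroup GC}
    {B : Set (GC ⧸ KC)} {x : GC ⧸ KC} (hB : ∀ y, y ∈ B ↔ ∃ g, φ g • x = y)
    (hx : LocallyTransitiveAt φ B x) : IsoHomogeneous φ B (stabilizerOf φ x) := by
  have hinv : ∀ g, ∀ y ∈ B, φ g • y ∈ B := by
    intro g y hy
    obtain ⟨a, rfl⟩ := (hB y).1 hy
    exact (hB _).2 ⟨g * a, by rw [map_mul, mul_smul]⟩
  have hmem : ∀ y, orbitMap φ x y ∈ B := by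
    intro y
    obtain ⟨g, rfl⟩ := QuotientGroup.mk_surjective y
    exact (hB _).2 ⟨g, rfl⟩
  let f : G ⧸ stabilizerOf φ x → B := fun y => ⟨orbitMap φ x y, hmem y⟩
  have hbij : Function.Bijective f := by
    refine ⟨fun y y' h => orbitMap_injective φ x (congrArg Subtype.val h), ?_⟩
    rintro ⟨y, hy⟩
    obtain ⟨g, rfl⟩ := (hB y).1 hy
    exact ⟨g, rfl⟩
  have hcont : Continuous f := (continuous_orbitMap hφ x).subtype_mk _
  have hopen : IsOpenMap f := by
    intro V hV
    rw [isOpen_iff_mem_nhds]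
    rintro _ ⟨v, hv, rfl⟩
    rw [nhds_subtype_eq_comap_nhdsWithin]
    refine ⟨_, image_orbitMap_mem_nhdsWithin hinv hx hV hv, ?_⟩
    rintro ⟨y, hy⟩ ⟨w, hw, rfl⟩
    exact ⟨w, hw, rfl⟩
  exact ⟨(Equiv.ofBijective f hbij).toHomeomorphOfContinuousOpen hcont hopen,
    fun g y => orbitMap_smul φ x g y⟩

/-- Local transitivity makes both orbits open in `B`, so their disjoint union carries the sum
topology. -/
theorem isoHomogeneousSum_of_locallyTransitive {φ : G →* GC} (hφ : Continuous φ)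
    {KC : Subgroup GC} {B : Set (GC ⧸ KC)} {x₁ x₂ : GC ⧸ KC}
    (hB : ∀ y, y ∈ B ↔ (∃ g, φ g • x₁ = y) ∨ ∃ g, φ g • x₂ = y)
    (hne : ∀ g, φ g • x₁ ≠ x₂)
    (hx₁ : LocallyTransitiveAt φ B x₁) (hx₂ : LocallyTransitiveAt φ B x₂) :
    IsoHomogeneousSum φ B (stabilizerOf φ x₁) (stabilizerOf φ x₂) := by
  have hinv : ∀ g, ∀ y ∈ B, φ g • y ∈ B := by
    intro g y hy
    obtain ⟨a, rfl⟩ | ⟨a, rfl⟩ := (hB y).1 hy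
    · exact (hB _).2 (.inl ⟨g * a, by rw [map_mul, mul_smul]⟩)
    · exact (hB _).2 (.inr ⟨g * a, by rw [map_mul, mul_smul]⟩)
  have hmem₁ : ∀ y, orbitMap φ x₁ y ∈ B := by
    intro y
    obtain ⟨g, rfl⟩ := QuotientGroup.mk_surjective y
    exact (hB _).2 (.inl ⟨g, rfl⟩)
  have hmem₂ : ∀ y, orbitMap φ x₂ y ∈ B := by
    intro y
    obtain ⟨g, rfl⟩ := QuotientGroup.mk_surjective y
    exact (hB _).2 (.inr ⟨g, rfl⟩)
  have hdis : ∀ y y', orbitMap φ x₁ y ≠ orbitMap φ x₂ y' := by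
    intro y y' h
    obtain ⟨a, rfl⟩ := QuotientGroup.mk_surjective y
    obtain ⟨b, rfl⟩ := QuotientGroup.mk_surjective y'
    rw [orbitMap_mk, orbitMap_mk] at h
    exact hne (b⁻¹ * a) (by rw [map_mul, map_inv, mul_smul, h, inv_smul_smul])
  let f : (G ⧸ stabilizerOf φ x₁) ⊕ (G ⧸ stabilizerOf φ x₂) → B :=
    Sum.elim (fun y => ⟨orbitMap φ x₁ y, hmem₁ y⟩) fun y => ⟨orbitMap φ x₂ y, hmem₂ y⟩
  have hbij : Function.Bijective f := by
    refine ⟨?_, ?_⟩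
    · rintro (y | y) (y' | y') h
      · exact congrArg _ (orbitMap_injective φ x₁ (congrArg Subtype.val h))
      · exact absurd (congrArg Subtype.val h) (hdis y y')
      · exact absurd (congrArg Subtype.val h).symm (hdis y' y)
      · exact congrArg _ (orbitMap_injective φ x₂ (congrArg Subtype.val h))
    · rintro ⟨y, hy⟩
      obtain ⟨g, rfl⟩ | ⟨g, rfl⟩ := (hB y).1 hy
      · exact ⟨.inl g, rfl⟩
      · exact ⟨.inr g, rfl⟩
  have hcont : Continuous f := continuous_sumElim.2
    ⟨(continuous_orbitMap hφ x₁).subtype_mk _, (continuous_orbitMap hφ x₂).subtype_mk _⟩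
  have hopen : IsOpenMap f := by
    intro V hV
    rw [isOpen_iff_mem_nhds]
    rintro _ ⟨v | v, hv, rfl⟩ <;> rw [nhds_subtype_eq_comap_nhdsWithin]
    · refine ⟨_, image_orbitMap_mem_nhdsWithin hinv hx₁ (hV.preimage continuous_inl) hv, ?_⟩
      rintro ⟨y, hy⟩ ⟨w, hw, rfl⟩
      exact ⟨.inl w, hw, rfl⟩
    · refine ⟨_, image_orbitMap_mem_nhdsWithin hinv hx₂ (hV.preimage continuous_inr) hv, ?_⟩
      rintro ⟨y, hy⟩ ⟨w, hw, rfl⟩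
      exact ⟨.inr w, hw, rfl⟩
  exact ⟨(Equiv.ofBijective f hbij).toHomeomorphOfContinuousOpen hcont hopen,
    fun g y => orbitMap_smul φ x₁ g y, fun g y => orbitMap_smul φ x₂ g y⟩

/-- A linear realization of the symmetric space `G_ℂ / K_ℂ` as a space of symmetries `ρ(g) θ ρ(g)⁻¹`
in a Banach algebra. -/
structure LinearRealization {𝒜 : Type*} [NormedRing 𝒜] [NormedAlgebra ℝ 𝒜]
    (D : SymmetryData 𝒜) (φ : G →* GC) (KC : Subgroup GC) where
  /-- the linear representation of `G_ℂ` -/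
  ρ : GC →* 𝒜
  /-- the symmetry at the base point -/
  θ : 𝒜
  continuous_ρ : Continuous ρ
  continuous_φ : Continuous φ
  θ_mul_θ : θ * θ = 1
  τ_θ : D.τ θ = θ
  σ_θ : D.σ θ = θ
  δ_θ : D.δ θ = D.c • θ
  τ_ρ : ∀ g, D.τ (ρ g) = ρ g⁻¹
  δ_ρ : ∀ g, D.δ (ρ g) = ρ g
  σ_φ : ∀ g, D.σ (ρ (φ g)) = ρ (φ g)
  ρ_comm : ∀ k ∈ KC, ρ k * θ = θ * ρ k
  -- Only a local statement is possible: for `SO(p,q;ℂ)` the centralizer of `θ` also contains block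
  -- matrices whose blocks both have determinant `-1`.
  eventually_mem : ∀ᶠ k in 𝓝 (1 : GC), ρ k * θ = θ * ρ k → k ∈ KC
  exists_exp : ∀ U ∈ 𝓝 (1 : G), ∃ V ∈ 𝓝 (0 : 𝒜), ∀ Y ∈ V, D.IsInfinitesimal Y →
    ∃ h ∈ U, ρ (φ h) = NormedSpace.exp Y

namespace LinearRealization

variable {𝒜 : Type*} [NormedRing 𝒜] [NormedAlgebra ℝ 𝒜]
  {D : SymmetryData 𝒜} {φ : G →* GC} {KC : Subgroup GC} (R : LinearRealization D φ KC)

/-- The symmetry of `G_ℂ / K_ℂ` at the point `g K_ℂ`. -/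
def symm (g : GC) : 𝒜 := R.ρ g * R.θ * R.ρ g⁻¹

/-- `z` is of the form `exp(π / 4 • N)`, where `N` has eigenvalues `0`, `±i`, is imaginary, and
anticommutes with `θ`. -/
def IsQuarterTurn (z : GC) (N : 𝒜) : Prop :=
  R.ρ z = NormedSpace.exp ((Real.pi / 4) • N) ∧ N * N * N = -N ∧ D.σ N = -N ∧
    R.θ * N = -(N * R.θ)

omit [IsTopologicalGroup G] [IsTopologicalGroup GC] in
theorem ρ_mul_inv (g : GC) : R.ρ g * R.ρ g⁻¹ = 1 := by rw [← map_mul, mul_inv_cancel, map_one]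

omit [IsTopologicalGroup G] [IsTopologicalGroup GC] in
theorem ρ_inv_mul (g : GC) : R.ρ g⁻¹ * R.ρ g = 1 := by rw [← map_mul, inv_mul_cancel, map_one]

omit [IsTopologicalGroup G] [IsTopologicalGroup GC] in
theorem symm_mul (g h : GC) : R.symm (g * h) = R.ρ g * R.symm h * R.ρ g⁻¹ := by
  simp only [symm, _root_.mul_inv_rev, map_mul, mul_assoc]

omit [IsTopologicalGroup G] [IsTopologicalGroup GC] in
theorem symm_eq_symm_iff (g h : GC) :
    R.symm g = R.symm h ↔ R.ρ (h⁻¹ * g) * R.θ = R.θ * R.ρ (h⁻¹ * g) := by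
  simp only [symm, map_mul]
  constructor
  · intro e
    calc R.ρ h⁻¹ * R.ρ g * R.θ = R.ρ h⁻¹ * (R.ρ g * R.θ * R.ρ g⁻¹) * R.ρ g := by
          simp only [mul_assoc, R.ρ_inv_mul, mul_one]
      _ = (R.ρ h⁻¹ * R.ρ h) * R.θ * (R.ρ h⁻¹ * R.ρ g) := by rw [e]; simp only [mul_assoc]
      _ = _ := by rw [R.ρ_inv_mul, one_mul]
  · intro e
    calc R.ρ g * R.θ * R.ρ g⁻¹ = (R.ρ h * R.ρ h⁻¹) * R.ρ g * R.θ * R.ρ g⁻¹ := by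
          rw [R.ρ_mul_inv, one_mul]
      _ = R.ρ h * (R.ρ h⁻¹ * R.ρ g * R.θ) * R.ρ g⁻¹ := by simp only [mul_assoc]
      _ = R.ρ h * R.θ * R.ρ h⁻¹ * (R.ρ g * R.ρ g⁻¹) := by rw [e]; simp only [mul_assoc]
      _ = _ := by rw [R.ρ_mul_inv, mul_one]

omit [IsTopologicalGroup G] [IsTopologicalGroup GC] in
theorem symm_eq_of_mk_eq {g h : GC} (e : (g : GC ⧸ KC) = h) : R.symm g = R.symm h := by
  rw [symm_eq_symm_iff]
  exact R.ρ_comm _ (QuotientGroup.eq.1 e.symm)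

section
variable [CompleteSpace 𝒜]

omit [IsTopologicalGroup G] [IsTopologicalGroup GC] in
theorem ρ_inv_eq {z : GC} {Y : 𝒜} (h : R.ρ z = NormedSpace.exp Y) :
    R.ρ z⁻¹ = NormedSpace.exp (-Y) := by
  calc R.ρ z⁻¹ = R.ρ z⁻¹ * (R.ρ z * NormedSpace.exp (-Y)) := by
        rw [h, Real.exp_mul_exp_neg, mul_one]
    _ = _ := by rw [← mul_assoc, R.ρ_inv_mul, one_mul]

omit [IsTopologicalGroup G] [IsTopologicalGroup GC] in
-- Since `θ` anticommutes with `N`, it inverts `ρ z`. Hence `ρ(z) θ ρ(z)⁻¹ = ρ(z)² θ = exp(π/2 N)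
-- θ`, and at the angle `π/2` Rodrigues' formula is polynomial in `N`.
theorem symm_of_isQuarterTurn {z : GC} {N : 𝒜} (h : R.IsQuarterTurn z N) :
    R.symm z = (1 + N + N * N) * R.θ := by
  obtain ⟨h1, h2, h3, h4⟩ := h
  have e : R.θ * ((Real.pi / 4) • N) = -((Real.pi / 4) • N * R.θ) := by
    rw [mul_smul_comm, h4, smul_mul_assoc, smul_neg]
  rw [symm, R.ρ_inv_eq h1, mul_assoc, ← Real.exp_neg_conj e, ← mul_assoc, h1,
    ← Real.exp_add_of_commute (Commute.refl _), ← add_smul, ← exp_pi_div_two_smul h2]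
  congr 3
  ring

omit [IsTopologicalGroup G] [IsTopologicalGroup GC] in
-- The angle `π/4` matters for the last condition: at the base point the two products of `J` and
-- `σ(J)` are `(1 + N + N²)²` and `(1 - N + N²)²`, which are `exp(π N)` and `exp(-π N)`. Both equal
-- `1 + 2 N²` because `N³ = -N`. Translation by the real group commutes with `σ`, so the property
-- holds along the orbit.
theorem isSymmetry_of_isQuarterTurn {z : GC} {N : 𝒜} (h : R.IsQuarterTurn z N) (g : G) :
    D.IsSymmetry (R.symm (φ g * z)) := by
  have hJ := R.symm_of_isQuarterTurn h
  obtain ⟨h1, h2, h3, h4⟩ := h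
  have hcomm : R.symm z * D.σ (R.symm z) = D.σ (R.symm z) * R.symm z := by
    have e1 : D.σ (R.symm z) = (1 - N + N * N) * R.θ := by
      rw [hJ, map_mul, map_add, map_add, map_mul, map_one, h3, R.σ_θ, neg_mul_neg, sub_eq_add_neg]
    have e2 : N * R.θ = -(R.θ * N) := by rw [h4, neg_neg]
    have e3 : ∀ X, N * (R.θ * X) = -(R.θ * (N * X)) := by
      intro X; rw [← mul_assoc, e2, neg_mul, mul_assoc]
    have e4 : N * (N * N) = -N := by rw [← mul_assoc, h2]
    rw [e1, hJ]
    have p1 : (1 + N + N * N) * R.θ * ((1 - N + N * N) * R.θ) =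
        (1 + N + N * N) * (1 + N + N * N) := by
      have : R.θ * ((1 - N + N * N) * R.θ) = 1 + N + N * N := by
        simp only [sub_mul, add_mul, one_mul, mul_sub, mul_add, mul_assoc, e2, mul_neg,
          e3, neg_neg, ← mul_assoc R.θ R.θ, R.θ_mul_θ]
        abel
      rw [mul_assoc, this]
    have p2 : (1 - N + N * N) * R.θ * ((1 + N + N * N) * R.θ) =
        (1 - N + N * N) * (1 - N + N * N) := by
      have : R.θ * ((1 + N + N * N) * R.θ) = 1 - N + N * N := by
        simp only [add_mul, one_mul, mul_add, mul_assoc, e2, mul_neg,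
          e3, neg_neg, ← mul_assoc R.θ R.θ, R.θ_mul_θ]
        abel
      rw [mul_assoc, this]
    rw [p1, p2]
    simp only [add_mul, sub_mul, mul_add, mul_sub, one_mul, mul_one, mul_assoc, e4, mul_neg]
    abel
  refine ⟨?_, ?_, ?_, ?_⟩
  · rw [symm]
    calc _ = R.ρ (φ g * z) * R.θ * (R.ρ (φ g * z)⁻¹ * R.ρ (φ g * z)) * R.θ * R.ρ (φ g * z)⁻¹ := by
          simp only [mul_assoc]
      _ = _ := by
          rw [R.ρ_inv_mul, mul_one, mul_assoc (R.ρ _), R.θ_mul_θ, mul_one, R.ρ_mul_inv]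
  · rw [symm, D.τ_mul, D.τ_mul, R.τ_ρ, R.τ_ρ, R.τ_θ, inv_inv, mul_assoc]
  · rw [symm, map_mul, map_mul, R.δ_ρ, R.δ_ρ, R.δ_θ, mul_smul_comm, smul_mul_assoc]
  · rw [symm_mul, map_mul, map_mul, ← map_inv, R.σ_φ, R.σ_φ]
    have e : ∀ X Y : 𝒜, R.ρ (φ g) * X * R.ρ (φ g⁻¹) * (R.ρ (φ g) * Y * R.ρ (φ g⁻¹)) =
        R.ρ (φ g) * (X * Y) * R.ρ (φ g⁻¹) := by
      intro X Y
      calc _ = R.ρ (φ g) * X * (R.ρ (φ g⁻¹) * R.ρ (φ g)) * Y * R.ρ (φ g⁻¹) := by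
            simp only [mul_assoc]
        _ = _ := by rw [map_inv, R.ρ_inv_mul, mul_one, mul_assoc (R.ρ (φ g)) X]
    rw [e, e, hcomm]

/-- A point of `B` near `z` has a symmetry near that of `z`, so `SymmetryData.eventually_conj`
supplies a small element of `G` that matches the two symmetries. The two points then differ by an
element that commutes with `θ` and is close to `1`, hence lies in `K_ℂ`. -/
theorem locallyTransitiveAt {B : Set (GC ⧸ KC)} (hB : ∀ g : GC, (g : GC ⧸ KC) ∈ B →
    D.IsSymmetry (R.symm g)) (x : GC ⧸ KC) (hx : x ∈ B) : LocallyTransitiveAt φ B x := by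
  intro U hU
  obtain ⟨z, rfl⟩ := QuotientGroup.mk_surjective x
  rw [eventually_nhdsWithin_iff]
  have hq : 𝓝 (z : GC ⧸ KC) = map QuotientGroup.mk (𝓝 z) := QuotientGroup.nhds_eq KC z
  rw [hq, eventually_map]
  have c1 : Tendsto (fun p : (G × G) × GC => (φ (p.1.1 * p.1.2) * z)⁻¹ * p.2)
      (𝓝 (((1 : G), (1 : G)), z)) (𝓝 1) := by
    have hφ := R.continuous_φ
    have : Continuous (fun p : (G × G) × GC => (φ (p.1.1 * p.1.2) * z)⁻¹ * p.2) := by fun_prop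
    simpa using this.tendsto (((1 : G), (1 : G)), z)
  have c2 : Tendsto (fun p : G × G => p.1 * p.2) (𝓝 ((1 : G), (1 : G))) (𝓝 1) := by
    simpa using (continuous_mul (M := G)).tendsto (1, 1)
  have c3 := c1.eventually R.eventually_mem
  rw [nhds_prod_eq, nhds_prod_eq] at c3
  rw [nhds_prod_eq] at c2
  obtain ⟨P, hP, Q, hQ, hPQ⟩ := eventually_prod_iff.1 c3
  have hPU := hP.and (c2.eventually hU)
  rw [eventually_prod_self_iff'] at hPU
  obtain ⟨U', hU', hPU⟩ := hPU
  obtain ⟨V, hV, hVe⟩ := R.exists_exp U' hU'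
  have c4 : Continuous R.symm := by
    have := R.continuous_ρ
    unfold symm
    fun_prop
  have c5 := (c4.tendsto z).eventually (D.eventually_conj (hB z hx) hV)
  filter_upwards [c5, hQ] with g hg hQg hgB
  obtain ⟨Y, hY, Z, hZ, hYi, hZi, hYZ⟩ := hg (hB g hgB)
  obtain ⟨h₁, hh₁, e₁⟩ := hVe Y hY hYi
  obtain ⟨h₂, hh₂, e₂⟩ := hVe Z hZ hZi
  obtain ⟨hp, hu⟩ := hPU h₁ hh₁ h₂ hh₂
  refine ⟨h₁ * h₂, hu, ?_⟩
  rw [MulAction.Quotient.smul_coe, smul_eq_mul, QuotientGroup.eq]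
  refine hPQ hp hQg ?_
  rw [← symm_eq_symm_iff, symm_mul, map_mul φ, map_mul R.ρ, e₁, e₂, hYZ, ← e₁, ← e₂,
    ← map_mul R.ρ, mul_assoc, R.ρ_mul_inv, mul_one]

omit [CompleteSpace 𝒜] [IsTopologicalGroup G] in
/-- One-parameter groups which fix the symmetry at `z K_ℂ` fix the point `z K_ℂ`. -/
theorem mem_stabilizerOf_of_commute {z : GC} {X : 𝒜} (hX : X * R.symm z = R.symm z * X)
    {γ : ℝ → G} (hγ : Continuous γ) (hadd : ∀ s t, γ (s + t) = γ s * γ t)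
    (hexp : ∀ t, R.ρ (φ (γ t)) = NormedSpace.exp (t • X)) (t : ℝ) :
    γ t ∈ stabilizerOf φ (z : GC ⧸ KC) := by
  have hφ := R.continuous_φ
  have h0 : γ 0 = 1 := by simpa using hadd 0 0
  have c1 : Tendsto (fun s => z⁻¹ * φ (γ s) * z) (𝓝 0) (𝓝 1) := by
    have : Continuous (fun s => z⁻¹ * φ (γ s) * z) := by fun_prop
    simpa [h0] using this.tendsto 0
  have hcomm : ∀ s, R.ρ (z⁻¹ * φ (γ s) * z) * R.θ = R.θ * R.ρ (z⁻¹ * φ (γ s) * z) := by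
    intro s
    rw [mul_assoc, ← symm_eq_symm_iff, symm_mul, hexp]
    have : Commute (NormedSpace.exp (s • X)) (R.symm z) := by
      let := NormedAlgebra.restrictScalars ℚ ℝ 𝒜
      exact Commute.exp_left (Commute.smul_left hX s)
    rw [this.eq, ← hexp, mul_assoc, R.ρ_mul_inv, mul_one]
  have c2 : ∀ᶠ s in 𝓝 (0 : ℝ), γ s ∈ stabilizerOf φ (z : GC ⧸ KC) := by
    filter_upwards [c1.eventually R.eventually_mem] with s hs
    rw [mem_stabilizerOf_mk]
    exact hs (hcomm s)
  -- So far only small parameters are known to give elements of the stabilizer. A general `γ t` is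
  -- the power `γ(t / n) ^ n` with `t / n` small.
  have c3 : Tendsto (fun n : ℕ => t / n) atTop (𝓝 0) := tendsto_const_div_atTop_nhds_zero_nat t
  obtain ⟨n, hn, hn0⟩ := ((c3.eventually c2).and (eventually_ne_atTop 0)).exists
  have hpow : ∀ k : ℕ, γ (k * (t / n)) = γ (t / n) ^ k := by
    intro k
    induction k with
    | zero => simp [h0]
    | succ k ih => rw [pow_succ, ← ih, ← hadd]; congr 1; push_cast; ring
  have : γ t = γ (t / n) ^ n := by
    rw [← hpow]; congr 1; field_simp
  rw [this]
  exact Subgroup.pow_mem _ hn n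

omit [IsTopologicalGroup G] [IsTopologicalGroup GC] in
-- The relation is the derivative at `t = 0` of the invariance of the symmetry under `exp(t X)`.
theorem commute_of_mem_stabilizerOf {z : GC} {X : 𝒜}
    (h : ∀ t : ℝ, ∃ g ∈ stabilizerOf φ (z : GC ⧸ KC), R.ρ (φ g) = NormedSpace.exp (t • X)) :
    X * R.symm z = R.symm z * X := by
  have h1 : ∀ t : ℝ, NormedSpace.exp (t • X) * R.symm z = R.symm z * NormedSpace.exp (t • X) := by
    intro t
    obtain ⟨g, hg, e⟩ := h t
    have := R.symm_eq_of_mk_eq (g := φ g * z) (h := z) hg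
    rw [symm_mul] at this
    rw [← e]
    conv_rhs => rw [← this]
    rw [mul_assoc, R.ρ_inv_mul, mul_one]
  have d : HasDerivAt (fun t : ℝ => NormedSpace.exp (t • X)) X 0 := by
    simpa using hasDerivAt_exp_smul_const (𝕂 := ℝ) X 0
  have d1 := d.mul_const (R.symm z)
  have d2 := d.const_mul (R.symm z)
  rw [← funext h1] at d2
  exact d1.unique d2

end

end LinearRealization

end Homogeneous

/-! ### Matrix exponentials and infinitesimal isometries. -/

section MatrixExponential

attribute [-instance] LieRing.ofAssociativeRing

open scoped Matrix.Norms.Operator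

variable {ι 𝕜 : Type*} [Fintype ι] [DecidableEq ι] [RCLike 𝕜]

theorem Matrix.continuous_exp : Continuous (NormedSpace.exp : Matrix ι ι 𝕜 → Matrix ι ι 𝕜) :=
  Real.continuous_normedSpaceExp

theorem Matrix.exp_mul_exp_neg (X : Matrix ι ι 𝕜) :
    NormedSpace.exp X * NormedSpace.exp (-X) = 1 := Real.exp_mul_exp_neg X

theorem Matrix.exp_neg_mul_exp (X : Matrix ι ι 𝕜) :
    NormedSpace.exp (-X) * NormedSpace.exp X = 1 := Real.exp_neg_mul_exp X

theorem Matrix.exp_add_smul (X : Matrix ι ι 𝕜) (s t : ℝ) : NormedSpace.exp ((s + t) • X) =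
    NormedSpace.exp (s • X) * NormedSpace.exp (t • X) := by
  rw [add_smul]
  exact Real.exp_add_of_commute (((Commute.refl X).smul_left s).smul_right t)

theorem Matrix.exp_semiconj {S X Y : Matrix ι ι 𝕜} (h : S * X = Y * S) :
    S * NormedSpace.exp X = NormedSpace.exp Y * S := by
  let : NormedAlgebra ℚ (Matrix ι ι 𝕜) := NormedAlgebra.restrictScalars ℚ ℝ _
  exact (show SemiconjBy S X Y from h).exp_right

theorem Matrix.hasDerivAt_exp_smul (X : Matrix ι ι 𝕜) :
    HasDerivAt (fun t : ℝ => NormedSpace.exp (t • X)) X 0 := by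
  simpa using! hasDerivAt_exp_smul_const (𝕂 := ℝ) X 0

theorem Matrix.exp_smul_of_cube_eq_neg {N : Matrix ι ι 𝕜} (hN : N * N * N = -N) (θ : ℝ) :
    NormedSpace.exp (θ • N) = 1 + Real.sin θ • N + (1 - Real.cos θ) • (N * N) :=
  _root_.exp_smul_of_cube_eq_neg hN θ

theorem Matrix.map_exp_ofReal (X : Matrix ι ι ℝ) :
    (NormedSpace.exp X).map (algebraMap ℝ ℂ) = NormedSpace.exp (X.map (algebraMap ℝ ℂ)) := by
  have hc : Continuous ((algebraMap ℝ ℂ).mapMatrix : Matrix ι ι ℝ →+* Matrix ι ι ℂ) :=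
    continuous_id.matrix_map Complex.continuous_ofReal
  exact NormedSpace.map_exp ((algebraMap ℝ ℂ).mapMatrix : Matrix ι ι ℝ →+* Matrix ι ι ℂ) hc X

theorem Matrix.map_exp_conj (X : Matrix ι ι ℂ) :
    (NormedSpace.exp X).map (starRingEnd ℂ) = NormedSpace.exp (X.map (starRingEnd ℂ)) := by
  have hc : Continuous ((starRingEnd ℂ).mapMatrix : Matrix ι ι ℂ →+* Matrix ι ι ℂ) :=
    continuous_id.matrix_map Complex.continuous_conj
  exact NormedSpace.map_exp ((starRingEnd ℂ).mapMatrix : Matrix ι ι ℂ →+* Matrix ι ι ℂ) hc X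

/-- The matrix exponential as a map to the general linear group. -/
def expGL (X : Matrix ι ι 𝕜) : GL ι 𝕜 :=
  ⟨NormedSpace.exp X, NormedSpace.exp (-X), Matrix.exp_mul_exp_neg X, Matrix.exp_neg_mul_exp X⟩

theorem continuous_expGL : Continuous (expGL : Matrix ι ι 𝕜 → GL ι 𝕜) :=
  Units.continuous_iff.2 ⟨Matrix.continuous_exp, Matrix.continuous_exp.comp continuous_neg⟩

theorem expGL_zero : expGL (0 : Matrix ι ι 𝕜) = 1 := Units.ext NormedSpace.exp_zero

theorem expGL_add_smul (X : Matrix ι ι 𝕜) (s t : ℝ) :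
    expGL ((s + t) • X) = expGL (s • X) * expGL (t • X) := Units.ext (Matrix.exp_add_smul X s t)

/-- Infinitesimal isometries of the bilinear form with matrix `S`. -/
def IsSkewFor (S X : Matrix ι ι 𝕜) : Prop := Xᵀ * S + S * X = 0

theorem IsSkewFor.smul {S X : Matrix ι ι 𝕜} (h : IsSkewFor S X) (t : ℝ) :
    IsSkewFor S (t • X) := by
  rw [IsSkewFor, transpose_smul, smul_mul_assoc, mul_smul_comm, ← smul_add, h, smul_zero]

theorem IsSkewFor.exp_isometry {S X : Matrix ι ι 𝕜} (h : IsSkewFor S X) :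
    (NormedSpace.exp X)ᵀ * S * NormedSpace.exp X = S := by
  have h1 : S * X = (-Xᵀ) * S := by rw [neg_mul]; exact eq_neg_of_add_eq_zero_right h
  rw [mul_assoc, Matrix.exp_semiconj h1, ← Matrix.exp_transpose, ← mul_assoc,
    Matrix.exp_mul_exp_neg, one_mul]

theorem det_sq_of_isometry {S g : Matrix ι ι 𝕜} (hS : S.det ≠ 0) (h : gᵀ * S * g = S) :
    g.det * g.det = 1 := by
  have := congrArg det h
  rw [det_mul, det_mul, det_transpose] at this
  refine mul_right_cancel₀ hS ?_
  rw [one_mul]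
  linear_combination this

/-- The matrix `exp X` is the square of the isometry `exp(X / 2)`, whose determinant squares to `1`.
-/
theorem IsSkewFor.det_exp {S X : Matrix ι ι 𝕜} (hS : S.det ≠ 0) (h : IsSkewFor S X) :
    (NormedSpace.exp X).det = 1 := by
  have : NormedSpace.exp X = NormedSpace.exp ((1 / 2 : ℝ) • X) * NormedSpace.exp ((1 / 2 : ℝ) • X) := by
    rw [← Matrix.exp_add_smul]
    norm_num
  rw [this, det_mul]
  exact det_sq_of_isometry hS (h.smul _).exp_isometry

theorem isSkewFor_of_exp {S X : Matrix ι ι 𝕜} (h : ∀ t : ℝ,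
    (NormedSpace.exp (t • X))ᵀ * S * NormedSpace.exp (t • X) = S) : IsSkewFor S X := by
  have h1 : ∀ t : ℝ, NormedSpace.exp (t • Xᵀ) * S = S * NormedSpace.exp (t • -X) := by
    intro t
    rw [← transpose_smul, Matrix.exp_transpose]
    calc _ = (NormedSpace.exp (t • X))ᵀ * S * (NormedSpace.exp (t • X) *
          NormedSpace.exp (-(t • X))) := by rw [Matrix.exp_mul_exp_neg, mul_one]
      _ = _ := by rw [← mul_assoc, h, smul_neg]
  have d1 := (Matrix.hasDerivAt_exp_smul Xᵀ).mul_const S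
  have d2 := (Matrix.hasDerivAt_exp_smul (-X)).const_mul S
  rw [← funext h1] at d2
  have := d1.unique d2
  rw [IsSkewFor, this, mul_neg, neg_add_cancel]

end MatrixExponential

theorem Matrix.eq_zero_of_eq_neg {m n : Type*} {B : Matrix m n ℂ} (h : B = -B) : B = 0 := by
  ext i j
  exact self_eq_neg.1 (congrFun (congrFun h i) j)

/-! ### The form `I_{p,q}` and the realization of `SO(p,q;ℂ) / K_ℂ` by symmetries. -/

section SignMatrix

variable (p q : ℕ) (𝕜 : Type*) [RCLike 𝕜]

theorem signMatrix_mul_self : signMatrix p q 𝕜 * signMatrix p q 𝕜 = 1 := by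
  simp [signMatrix, fromBlocks_multiply]

theorem signMatrix_transpose : (signMatrix p q 𝕜)ᵀ = signMatrix p q 𝕜 := by
  simp [signMatrix, fromBlocks_transpose]

theorem det_signMatrix_ne_zero : (signMatrix p q 𝕜).det ≠ 0 := by
  intro h
  have := congrArg det (signMatrix_mul_self p q 𝕜)
  simp [h] at this

theorem map_signMatrix {𝕜 𝕜' : Type*} [RCLike 𝕜] [RCLike 𝕜'] (f : 𝕜 →+* 𝕜') :
    (signMatrix p q 𝕜).map f = signMatrix p q 𝕜' := by
  rw [signMatrix, signMatrix, fromBlocks_map]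
  congr 1
  · exact Matrix.map_one _ (map_zero f) (map_one f)
  · exact Matrix.map_zero _ (map_zero f)
  · exact Matrix.map_zero _ (map_zero f)
  · ext i j
    rcases eq_or_ne i j with rfl | h <;> simp [*]

end SignMatrix

section SOpq

attribute [-instance] LieRing.ofAssociativeRing

variable {p q : ℕ} {𝕜 : Type*} [RCLike 𝕜]

theorem IsSkewFor.expGL_mem_SOpq {X : Matrix (Fin p ⊕ Fin q) (Fin p ⊕ Fin q) 𝕜}
    (h : IsSkewFor (signMatrix p q 𝕜) X) : expGL X ∈ SOpq p q 𝕜 :=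
  ⟨h.exp_isometry, h.det_exp (det_signMatrix_ne_zero p q 𝕜)⟩

theorem mem_SOe_iff (g : GL (Fin p ⊕ Fin q) ℝ) :
    g ∈ SOe p q ↔ ∃ h : g ∈ SOpq p q ℝ, (⟨g, h⟩ : SOpq p q ℝ) ∈ connectedComponent 1 := by
  constructor
  · rintro ⟨x, hx, rfl⟩
    exact ⟨x.2, hx⟩
  · rintro ⟨h, hx⟩
    exact ⟨⟨g, h⟩, hx, rfl⟩

/-- The path `t ↦ exp(t X)` joins `1` to `exp X` inside `SO(p,q)`. -/
theorem IsSkewFor.expGL_mem_SOe {X : Matrix (Fin p ⊕ Fin q) (Fin p ⊕ Fin q) ℝ}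
    (h : IsSkewFor (signMatrix p q ℝ) X) : expGL X ∈ SOe p q := by
  rw [mem_SOe_iff]
  refine ⟨h.expGL_mem_SOpq, ?_⟩
  let γ : ℝ → SOpq p q ℝ := fun t => ⟨expGL (t • X), (h.smul t).expGL_mem_SOpq⟩
  have hγ : Continuous γ :=
    (continuous_expGL.comp (continuous_id.smul continuous_const)).subtype_mk _
  have h0 : γ 0 = 1 := Subtype.ext (by simp [γ, expGL_zero])
  have h1 : γ 1 = ⟨expGL X, h.expGL_mem_SOpq⟩ := Subtype.ext (by simp [γ])
  rw [← h1]
  exact (isPreconnected_range hγ).subset_connectedComponent ⟨0, h0⟩ ⟨1, rfl⟩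

open scoped Matrix.Norms.Operator in
/-- The symmetry data of `SO(p, q; ℂ)` with its real form `SO(p, q)`. -/
def symmetryDataPQ (p q : ℕ) : SymmetryData (Matrix (Fin p ⊕ Fin q) (Fin p ⊕ Fin q) ℂ) where
  σ := (Complex.conjAe : ℂ →ₐ[ℝ] ℂ).mapMatrix
  -- The grading plays no role here. It is needed for `SO(m,ℂ) × SO(m,ℂ)`, where it singles out
  -- block diagonal matrices.
  δ := AlgHom.id ℝ _
  τ := { toFun := fun X => signMatrix p q ℂ * Xᵀ * signMatrix p q ℂ
         map_add' := fun X Y => by rw [transpose_add, mul_add, add_mul]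
         map_smul' := fun c X => by
          rw [transpose_smul, mul_smul_comm, smul_mul_assoc, RingHom.id_apply] }
  c := 1
  continuous_σ := continuous_id.matrix_map Complex.continuous_conj
  continuous_δ := continuous_id
  continuous_τ := (continuous_const.matrix_mul continuous_id.matrix_transpose).matrix_mul
    continuous_const
  σ_σ X := by ext i j; simp
  τ_σ X := by
    have h := map_signMatrix p q (starRingEnd ℂ)
    have h1 : (Complex.conjAe : ℂ →ₐ[ℝ] ℂ).mapMatrix (signMatrix p q ℂ) = signMatrix p q ℂ := h
    simp only [LinearMap.coe_mk, AddHom.coe_mk, map_mul, h1]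
    rfl
  δ_σ X := rfl
  τ_one := by simp [signMatrix_mul_self]
  τ_mul X Y := by
    simp only [LinearMap.coe_mk, AddHom.coe_mk, transpose_mul]
    calc _ = signMatrix p q ℂ * Yᵀ * 1 * Xᵀ * signMatrix p q ℂ := by
          simp only [mul_one, mul_assoc]
      _ = _ := by rw [← signMatrix_mul_self]; simp only [mul_assoc]
  c_mul_c := one_mul 1

open scoped Matrix.Norms.Operator in
theorem symmetryDataPQ_σ (X : Matrix (Fin p ⊕ Fin q) (Fin p ⊕ Fin q) ℂ) :
    (symmetryDataPQ p q).σ X = X.map (starRingEnd ℂ) := rfl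

open scoped Matrix.Norms.Operator in
theorem symmetryDataPQ_τ (X : Matrix (Fin p ⊕ Fin q) (Fin p ⊕ Fin q) ℂ) :
    (symmetryDataPQ p q).τ X = signMatrix p q ℂ * Xᵀ * signMatrix p q ℂ := rfl

theorem SOpq_inv_eq (g : SOpq p q 𝕜) :
    (g⁻¹).val.val = signMatrix p q 𝕜 * g.val.valᵀ * signMatrix p q 𝕜 := by
  have h : g.val.val * (g⁻¹).val.val = 1 := g.val.mul_inv
  calc (g⁻¹).val.val = signMatrix p q 𝕜 * (g.val.valᵀ * signMatrix p q 𝕜 * g.val.val) *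
        (g⁻¹).val.val := by rw [g.2.1, signMatrix_mul_self, one_mul]
    _ = signMatrix p q 𝕜 * g.val.valᵀ * signMatrix p q 𝕜 * (g.val.val * (g⁻¹).val.val) := by
      simp only [mul_assoc]
    _ = _ := by rw [h, mul_one]

theorem continuous_SOeToComplex : Continuous (SOeToComplex p q) := by
  refine Continuous.subtype_mk ?_ _
  have hc : Continuous fun X : Matrix (Fin p ⊕ Fin q) (Fin p ⊕ Fin q) ℝ =>
      X.map (algebraMap ℝ ℂ) := continuous_id.matrix_map Complex.continuous_ofReal
  exact Units.continuous_iff.2 ⟨hc.comp (Units.continuous_val.comp continuous_subtype_val),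
    hc.comp (Units.continuous_coe_inv.comp continuous_subtype_val)⟩

theorem KCpq_comm {k : SOpq p q ℂ} (hk : k ∈ KCpq p q) :
    k.val.val * signMatrix p q ℂ = signMatrix p q ℂ * k.val.val := by
  obtain ⟨A, D, -, -, h⟩ := hk
  rw [h, signMatrix, fromBlocks_multiply, fromBlocks_multiply]
  simp

/-- Commuting with `I_{p,q}` forces block diagonal form with orthogonal blocks. The determinant of
the first block is then `±1`, and `-1` is excluded near the identity by continuity. The second
determinant follows because the product is `1`. -/
theorem eventually_mem_KCpq : ∀ᶠ k in 𝓝 (1 : SOpq p q ℂ),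
    k.val.val * signMatrix p q ℂ = signMatrix p q ℂ * k.val.val → k ∈ KCpq p q := by
  have hc : Continuous fun k : SOpq p q ℂ => (k.val.val.toBlocks₁₁).det := by
    refine Continuous.matrix_det ?_
    exact (Units.continuous_val.comp continuous_subtype_val).matrix_submatrix _ _
  have h1 : ∀ᶠ k in 𝓝 (1 : SOpq p q ℂ), (k.val.val.toBlocks₁₁).det ≠ -1 := by
    refine (hc.tendsto 1).eventually_ne ?_
    have : (((1 : SOpq p q ℂ).val.val).toBlocks₁₁).det = 1 := by
      have : ((1 : SOpq p q ℂ).val.val).toBlocks₁₁ = 1 := by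
        ext i j; simp [toBlocks₁₁, one_apply]
      rw [this, det_one]
    rw [this]
    norm_num
  filter_upwards [h1] with k hk hcomm
  obtain ⟨hk1, hk2⟩ := k.2
  obtain ⟨A, B, C, D, h⟩ : ∃ A B C D, k.val.val = fromBlocks A B C D :=
    ⟨_, _, _, _, (fromBlocks_toBlocks _).symm⟩
  rw [h, signMatrix, fromBlocks_multiply, fromBlocks_multiply, fromBlocks_inj] at hcomm
  obtain ⟨-, hB, hC, -⟩ := hcomm
  have hB : B = 0 := Matrix.eq_zero_of_eq_neg (by simpa [eq_comm] using hB)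
  have hC : C = 0 := Matrix.eq_zero_of_eq_neg (by simpa [eq_comm] using hC)
  subst hB hC
  rw [h, toBlocks_fromBlocks₁₁] at hk
  rw [h, signMatrix, fromBlocks_transpose, fromBlocks_multiply, fromBlocks_multiply,
    fromBlocks_inj] at hk1
  rw [h, det_fromBlocks_zero₂₁] at hk2
  have hA : Aᵀ * A = 1 := by simpa using hk1.1
  have hA1 : A.det = 1 := by
    have := congrArg det hA
    rw [det_mul, det_transpose, det_one] at this
    exact (mul_self_eq_one_iff.1 this).resolve_right hk
  rw [hA1, one_mul] at hk2
  exact ⟨A, D, hA1, hk2, h⟩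

theorem isSkewFor_iff_of_map {X : Matrix (Fin p ⊕ Fin q) (Fin p ⊕ Fin q) ℝ} :
    IsSkewFor (signMatrix p q ℝ) X ↔
      IsSkewFor (signMatrix p q ℂ) (X.map (algebraMap ℝ ℂ)) := by
  have hinj : Function.Injective fun Y : Matrix (Fin p ⊕ Fin q) (Fin p ⊕ Fin q) ℝ =>
      Y.map (algebraMap ℝ ℂ) := Matrix.map_injective Complex.ofReal_injective
  have e : (Xᵀ * signMatrix p q ℝ + signMatrix p q ℝ * X).map (algebraMap ℝ ℂ) =
      (X.map (algebraMap ℝ ℂ))ᵀ * signMatrix p q ℂ +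
        signMatrix p q ℂ * X.map (algebraMap ℝ ℂ) := by
    rw [Matrix.map_add _ (map_add _), Matrix.map_mul, Matrix.map_mul, map_signMatrix]
    rfl
  rw [IsSkewFor, IsSkewFor, ← e]
  constructor
  · intro h; rw [h]; exact Matrix.map_zero _ (map_zero _)
  · intro h; exact hinj (h.trans (Matrix.map_zero _ (map_zero _)).symm)

open scoped Matrix.Norms.Operator in
/-- The realization of `SO(p, q; ℂ) / (SO(p, ℂ) × SO(q, ℂ))` by symmetries. -/
def realizationPQ (p q : ℕ) :
    LinearRealization (symmetryDataPQ p q) (SOeToComplex p q) (KCpq p q) where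
  ρ := (Units.coeHom _).comp (SOpq p q ℂ).subtype
  θ := signMatrix p q ℂ
  continuous_ρ := Units.continuous_val.comp continuous_subtype_val
  continuous_φ := continuous_SOeToComplex
  θ_mul_θ := signMatrix_mul_self p q ℂ
  τ_θ := by
    rw [symmetryDataPQ_τ, signMatrix_transpose, signMatrix_mul_self, one_mul]
  σ_θ := map_signMatrix p q (starRingEnd ℂ)
  δ_θ := (one_smul ℝ _).symm
  τ_ρ g := (SOpq_inv_eq g).symm
  δ_ρ g := rfl
  σ_φ g := by
    rw [symmetryDataPQ_σ]
    ext i j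
    exact Complex.conj_ofReal _
  ρ_comm k hk := KCpq_comm hk
  eventually_mem := eventually_mem_KCpq
  exists_exp U hU := by
    let E : {X : Matrix (Fin p ⊕ Fin q) (Fin p ⊕ Fin q) ℝ // IsSkewFor (signMatrix p q ℝ) X} →
        SOe p q := fun X => ⟨expGL X.1, X.2.expGL_mem_SOe⟩
    have hE : Continuous E := (continuous_expGL.comp continuous_subtype_val).subtype_mk _
    have h0 : IsSkewFor (signMatrix p q ℝ) 0 := by simp [IsSkewFor]
    have hE0 : E ⟨0, h0⟩ = 1 := Subtype.ext expGL_zero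
    have h1 : E ⁻¹' U ∈ 𝓝 (⟨0, h0⟩ : {X // IsSkewFor (signMatrix p q ℝ) X}) :=
      hE.continuousAt.preimage_mem_nhds (by rwa [hE0])
    rw [nhds_subtype_eq_comap, mem_comap] at h1
    obtain ⟨W, hW, hWU⟩ := h1
    -- An infinitesimal `Y` is fixed by complex conjugation, hence real. Taking real parts is a
    -- continuous way to regard it as an element of `𝔰𝔬(p,q)`.
    have hre : Continuous fun X : Matrix (Fin p ⊕ Fin q) (Fin p ⊕ Fin q) ℂ => X.map Complex.re :=
      continuous_id.matrix_map Complex.continuous_re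
    refine ⟨(fun X => X.map Complex.re) ⁻¹' W, hre.continuousAt.preimage_mem_nhds ?_, ?_⟩
    · rwa [Matrix.map_zero _ Complex.zero_re]
    · rintro Y hY ⟨hσ, hτ, -⟩
      have hYre : (Y.map Complex.re).map (algebraMap ℝ ℂ) = Y := by
        ext i j
        exact Complex.conj_eq_iff_re.1 (congrFun (congrFun hσ i) j)
      have hsk : IsSkewFor (signMatrix p q ℝ) (Y.map Complex.re) := by
        rw [isSkewFor_iff_of_map, hYre, IsSkewFor]
        rw [symmetryDataPQ_τ] at hτ
        calc _ = signMatrix p q ℂ * (signMatrix p q ℂ * Yᵀ * signMatrix p q ℂ) +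
              signMatrix p q ℂ * Y := by
              rw [mul_assoc (signMatrix p q ℂ), ← mul_assoc (signMatrix p q ℂ) (signMatrix p q ℂ),
                signMatrix_mul_self, one_mul]
          _ = 0 := by rw [hτ, mul_neg, neg_add_cancel]
      refine ⟨E ⟨_, hsk⟩, hWU hY, ?_⟩
      refine (Matrix.map_exp_ofReal _).trans ?_
      rw [hYre]
      rfl

end SOpq

/-! ### The domain `Ω₀` is a cube, and its extreme points are the vertices. -/

section Cube

open scoped Matrix.Norms.Operator in
theorem linfty_opNorm_lt {ι : Type*} [Fintype ι] [DecidableEq ι] {A : Matrix ι ι ℂ} {c : ℝ}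
    (hc : 0 < c) (h : ∀ i, ∑ j, ‖A i j‖ < c) : ‖A‖ < c := by
  lift c to NNReal using hc.le
  rw [Matrix.linfty_opNorm_def, NNReal.coe_lt_coe, Finset.sup_lt_iff (by exact_mod_cast hc)]
  intro i _
  have := h i
  rw [← NNReal.coe_lt_coe]
  push_cast
  exact this

/-- A set of restricted roots which contains the forms `2 e_j` and is bounded by the operator norm
cuts out a cube. -/
theorem crownPolytope_eq_cube {ι : Type*} [Fintype ι] [DecidableEq ι] {r : ℕ}
    {𝔰 : LieSubalgebra ℝ (Matrix ι ι ℂ)} {a : (Fin r → ℝ) →ₗ[ℝ] Matrix ι ι ℂ}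
    (hrow : ∀ (t : Fin r → ℝ) (c : ℝ), 0 < c → (∀ j, |t j| < c) → ∀ i, ∑ k, ‖a t i k‖ < c)
    (hroot : ∀ j, ∃ Z ∈ 𝔰, Z ≠ 0 ∧ ∀ t, a t * Z - Z * a t = (2 * t j) • Z) :
    crownPolytope (restrictedRoots 𝔰 a) = Set.univ.pi fun _ => Set.Ioo (-(Real.pi / 4)) (Real.pi / 4) := by
  ext t
  simp only [crownPolytope, Set.mem_ofPred_eq, Set.mem_univ_pi, Set.mem_Ioo, ← abs_lt]
  constructor
  · intro h j
    obtain ⟨Z, hZ, hZ0, hZt⟩ := hroot j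
    have := h ((2 : ℝ) • LinearMap.proj j) ⟨?_, Z, hZ, hZ0,
        fun t => by simpa [Ring.lie_def] using hZt t⟩
    · simp only [LinearMap.smul_apply, LinearMap.proj_apply, smul_eq_mul, abs_mul, abs_two] at this
      linarith
    · intro h0
      have := LinearMap.congr_fun h0 (Pi.single j 1)
      simp at this
  -- An eigenvalue of `ad (a t)` is at most `2 ‖a t‖` in the norm given by maximal row sums, and
  -- this norm is below `π/4` on the cube. So no complete list of the roots is needed.
  · rintro h α ⟨-, Z, -, hZ0, hZt⟩
    have hn := linfty_opNorm_lt (by positivity) (hrow t _ (by positivity) h)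
    have h1 := hZt t
    rw [Ring.lie_def] at h1
    open scoped Matrix.Norms.Operator in
    have hZ : 0 < ‖Z‖ := norm_pos_iff.2 hZ0
    open scoped Matrix.Norms.Operator in
    have h2 : |α t| * ‖Z‖ ≤ 2 * ‖a t‖ * ‖Z‖ := by
      calc |α t| * ‖Z‖ = ‖a t * Z - Z * a t‖ := by rw [h1, norm_smul, Real.norm_eq_abs]
        _ ≤ ‖a t * Z‖ + ‖Z * a t‖ := norm_sub_le _ _
        _ ≤ ‖a t‖ * ‖Z‖ + ‖Z‖ * ‖a t‖ := add_le_add (norm_mul_le _ _) (norm_mul_le _ _)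
        _ = _ := by ring
    have h3 := le_of_mul_le_mul_right h2 hZ
    linarith

theorem extremePoints_closure_cube (r : ℕ) (t : Fin r → ℝ) :
    t ∈ (closure (Set.univ.pi fun _ : Fin r => Set.Ioo (-(Real.pi / 4)) (Real.pi / 4))).extremePoints ℝ ↔
      ∃ ε : Fin r → ℤˣ, t = fun j => ((ε j : ℤ) : ℝ) * (Real.pi / 4) := by
  have hpi : -(Real.pi / 4) < Real.pi / 4 := by have := Real.pi_pos; linarith
  rw [closure_pi_set]
  simp only [closure_Ioo hpi.ne]
  rw [extremePoints_pi]
  simp only [Set.extremePoints_Icc hpi.le, Set.mem_univ_pi, Set.mem_insert_iff,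
    Set.mem_singleton_iff]
  constructor
  · intro h
    refine ⟨fun j => if t j = Real.pi / 4 then 1 else -1, funext fun j => ?_⟩
    rcases h j with h | h
    · have : ¬ t j = Real.pi / 4 := by rw [h]; exact hpi.ne
      simp only [if_neg this]
      simp [h]
    · simp [h]
  · rintro ⟨ε, rfl⟩ j
    rcases Int.units_eq_one_or (ε j) with h | h <;> simp [h]

end Cube

/-! ### Diagonal sign matrices, and those among them that lie in `SO_e(p,q)`. -/

section Signs

attribute [-instance] LieRing.ofAssociativeRing

variable {𝕜 : Type*} [RCLike 𝕜]

/-- Diagonal matrices with entries `±1`. -/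
def diagonalSign {ι : Type*} [Fintype ι] [DecidableEq ι] (𝕜 : Type*) [RCLike 𝕜] :
    (ι → ℤˣ) →* Matrix ι ι 𝕜 where
  toFun d := diagonal fun i => ((d i : ℤ) : 𝕜)
  map_one' := by simp
  map_mul' d e := by simp [diagonal_mul_diagonal]

theorem diagonalSign_apply {ι : Type*} [Fintype ι] [DecidableEq ι] (d : ι → ℤˣ) :
    diagonalSign 𝕜 d = diagonal fun i => ((d i : ℤ) : 𝕜) := rfl

theorem det_diagonalSign {ι : Type*} [Fintype ι] [DecidableEq ι] (d : ι → ℤˣ) :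
    (diagonalSign 𝕜 d).det = (((∏ i, d i : ℤˣ) : ℤ) : 𝕜) := by
  simp [diagonalSign_apply]

theorem transpose_diagonalSign {ι : Type*} [Fintype ι] [DecidableEq ι] (d : ι → ℤˣ) :
    (diagonalSign 𝕜 d)ᵀ = diagonalSign 𝕜 d := by
  simp [diagonalSign_apply]

theorem diagonalSign_mul_self {ι : Type*} [Fintype ι] [DecidableEq ι] (d : ι → ℤˣ) :
    diagonalSign 𝕜 d * diagonalSign 𝕜 d = 1 := by
  rw [← map_mul, show d * d = 1 from funext fun i => Int.units_mul_self (d i), map_one]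

theorem map_diagonalSign {ι 𝕜' : Type*} [Fintype ι] [DecidableEq ι] [RCLike 𝕜'] (f : 𝕜 →+* 𝕜')
    (d : ι → ℤˣ) : (diagonalSign 𝕜 d).map f = diagonalSign 𝕜' d := by
  rw [diagonalSign_apply, diagonal_map (map_zero f)]
  simp [diagonalSign_apply]

/-- The matrices `diag(1, d)` with `d` a diagonal matrix with entries `±1`. -/
def blockSign (p : ℕ) {q : ℕ} (𝕜 : Type*) [RCLike 𝕜] :
    (Fin q → ℤˣ) →* Matrix (Fin p ⊕ Fin q) (Fin p ⊕ Fin q) 𝕜 where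
  toFun d := fromBlocks 1 0 0 (diagonalSign 𝕜 d)
  map_one' := by simp
  map_mul' d e := by simp [fromBlocks_multiply]

variable {p q : ℕ}

theorem blockSign_apply (d : Fin q → ℤˣ) :
    blockSign p 𝕜 d = fromBlocks 1 0 0 (diagonalSign 𝕜 d) := rfl

theorem blockSign_mul_self (d : Fin q → ℤˣ) : blockSign p 𝕜 d * blockSign p 𝕜 d = 1 := by
  rw [← map_mul, show d * d = 1 from funext fun i => Int.units_mul_self (d i), map_one]

theorem det_blockSign (d : Fin q → ℤˣ) :
    (blockSign p 𝕜 d).det = (((∏ i, d i : ℤˣ) : ℤ) : 𝕜) := by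
  rw [blockSign_apply, det_fromBlocks_zero₂₁, det_one, one_mul, det_diagonalSign]

theorem transpose_blockSign (d : Fin q → ℤˣ) : (blockSign p 𝕜 d)ᵀ = blockSign p 𝕜 d := by
  rw [blockSign_apply, fromBlocks_transpose, transpose_diagonalSign]
  simp

theorem map_blockSign {𝕜' : Type*} [RCLike 𝕜'] (f : 𝕜 →+* 𝕜') (d : Fin q → ℤˣ) :
    (blockSign p 𝕜 d).map f = blockSign p 𝕜' d := by
  rw [blockSign_apply, fromBlocks_map, map_diagonalSign, blockSign_apply,
    Matrix.map_one _ (map_zero f) (map_one f), Matrix.map_zero _ (map_zero f),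
    Matrix.map_zero _ (map_zero f)]

theorem blockSign_comm_signMatrix (d : Fin q → ℤˣ) :
    blockSign p 𝕜 d * signMatrix p q 𝕜 = signMatrix p q 𝕜 * blockSign p 𝕜 d := by
  simp [blockSign_apply, signMatrix, fromBlocks_multiply]

/-- `diag(1, d)` as an invertible matrix. -/
def blockSignGL (p : ℕ) {q : ℕ} (𝕜 : Type*) [RCLike 𝕜] (d : Fin q → ℤˣ) : GL (Fin p ⊕ Fin q) 𝕜 :=
  ⟨blockSign p 𝕜 d, blockSign p 𝕜 d, blockSign_mul_self d, blockSign_mul_self d⟩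

theorem blockSignGL_mul (d e : Fin q → ℤˣ) :
    blockSignGL p 𝕜 (d * e) = blockSignGL p 𝕜 d * blockSignGL p 𝕜 e := Units.ext (map_mul _ _ _)

theorem blockSignGL_inv (d : Fin q → ℤˣ) : (blockSignGL p 𝕜 d)⁻¹ = blockSignGL p 𝕜 d :=
  Units.ext rfl

theorem blockSign_isometry (d : Fin q → ℤˣ) :
    (blockSign p 𝕜 d)ᵀ * signMatrix p q 𝕜 * blockSign p 𝕜 d = signMatrix p q 𝕜 := by
  rw [transpose_blockSign, blockSign_comm_signMatrix, mul_assoc, blockSign_mul_self, mul_one]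

/-- Changing two signs of the second block is the rotation by `π` in the plane of the coordinates
`a` and `b`: by Rodrigues' formula `exp(π Y) = 1 + 2 Y²`, where `-Y²` is the projection to that
plane. -/
theorem blockSignGL_pair_mem_SOe {a b : Fin q} (hab : a ≠ b) :
    blockSignGL p ℝ (Pi.mulSingle a (-1) * Pi.mulSingle b (-1)) ∈ SOe p q := by
  set y : Matrix (Fin q) (Fin q) ℝ := single a b 1 - single b a 1 with hy
  have hyy : y * y = -(single a a 1 + single b b 1) := by
    simp only [hy, sub_mul, mul_sub, single_mul_single_same, mul_one,
      single_mul_single_of_ne _ _ _ _ hab, single_mul_single_of_ne _ _ _ _ hab.symm]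
    abel
  have hyyy : y * y * y = -y := by
    rw [hyy]
    simp only [hy, mul_sub, neg_mul, add_mul, single_mul_single_same, mul_one,
      single_mul_single_of_ne _ _ _ _ hab, single_mul_single_of_ne _ _ _ _ hab.symm]
    abel
  set Y : Matrix (Fin p ⊕ Fin q) (Fin p ⊕ Fin q) ℝ := fromBlocks 0 0 0 y with hY
  have hYY : Y * Y = fromBlocks 0 0 0 (y * y) := by simp [hY, fromBlocks_multiply]
  have hYYY : Y * Y * Y = -Y := by
    rw [hYY, hY, fromBlocks_multiply, fromBlocks_neg]; simp [hyyy]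
  have hsk : IsSkewFor (signMatrix p q ℝ) Y := by
    rw [IsSkewFor, hY, signMatrix, fromBlocks_transpose, fromBlocks_multiply, fromBlocks_multiply,
      fromBlocks_add]
    simp [hy]
  have hexp : expGL (Real.pi • Y) = blockSignGL p ℝ (Pi.mulSingle a (-1) * Pi.mulSingle b (-1)) := by
    refine Units.ext ?_
    change NormedSpace.exp (Real.pi • Y) = fromBlocks 1 0 0 (diagonalSign ℝ _)
    rw [Matrix.exp_smul_of_cube_eq_neg hYYY, Real.sin_pi, Real.cos_pi, zero_smul, add_zero, hYY,
      ← fromBlocks_one, fromBlocks_smul, fromBlocks_add]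
    congr 1 <;> try simp
    rw [hyy]
    ext i j
    rcases eq_or_ne i j with rfl | hij
    · rcases eq_or_ne i a with rfl | hia
      · simp [diagonalSign_apply, hab, hab.symm]
      · rcases eq_or_ne i b with rfl | hib
        · simp [diagonalSign_apply, hia, hia.symm]
        · simp [diagonalSign_apply, hia, hib, hia.symm, hib.symm]
    · have h1 : ∀ c : Fin q, ¬(c = i ∧ c = j) := fun c h => hij (h.1.symm.trans h.2)
      simp [diagonalSign_apply, hij, h1]
  rw [← hexp]
  exact (hsk.smul _).expGL_mem_SOe

theorem blockSignGL_mem_SOe {d : Fin q → ℤˣ} (hd : ∏ i, d i = 1) :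
    blockSignGL p ℝ d ∈ SOe p q := by
  let f : (Fin q → ℤˣ) →* GL (Fin p ⊕ Fin q) ℝ :=
    { toFun := blockSignGL p ℝ
      map_one' := Units.ext (map_one _)
      map_mul' := blockSignGL_mul }
  rcases isEmpty_or_nonempty (Fin q) with hq | ⟨⟨a⟩⟩
  · rw [Subsingleton.elim d 1]
    exact (show f 1 ∈ SOe p q from f.map_one ▸ one_mem _)
  -- Each sign `d i` is paired with the same sign at a fixed index `a`. The signs collected at `a`
  -- multiply to `∏ d i = 1`, so the product of all pairs is `d`.
  have h1 : ∀ (i : Fin q) (u : ℤˣ), Pi.mulSingle i u * Pi.mulSingle a u ∈ (SOe p q).comap f := by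
    intro i u
    rcases Int.units_eq_one_or u with rfl | rfl
    · simp
    · rcases eq_or_ne i a with rfl | hia
      · rw [← Pi.mulSingle_mul, Int.units_mul_self, Pi.mulSingle_one]
        exact one_mem _
      · exact blockSignGL_pair_mem_SOe hia
  have h2 : ∏ i, (Pi.mulSingle i (d i) * Pi.mulSingle a (d i)) ∈ (SOe p q).comap f :=
    Subgroup.prod_mem _ fun i _ => h1 i (d i)
  have h3 : ∏ i, (Pi.mulSingle a (d i) : Fin q → ℤˣ) = 1 := by
    have := map_prod (MonoidHom.mulSingle (fun _ : Fin q => ℤˣ) a) d Finset.univ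
    rw [hd, map_one] at this
    exact this.symm
  rw [Finset.prod_mul_distrib, Finset.univ_prod_mulSingle, h3, mul_one] at h2
  exact h2

end Signs

/-! ### The subspace `𝔞` of `𝔰𝔬(p,q)` in block form, its root vectors in `𝔰𝔲(p,q)`, and the vertices
of the cube. -/

section PartnerMatrix

attribute [-instance] LieRing.ofAssociativeRing

variable {p q : ℕ}

/-- The index in the second block which `𝔞` couples to the `j`-th index of the first block. -/
def partner (h : p ≤ q) (j : Fin p) : Fin q := (Fin.castLE h j).rev

theorem partner_injective (h : p ≤ q) : Function.Injective (partner h) := fun _ _ e =>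
  Fin.castLE_injective h (Fin.rev_injective e)

/-- The matrix of the coupling `partner`. -/
def partnerMatrix (h : p ≤ q) (𝕜 : Type*) [RCLike 𝕜] : Matrix (Fin p) (Fin q) 𝕜 :=
  of fun j k => if k = partner h j then 1 else 0

variable (h : p ≤ q) {𝕜 : Type*} [RCLike 𝕜]

theorem partnerMatrix_mul_transpose :
    partnerMatrix h 𝕜 * (partnerMatrix h 𝕜)ᵀ = 1 := by
  ext i j
  simp [partnerMatrix, mul_apply, one_apply, (partner_injective h).eq_iff, eq_comm]

theorem map_partnerMatrix {𝕜' : Type*} [RCLike 𝕜'] (f : 𝕜 →+* 𝕜') :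
    (partnerMatrix h 𝕜).map f = partnerMatrix h 𝕜' := by
  ext i j
  simp [partnerMatrix, apply_ite f]

theorem aPQ_eq (t : Fin p → ℝ) :
    aPQ p q h t = fromBlocks 0 (diagonal (fun j => (t j : ℂ)) * partnerMatrix h ℂ)
      ((partnerMatrix h ℂ)ᵀ * diagonal (fun j => (t j : ℂ))) 0 := by
  have hp : ∀ j, (Fin.castLE h j).rev = partner h j := fun _ => rfl
  ext (i | i) (j | j)
  · simp [aPQ, Fintype.linearCombination_apply, Matrix.sum_apply]
  · simp only [aPQ, Fintype.linearCombination_apply, Matrix.sum_apply, Matrix.smul_apply,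
      Matrix.add_apply, hp, fromBlocks_apply₁₂, diagonal_mul, partnerMatrix, of_apply]
    rw [Finset.sum_eq_single i] <;> simp +contextual [single_apply, eq_comm]
  · simp only [aPQ, Fintype.linearCombination_apply, Matrix.sum_apply, Matrix.smul_apply,
      Matrix.add_apply, hp, fromBlocks_apply₂₁, mul_diagonal, transpose_apply, partnerMatrix,
          of_apply]
    rw [Finset.sum_eq_single j] <;> simp +contextual [single_apply, eq_comm]
  · simp [aPQ, Fintype.linearCombination_apply, Matrix.sum_apply]

theorem sum_norm_aPQ_lt (t : Fin p → ℝ) (c : ℝ) (hc : 0 < c) (ht : ∀ j, |t j| < c)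
    (i : Fin p ⊕ Fin q) : ∑ k, ‖aPQ p q h t i k‖ < c := by
  rw [aPQ_eq, Fintype.sum_sum_type]
  rcases i with i | i
  · simp only [fromBlocks_apply₁₁, fromBlocks_apply₁₂, diagonal_mul, partnerMatrix, of_apply]
    rw [Finset.sum_eq_single_of_mem (partner h i) (Finset.mem_univ _)
      (fun b _ hb => by simp [hb] : ∀ b ∈ Finset.univ, b ≠ partner h i → _)]
    simpa using ht i
  · simp only [fromBlocks_apply₂₁, fromBlocks_apply₂₂, mul_diagonal, partnerMatrix, of_apply,
      transpose_apply]
    by_cases hi : ∃ j, i = partner h j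
    · obtain ⟨j, rfl⟩ := hi
      rw [Finset.sum_eq_single_of_mem j (Finset.mem_univ _)
        (fun b _ hb => by simp [(partner_injective h).eq_iff, hb.symm])]
      simpa using ht j
    · push Not at hi
      simpa [hi] using hc

/-- A right eigenvector `v` of `a t` for `t j` and a left eigenvector `w` for `-t j` give a rank one
matrix `v wᵀ` with `ad`-eigenvalue `2 t j`. Since `w = I_{p,q} v` is real, the factor `i` makes this
matrix skew-Hermitian for the form. The factor is available in `𝔰𝔲(p,q)` but not in `𝔰𝔬(p,q)`, where
`2 e_j` is not a root. -/
theorem exists_root_vector_suAlg (j : Fin p) : ∃ Z ∈ suAlg p q, Z ≠ 0 ∧ ∀ t,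
    aPQ p q h t * Z - Z * aPQ p q h t = (2 * t j) • Z := by
  let v : Fin p ⊕ Fin q → ℂ := Sum.elim (Pi.single j 1) (Pi.single (partner h j) 1)
  let w : Fin p ⊕ Fin q → ℂ := Sum.elim (Pi.single j 1) (Pi.single (partner h j) (-1))
  have hv : ∀ t, aPQ p q h t *ᵥ v = (t j : ℂ) • v := by
    intro t
    rw [aPQ_eq, fromBlocks_mulVec]
    ext (i | i)
    · rcases eq_or_ne i j with rfl | hij
      · simp [v, partnerMatrix]
      · simp [v, partnerMatrix, (partner_injective h).eq_iff, hij, hij.symm]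
    · by_cases hij : i = partner h j <;> simp [v, partnerMatrix, hij]
  have hw : ∀ t, w ᵥ* aPQ p q h t = -((t j : ℂ) • w) := by
    intro t
    rw [aPQ_eq, vecMul_fromBlocks]
    ext (i | i)
    · rcases eq_or_ne i j with rfl | hij
      · simp [w, partnerMatrix]
      · simp [w, partnerMatrix, (partner_injective h).eq_iff, hij, hij.symm]
    · by_cases hij : i = partner h j <;> simp [w, partnerMatrix, hij]
  refine ⟨Complex.I • vecMulVec v w, ⟨?_, ?_⟩, ?_, ?_⟩
  · have hvw : v ᵥ* signMatrix p q ℂ = w := by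
      rw [signMatrix, vecMul_fromBlocks]
      ext (i | i) <;> simp [v, w, Pi.single_apply, one_apply, eq_comm]
      split_ifs <;> simp
    have hwv : signMatrix p q ℂ *ᵥ v = w := by
      rw [signMatrix, fromBlocks_mulVec]
      ext (i | i) <;> simp [v, w, Pi.single_apply, one_apply]
      split_ifs <;> simp
    have sv : star v = v := by
      ext (i | i)
      · by_cases hi : i = j <;> simp [v, hi]
      · by_cases hi : i = partner h j <;> simp [v, hi]
    have sw : star w = w := by
      ext (i | i)
      · by_cases hi : i = j <;> simp [w, hi]
      · by_cases hi : i = partner h j <;> simp [w, hi]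
    rw [conjTranspose_smul, conjTranspose_vecMulVec, sv, sw, smul_mul_assoc, mul_smul_comm,
      vecMulVec_mul, mul_vecMulVec, hvw, hwv]
    simp
  · simp [trace_vecMulVec, v, w, dotProduct, Fintype.sum_sum_type, Pi.single_apply]
  · intro h0
    have := congrFun (congrFun h0 (.inl j)) (.inl j)
    simp [vecMulVec_apply, v, w] at this
  · intro t
    rw [mul_smul_comm, smul_mul_assoc, mul_vecMulVec, vecMulVec_mul, hv, hw]
    ext a b
    simp only [Matrix.sub_apply, Matrix.smul_apply, vecMulVec_apply, Pi.smul_apply, Pi.neg_apply,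
        smul_eq_mul,
      Complex.real_smul]
    push_cast
    ring

theorem OmegaPQ_eq : OmegaPQ p q h =
    Set.univ.pi fun _ => Set.Ioo (-(Real.pi / 4)) (Real.pi / 4) :=
  crownPolytope_eq_cube (sum_norm_aPQ_lt h) (exists_root_vector_suAlg h)

/-- The generator `N` with `i a(π/4, …, π/4) = π/4 N`. -/
def quarterPQ (h : p ≤ q) : Matrix (Fin p ⊕ Fin q) (Fin p ⊕ Fin q) ℂ :=
  Complex.I • fromBlocks 0 (partnerMatrix h ℂ) (partnerMatrix h ℂ)ᵀ 0

theorem quarterPQ_mul_self : quarterPQ h * quarterPQ h =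
    -fromBlocks 1 0 0 ((partnerMatrix h ℂ)ᵀ * partnerMatrix h ℂ) := by
  rw [quarterPQ, smul_mul_smul_comm, Complex.I_mul_I, fromBlocks_multiply,
    partnerMatrix_mul_transpose]
  simp

theorem quarterPQ_cube : quarterPQ h * quarterPQ h * quarterPQ h = -quarterPQ h := by
  rw [quarterPQ_mul_self, quarterPQ, neg_mul, mul_smul_comm, fromBlocks_multiply]
  simp [Matrix.mul_assoc, partnerMatrix_mul_transpose]

theorem signMatrix_mul_quarterPQ :
    signMatrix p q ℂ * quarterPQ h = -(quarterPQ h * signMatrix p q ℂ) := by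
  rw [quarterPQ, signMatrix, mul_smul_comm, smul_mul_assoc, fromBlocks_multiply,
    fromBlocks_multiply, ← smul_neg, fromBlocks_neg]
  simp

theorem map_conj_quarterPQ : (quarterPQ h).map (starRingEnd ℂ) = -quarterPQ h := by
  have := map_partnerMatrix (𝕜 := ℂ) h (starRingEnd ℂ)
  have h1 : (fromBlocks 0 (partnerMatrix h ℂ) (partnerMatrix h ℂ)ᵀ 0).map (starRingEnd ℂ) =
      fromBlocks 0 (partnerMatrix h ℂ) (partnerMatrix h ℂ)ᵀ 0 := by
    rw [fromBlocks_map, transpose_map, this, Matrix.map_zero _ (map_zero _),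
      Matrix.map_zero _ (map_zero _)]
  ext i j
  have h2 := congrFun (congrFun h1 i) j
  rw [map_apply] at h2
  simp [quarterPQ, h2]

/-- The vertices of the cube, indexed by signs on the second block. -/
def vertexPQ (h : p ≤ q) (d : Fin q → ℤˣ) (j : Fin p) : ℝ :=
  ((d (partner h j) : ℤ) : ℝ) * (Real.pi / 4)

/-- All vertices come from the single generator `quarterPQ` by conjugation with `diag(1, d)`,
because each coupled index of the second block belongs to just one coordinate of `𝔞`. -/
theorem I_smul_aPQ_vertex (d : Fin q → ℤˣ) : Complex.I • aPQ p q h (vertexPQ h d) =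
    (Real.pi / 4) • (blockSign p ℂ d * quarterPQ h * blockSign p ℂ d) := by
  rw [aPQ_eq, quarterPQ, blockSign_apply, mul_smul_comm, smul_mul_assoc, fromBlocks_multiply,
    fromBlocks_multiply, smul_comm]
  congr 1
  rw [fromBlocks_smul]
  congr 1
  · simp
  · ext i j
    by_cases hij : j = partner h i
    · simp [partnerMatrix, vertexPQ, diagonalSign_apply, hij]; ring
    · simp [partnerMatrix, vertexPQ, diagonalSign_apply, hij]
  · ext i j
    by_cases hij : i = partner h j
    · simp [partnerMatrix, vertexPQ, diagonalSign_apply, hij]; ring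
    · simp [partnerMatrix, vertexPQ, diagonalSign_apply, hij]
  · simp

theorem mem_extremePoints_OmegaPQ (t : Fin p → ℝ) :
    t ∈ (closure (OmegaPQ p q h)).extremePoints ℝ ↔ ∃ d, t = vertexPQ h d := by
  rw [OmegaPQ_eq, extremePoints_closure_cube]
  constructor
  · rintro ⟨ε, rfl⟩
    -- Signs at uncoupled indices do not affect the vertex; they are set to `1`.
    refine ⟨Function.extend (partner h) ε 1, funext fun j => ?_⟩
    rw [vertexPQ, (partner_injective h).extend_apply]
  · rintro ⟨d, rfl⟩
    exact ⟨d ∘ partner h, rfl⟩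

end PartnerMatrix

/-! ### The distinguished boundary for `SO_e(p,q)` as a union of orbits. -/

section BoundaryPQ

attribute [-instance] LieRing.ofAssociativeRing

variable {p q : ℕ} (h : p ≤ q)

theorem isSkewFor_vertex (d : Fin q → ℤˣ) :
    IsSkewFor (signMatrix p q ℂ) (Complex.I • aPQ p q h (vertexPQ h d)) := by
  rw [I_smul_aPQ_vertex]
  refine IsSkewFor.smul ?_ _
  have hN : (quarterPQ h)ᵀ = quarterPQ h := by
    rw [quarterPQ, transpose_smul, fromBlocks_transpose]
    simp
  rw [IsSkewFor, transpose_mul, transpose_mul, transpose_blockSign, hN]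
  calc _ = blockSign p ℂ d * quarterPQ h * (blockSign p ℂ d * signMatrix p q ℂ) +
        (signMatrix p q ℂ * blockSign p ℂ d) * quarterPQ h * blockSign p ℂ d := by
        simp only [mul_assoc]
    _ = blockSign p ℂ d * quarterPQ h * (signMatrix p q ℂ * blockSign p ℂ d) +
        (blockSign p ℂ d * signMatrix p q ℂ) * quarterPQ h * blockSign p ℂ d := by
        rw [blockSign_comm_signMatrix]
    _ = blockSign p ℂ d * (quarterPQ h * signMatrix p q ℂ + signMatrix p q ℂ * quarterPQ h) *
        blockSign p ℂ d := by
        simp only [mul_add, add_mul, mul_assoc]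
    _ = 0 := by rw [signMatrix_mul_quarterPQ, add_neg_cancel, mul_zero, zero_mul]

/-- The points `exp(i Y)`, for `Y` a vertex of the cube. -/
def boundaryPoint (d : Fin q → ℤˣ) : SOpq p q ℂ :=
  ⟨expGL (Complex.I • aPQ p q h (vertexPQ h d)), (isSkewFor_vertex h d).expGL_mem_SOpq⟩

theorem coe_boundaryPoint (d : Fin q → ℤˣ) : (boundaryPoint h d).val.val =
    NormedSpace.exp (Complex.I • aPQ p q h (vertexPQ h d)) := rfl

theorem coe_boundaryPoint_eq (d : Fin q → ℤˣ) : (boundaryPoint h d).val.val =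
    NormedSpace.exp ((Real.pi / 4) • (blockSign p ℂ d * quarterPQ h * blockSign p ℂ d)) := by
  rw [coe_boundaryPoint, I_smul_aPQ_vertex]

theorem boundaryPoint_val_mul (e d : Fin q → ℤˣ) : (boundaryPoint h (e * d)).val =
    blockSignGL p ℂ e * (boundaryPoint h d).val * (blockSignGL p ℂ e)⁻¹ := by
  refine Units.ext ?_
  rw [coe_boundaryPoint_eq, Units.val_mul, Units.val_mul, coe_boundaryPoint_eq, blockSignGL_inv]
  change _ = blockSign p ℂ e * _ * blockSign p ℂ e
  rw [Matrix.exp_semiconj (Y := (Real.pi / 4) •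
    (blockSign p ℂ (e * d) * quarterPQ h * blockSign p ℂ (e * d))), mul_assoc (NormedSpace.exp _),
    blockSign_mul_self, mul_one]
  rw [mul_smul_comm, smul_mul_assoc, map_mul]
  congr 1
  have hc : blockSign p ℂ e * blockSign p ℂ d = blockSign p ℂ d * blockSign p ℂ e := by
    rw [← map_mul, mul_comm, map_mul]
  calc _ = blockSign p ℂ e * blockSign p ℂ d * quarterPQ h * blockSign p ℂ d * 1 := by
        simp only [mul_one, mul_assoc]
    _ = _ := by
        rw [← blockSign_mul_self e, ← mul_assoc, mul_assoc _ (blockSign p ℂ d), ← hc]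

open scoped Matrix.Norms.Operator in
theorem isQuarterTurn_boundaryPoint (d : Fin q → ℤˣ) :
    (realizationPQ p q).IsQuarterTurn (boundaryPoint h d)
      (blockSign p ℂ d * quarterPQ h * blockSign p ℂ d) := by
  have hs := blockSign_mul_self (p := p) (𝕜 := ℂ) d
  refine ⟨coe_boundaryPoint_eq h d, ?_, ?_, ?_⟩
  · calc _ = blockSign p ℂ d * quarterPQ h * (blockSign p ℂ d * blockSign p ℂ d) * quarterPQ h *
          (blockSign p ℂ d * blockSign p ℂ d) * quarterPQ h * blockSign p ℂ d := by
          simp only [mul_assoc]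
      _ = blockSign p ℂ d * (quarterPQ h * quarterPQ h * quarterPQ h) * blockSign p ℂ d := by
          rw [hs]; simp only [mul_assoc, one_mul]
      _ = _ := by rw [quarterPQ_cube, mul_neg, neg_mul]
  · rw [map_mul, map_mul, symmetryDataPQ_σ, symmetryDataPQ_σ, map_blockSign, map_conj_quarterPQ,
      mul_neg, neg_mul]
  · change signMatrix p q ℂ * _ = -(_ * signMatrix p q ℂ)
    calc _ = (signMatrix p q ℂ * blockSign p ℂ d) * quarterPQ h * blockSign p ℂ d := by
          simp only [mul_assoc]
      _ = blockSign p ℂ d * (signMatrix p q ℂ * quarterPQ h) * blockSign p ℂ d := by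
          rw [← blockSign_comm_signMatrix]; simp only [mul_assoc]
      _ = -(blockSign p ℂ d * quarterPQ h * (signMatrix p q ℂ * blockSign p ℂ d)) := by
          rw [signMatrix_mul_quarterPQ]; simp only [mul_assoc, mul_neg, neg_mul]
      _ = _ := by rw [← blockSign_comm_signMatrix]; simp only [mul_assoc]

theorem mem_boundaryPQ (y : SOpq p q ℂ ⧸ KCpq p q) : y ∈ boundaryPQ p q h ↔
    ∃ (d : Fin q → ℤˣ) (g : SOe p q), SOeToComplex p q g • (boundaryPoint h d : SOpq p q ℂ ⧸ KCpq p q) = y := by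
  constructor
  · rintro ⟨g, z, ⟨t, ht, hz⟩, rfl⟩
    obtain ⟨d, rfl⟩ := (mem_extremePoints_OmegaPQ h t).1 ht
    obtain rfl : z = boundaryPoint h d := Subtype.ext (Units.ext hz)
    exact ⟨d, g, rfl⟩
  · rintro ⟨d, g, rfl⟩
    exact ⟨g, boundaryPoint h d, ⟨_, (mem_extremePoints_OmegaPQ h _).2 ⟨d, rfl⟩, rfl⟩, rfl⟩

theorem locallyTransitiveAt_boundaryPQ (d : Fin q → ℤˣ) :
    LocallyTransitiveAt (SOeToComplex p q) (boundaryPQ p q h)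
      (boundaryPoint h d : SOpq p q ℂ ⧸ KCpq p q) := by
  open scoped Matrix.Norms.Operator in
  refine (realizationPQ p q).locallyTransitiveAt ?_ _ ((mem_boundaryPQ h _).2 ⟨d, 1, ?_⟩)
  · intro z hz
    obtain ⟨e, g, hg⟩ := (mem_boundaryPQ h _).1 hz
    rw [← (realizationPQ p q).symm_eq_of_mk_eq (g := SOeToComplex p q g * boundaryPoint h e) hg]
    exact (realizationPQ p q).isSymmetry_of_isQuarterTurn (isQuarterTurn_boundaryPoint h e) g
  · rw [map_one, one_smul]

/-- The matrix `diag(1, e)` of determinant `1` lies in `SO_e(p,q)` and, complexified, in `K_ℂ`. It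
conjugates one boundary point to the other, and the right factor of the conjugation is absorbed by
`K_ℂ`. -/
theorem smul_boundaryPoint {e : Fin q → ℤˣ} (he : ∏ i, e i = 1) (d : Fin q → ℤˣ) :
    ∃ g : SOe p q, SOeToComplex p q g • (boundaryPoint h d : SOpq p q ℂ ⧸ KCpq p q) =
      boundaryPoint h (e * d) := by
  have hv : (SOeToComplex p q ⟨blockSignGL p ℝ e, blockSignGL_mem_SOe he⟩).val =
      blockSignGL p ℂ e := Units.ext (map_blockSign (algebraMap ℝ ℂ) e)
  refine ⟨⟨blockSignGL p ℝ e, blockSignGL_mem_SOe he⟩, ?_⟩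
  rw [MulAction.Quotient.smul_coe, smul_eq_mul, QuotientGroup.eq]
  have : (SOeToComplex p q ⟨blockSignGL p ℝ e, blockSignGL_mem_SOe he⟩ * boundaryPoint h d)⁻¹ *
      boundaryPoint h (e * d) =
        (SOeToComplex p q ⟨blockSignGL p ℝ e, blockSignGL_mem_SOe he⟩)⁻¹ := by
    rw [inv_mul_eq_iff_eq_mul]
    refine Subtype.ext ?_
    rw [boundaryPoint_val_mul, ← hv]
    rfl
  rw [this]
  refine inv_mem ⟨1, diagonalSign ℂ e, det_one, ?_, ?_⟩
  · rw [det_diagonalSign, he]; simp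
  · rw [hv]; rfl

theorem boundaryPoint_congr {d d' : Fin q → ℤˣ} (hd : ∀ j, d (partner h j) = d' (partner h j)) :
    boundaryPoint h d = boundaryPoint h d' := by
  have : vertexPQ h d = vertexPQ h d' := funext fun j => by rw [vertexPQ, vertexPQ, hd]
  rw [boundaryPoint, boundaryPoint]
  simp only [this]

theorem boundaryPQ_eq_orbit (hpq : p < q) (y : SOpq p q ℂ ⧸ KCpq p q) :
    y ∈ boundaryPQ p q hpq.le ↔ ∃ g : SOe p q,
      SOeToComplex p q g • (boundaryPoint hpq.le 1 : SOpq p q ℂ ⧸ KCpq p q) = y := by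
  rw [mem_boundaryPQ]
  refine ⟨?_, fun ⟨g, hg⟩ => ⟨1, g, hg⟩⟩
  rintro ⟨d, g, rfl⟩
  -- The coupled indices are `q - 1 - j` with `j < p`, so for `p < q` the index `0` is free. Its
  -- sign is used to make the product of all signs equal to `1`.
  let k : Fin q := ⟨0, by omega⟩
  have hk : ∀ j : Fin p, partner hpq.le j ≠ k := by
    intro j e
    have h1 := congrArg Fin.val e
    simp only [partner, Fin.val_rev, Fin.val_castLE, k] at h1
    omega
  let e : Fin q → ℤˣ := d * Pi.mulSingle k (∏ i, d i)
  have he : ∏ i, e i = 1 := by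
    simp only [e, Pi.mul_apply]
    rw [Finset.prod_mul_distrib, Fintype.prod_pi_mulSingle' , Int.units_mul_self]
  obtain ⟨g', hg'⟩ := smul_boundaryPoint hpq.le he 1
  refine ⟨g * g', ?_⟩
  rw [map_mul, mul_smul, hg', mul_one,
    boundaryPoint_congr hpq.le (d := e) (d' := d) fun j => by simp [e, hk j]]

/-- Even sign changes act through `G`, so only the parity of `d` counts: if the product of its signs
is `-1`, then `d * r` is even and moves `r` to `d`. -/
theorem boundaryPQ_eq_orbits {n : ℕ} {r : Fin n → ℤˣ} (hr : ∏ i, r i = -1)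
    (y : SOpq n n ℂ ⧸ KCpq n n) :
    y ∈ boundaryPQ n n le_rfl ↔ (∃ g : SOe n n,
      SOeToComplex n n g • (boundaryPoint (le_refl n) 1 : SOpq n n ℂ ⧸ KCpq n n) = y) ∨
      ∃ g : SOe n n,
        SOeToComplex n n g • (boundaryPoint (le_refl n) r : SOpq n n ℂ ⧸ KCpq n n) = y := by
  rw [mem_boundaryPQ]
  constructor
  · rintro ⟨d, g, rfl⟩
    rcases Int.units_eq_one_or (∏ i, d i) with hd | hd
    · obtain ⟨g', hg'⟩ := smul_boundaryPoint (le_refl n) hd 1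
      exact .inl ⟨g * g', by rw [map_mul, mul_smul, hg', mul_one]⟩
    · have hdr : ∏ i, (d * r) i = 1 := by
        simp only [Pi.mul_apply]
        rw [Finset.prod_mul_distrib, hd, hr, Int.units_mul_self]
      obtain ⟨g', hg'⟩ := smul_boundaryPoint (le_refl n) hdr r
      refine .inr ⟨g * g', ?_⟩
      rw [map_mul, mul_smul, hg', mul_assoc,
        show r * r = 1 from funext fun i => Int.units_mul_self (r i), mul_one]
  · rintro (⟨g, hg⟩ | ⟨g, hg⟩)
    · exact ⟨1, g, hg⟩
    · exact ⟨r, g, hg⟩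

open scoped Matrix.Norms.Operator in
theorem symm_boundaryPoint_one : (realizationPQ p q).symm (boundaryPoint h 1) =
    fromBlocks 0 (-Complex.I • partnerMatrix h ℂ) (Complex.I • (partnerMatrix h ℂ)ᵀ)
      (-(1 - (partnerMatrix h ℂ)ᵀ * partnerMatrix h ℂ)) := by
  rw [(realizationPQ p q).symm_of_isQuarterTurn (isQuarterTurn_boundaryPoint h 1), map_one, one_mul,
    mul_one, quarterPQ_mul_self]
  change _ * signMatrix p q ℂ = _
  rw [quarterPQ, signMatrix, ← fromBlocks_one, fromBlocks_neg, fromBlocks_smul, fromBlocks_add,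
    fromBlocks_add, fromBlocks_multiply]
  simp [sub_eq_add_neg]

end BoundaryPQ

/-! ### Determinants of matrices that commute with a quaternionic structure. -/

section QuaternionicDeterminant

/-- A complex endomorphism which commutes with a quaternionic structure has nonnegative
determinant. -/
theorem LinearMap.det_nonneg_of_quaternionic {V : Type*} [AddCommGroup V] [Module ℂ V]
    [FiniteDimensional ℂ V] (j : V →ₛₗ[starRingEnd ℂ] V) (hj : ∀ v, j (j v) = -v) (f : V →ₗ[ℂ] V)
    (hf : ∀ v, f (j v) = j (f v)) : ∃ r : ℝ, 0 ≤ r ∧ LinearMap.det f = r := by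
  induction hn : Module.finrank ℂ V using Nat.strong_induction_on generalizing V with
  | _ n ih =>
  rcases Nat.eq_zero_or_pos n with rfl | hpos
  · exact ⟨1, zero_le_one, by rw [LinearMap.det_eq_one_of_finrank_eq_zero hn, Complex.ofReal_one]⟩
  have : Nontrivial V := Module.nontrivial_of_finrank_pos (R := ℂ) (hn ▸ hpos)
  obtain ⟨μ, hμ⟩ := Module.End.exists_eigenvalue f
  obtain ⟨v, hv⟩ := hμ.exists_hasEigenvector
  have hfv : f v = μ • v := hv.apply_eq_smul
  have hfw : f (j v) = starRingEnd ℂ μ • j v := by rw [hf, hfv, LinearMap.map_smulₛₗ]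
  -- An eigenvector `v` and `j v` have eigenvalues `μ` and its conjugate, and span a plane stable
  -- under `f` and `j`. This plane contributes `|μ|²` to the determinant, and the induction
  -- continues on the quotient. A relation `j v = c v` would give `-v = |c|² v`.
  have hli : LinearIndependent ℂ ![v, j v] := by
    rw [LinearIndependent.pair_iff' hv.2]
    intro c hc
    have h1 : -v = (starRingEnd ℂ c * c) • v := by
      rw [mul_smul, hc, ← LinearMap.map_smulₛₗ, hc, hj]
    have h2 : (starRingEnd ℂ c * c + 1) • v = 0 := by
      rw [add_smul, ← h1, one_smul, neg_add_cancel]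
    rcases smul_eq_zero.1 h2 with h3 | h3
    · rw [← Complex.normSq_eq_conj_mul_self] at h3
      have h4 : Complex.normSq c + 1 = 0 := by exact_mod_cast h3
      linarith [Complex.normSq_nonneg c]
    · exact hv.2 h3
  set W := Submodule.span ℂ (Set.range ![v, j v]) with hW
  have hvW : v ∈ W := Submodule.subset_span ⟨0, rfl⟩
  have hwW : j v ∈ W := Submodule.subset_span ⟨1, rfl⟩
  have hfW : W ≤ W.comap f := by
    rw [hW, Submodule.span_le]
    rintro _ ⟨i, rfl⟩
    fin_cases i
    · exact (show f v ∈ W by rw [hfv]; exact W.smul_mem μ hvW)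
    · exact (show f (j v) ∈ W by rw [hfw]; exact W.smul_mem _ hwW)
  have hjW : W ≤ W.comap j := by
    rw [hW, Submodule.span_le]
    rintro _ ⟨i, rfl⟩
    fin_cases i
    · exact hwW
    · exact (show j (j v) ∈ W by rw [hj]; exact W.neg_mem hvW)
  have hdetW : LinearMap.det (f.restrict hfW) = μ * starRingEnd ℂ μ := by
    have hb : LinearMap.toMatrix (Module.Basis.span hli) (Module.Basis.span hli) (f.restrict hfW) =
        diagonal ![μ, starRingEnd ℂ μ] := by
      have key : ∀ i, f.restrict hfW (Module.Basis.span hli i) =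
          ![μ, starRingEnd ℂ μ] i • Module.Basis.span hli i := by
        intro i
        apply Subtype.ext
        rw [LinearMap.coe_restrict_apply, Submodule.coe_smul, Module.Basis.span_apply]
        fin_cases i
        · exact hfv
        · exact hfw
      ext i k
      rw [LinearMap.toMatrix_apply, key, map_smul, Finsupp.smul_apply, Module.Basis.repr_self,
        diagonal_apply, Finsupp.single_apply]
      rcases eq_or_ne i k with rfl | hik
      · simp
      · simp [hik, hik.symm]
    rw [← LinearMap.det_toMatrix (Module.Basis.span hli), hb, det_diagonal]
    simp
  have hlt : Module.finrank ℂ (V ⧸ W) < n := by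
    have h1 := W.finrank_quotient_add_finrank
    have h2 : Module.finrank ℂ W = 2 := by
      rw [hW, finrank_span_eq_card hli, Fintype.card_fin]
    omega
  obtain ⟨r, hr, hdet⟩ := ih _ hlt (W.mapQ W j hjW) (fun x => by
      obtain ⟨y, rfl⟩ := W.mkQ_surjective x
      simp [hj]) (W.mapQ W f hfW) (fun x => by
      obtain ⟨y, rfl⟩ := W.mkQ_surjective x
      simp [hf]) rfl
  refine ⟨Complex.normSq μ * r, mul_nonneg (Complex.normSq_nonneg μ) hr, ?_⟩
  rw [LinearMap.det_eq_det_mul_det W f hfW, hdet, hdetW, Complex.mul_conj, Complex.ofReal_mul]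

/-- The hypotheses say that `v ↦ N * conj v` is a quaternionic structure and that `M` commutes with
it. -/
theorem Matrix.det_ne_neg_one_of_quaternionic {ι : Type*} [Fintype ι] [DecidableEq ι]
    {M N : Matrix ι ι ℂ} (hN : N * N.map (starRingEnd ℂ) = -1)
    (hM : M * N = N * M.map (starRingEnd ℂ)) : M.det ≠ -1 := by
  have hstar : ∀ (A : Matrix ι ι ℂ) (v : ι → ℂ), star (A *ᵥ v) = A.map (starRingEnd ℂ) *ᵥ star v := by
    intro A v
    ext i
    simp [mulVec, dotProduct]
  let j : (ι → ℂ) →ₛₗ[starRingEnd ℂ] (ι → ℂ) :=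
    { toFun := fun v => N *ᵥ star v
      map_add' := fun v w => by rw [star_add, mulVec_add]
      map_smul' := fun c v => by rw [star_smul, mulVec_smul]; rfl }
  obtain ⟨r, hr, hdet⟩ := LinearMap.det_nonneg_of_quaternionic j (fun v => by
      change N *ᵥ star (N *ᵥ star v) = -v
      rw [hstar, star_star, mulVec_mulVec, hN, neg_mulVec,
          one_mulVec]) (Matrix.toLin' M) (fun v => by
      change M *ᵥ (N *ᵥ star v) = N *ᵥ star (M *ᵥ v)
      rw [hstar, mulVec_mulVec, mulVec_mulVec, hM])
  rw [LinearMap.det_toLin'] at hdet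
  rw [hdet]
  intro h
  have : r = -1 := by exact_mod_cast h
  linarith

end QuaternionicDeterminant

/-! ### Transport of subgroups and Lie algebras under conjugation by an element of the ambient
linear group. -/

section Conjugation

/-- Conjugation by an element of an ambient group which normalizes `S`. -/
def conjOfNormalizes {Γ : Type*} [Group Γ] [TopologicalSpace Γ] [IsTopologicalGroup Γ]
    (S : Subgroup Γ) (r : Γ) (h : ∀ g ∈ S, r * g * r⁻¹ ∈ S) (h' : ∀ g ∈ S, r⁻¹ * g * r ∈ S) :
    S ≃ₜ* S where
  toFun g := ⟨r * g * r⁻¹, h g g.2⟩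
  invFun g := ⟨r⁻¹ * g * r, h' g g.2⟩
  left_inv g := Subtype.ext (by group)
  right_inv g := Subtype.ext (by group)
  map_mul' a b := Subtype.ext (by simp only [Subgroup.coe_mul]; group)
  continuous_toFun := ((continuous_const.mul continuous_subtype_val).mul
    continuous_const).subtype_mk _
  continuous_invFun := ((continuous_const.mul continuous_subtype_val).mul
    continuous_const).subtype_mk _

theorem map_eq_of_mem_iff {G : Type*} [Group G] [TopologicalSpace G] (κ : G ≃ₜ* G)
    {H₁ H₂ : Subgroup G} (h : ∀ g, g ∈ H₁ ↔ κ g ∈ H₂) :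
    H₁.map κ.toMulEquiv.toMonoidHom = H₂ := by
  ext g
  constructor
  · rintro ⟨a, ha, rfl⟩
    exact (h a).1 ha
  · intro hg
    exact ⟨κ.symm g, (h _).2 (by simpa using hg), κ.apply_symm_apply g⟩

theorem HasLieAlgebra.conj {ι 𝕜 : Type*} [Fintype ι] [DecidableEq ι] [RCLike 𝕜]
    {G : Subgroup (GL ι 𝕜)} {H₁ H₂ : Subgroup G} {L : Type*} [LieRing L] [LieAlgebra ℝ L]
    (hL : HasLieAlgebra H₁ L) (r : GL ι 𝕜) (κ : G ≃ₜ* G)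
    (hκ : ∀ g, (κ g).val = r * g.val * r⁻¹) (h : ∀ g, g ∈ H₁ ↔ κ g ∈ H₂) :
    HasLieAlgebra H₂ L := by
  obtain ⟨𝔥, h𝔥, ⟨e⟩⟩ := hL
  let c : Matrix ι ι 𝕜 ≃ₐ[ℝ] Matrix ι ι 𝕜 :=
    AlgEquiv.ofAlgHom
      { toFun := fun X => r.val * X * r⁻¹.val
        map_one' := by simp
        map_mul' := fun X Y => by
          calc _ = r.val * X * (r⁻¹.val * r.val) * Y * r⁻¹.val := by
                rw [r.inv_mul]; simp only [mul_assoc, one_mul]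
            _ = _ := by simp only [mul_assoc]
        map_zero' := by simp
        map_add' := fun X Y => by rw [mul_add, add_mul]
        commutes' := fun t => by
          rw [← Algebra.commutes, mul_assoc, r.mul_inv, mul_one] }
      { toFun := fun X => r⁻¹.val * X * r.val
        map_one' := by simp
        map_mul' := fun X Y => by
          calc _ = r⁻¹.val * X * (r.val * r⁻¹.val) * Y * r.val := by
                rw [r.mul_inv]; simp only [mul_assoc, one_mul]
            _ = _ := by simp only [mul_assoc]
        map_zero' := by simp
        map_add' := fun X Y => by rw [mul_add, add_mul]
        commutes' := fun t => by
          rw [← Algebra.commutes, mul_assoc, r.inv_mul, mul_one] }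
      (by
        ext1 X
        change r.val * (r⁻¹.val * X * r.val) * r⁻¹.val = X
        calc _ = (r.val * r⁻¹.val) * X * (r.val * r⁻¹.val) := by simp only [mul_assoc]
          _ = X := by rw [r.mul_inv, one_mul, mul_one])
      (by
        ext1 X
        change r⁻¹.val * (r.val * X * r⁻¹.val) * r.val = X
        calc _ = (r⁻¹.val * r.val) * X * (r⁻¹.val * r.val) := by simp only [mul_assoc]
          _ = X := by rw [r.inv_mul, one_mul, mul_one])
  have hexp : ∀ (t : ℝ) (X : Matrix ι ι 𝕜), r.val * NormedSpace.exp (t • X) * r⁻¹.val =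
      NormedSpace.exp (t • (r.val * X * r⁻¹.val)) := by
    intro t X
    rw [Matrix.exp_semiconj (Y := t • (r.val * X * r⁻¹.val)), mul_assoc, r.mul_inv, mul_one]
    rw [mul_smul_comm, smul_mul_assoc, mul_assoc (r.val * X), r.inv_mul, mul_one]
  refine ⟨𝔥.map (AlgEquiv.toLieEquiv c).toLieHom, fun X => ?_,
    ⟨((AlgEquiv.toLieEquiv c).lieSubalgebraMap 𝔥).symm.trans e⟩⟩
  constructor
  · rintro ⟨Y, hY, rfl⟩ t
    obtain ⟨g, hg, hgY⟩ := (h𝔥 Y).1 hY t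
    refine ⟨κ g, (h g).1 hg, ?_⟩
    rw [hκ, Units.val_mul, Units.val_mul, hgY]
    exact hexp t Y
  · intro hX
    refine ⟨c.symm X, (h𝔥 _).2 fun t => ?_, c.apply_symm_apply X⟩
    obtain ⟨g, hg, hgX⟩ := hX t
    refine ⟨κ.symm g, (h _).2 (by simpa using hg), ?_⟩
    have h1 := hκ (κ.symm g)
    rw [ContinuousMulEquiv.apply_symm_apply] at h1
    have h2 : (κ.symm g).val.val = r⁻¹.val * g.val.val * r.val := by
      rw [h1, Units.val_mul, Units.val_mul]
      calc _ = (r⁻¹.val * r.val) * (κ.symm g).val.val * (r⁻¹.val * r.val) := by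
            rw [r.inv_mul, one_mul, mul_one]
        _ = _ := by simp only [mul_assoc]
    rw [h2, hgX]
    have h3 := hexp t (c.symm X)
    rw [show r.val * c.symm X * r⁻¹.val = X from c.apply_symm_apply X] at h3
    rw [← h3]
    calc _ = (r⁻¹.val * r.val) * NormedSpace.exp (t • c.symm X) * (r⁻¹.val * r.val) := by
          simp only [mul_assoc]
      _ = _ := by rw [r.inv_mul, one_mul, mul_one]

end Conjugation

/-! ### Comparison of the stabilizers for different vertices, and distinctness of the two orbits for
`p = q`. -/

section BoundaryPQ

attribute [-instance] LieRing.ofAssociativeRing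

variable {p q n : ℕ}

/-- The sign matrix may have determinant `-1`, so it need not lie in `SO(p,q)`. It still normalizes
`SO(p,q)`, and a continuous self-map fixing `1` preserves the identity component. -/
theorem blockSign_conj_mem_SOe (d : Fin q → ℤˣ) {g : GL (Fin p ⊕ Fin q) ℝ} (hg : g ∈ SOe p q) :
    blockSignGL p ℝ d * g * (blockSignGL p ℝ d)⁻¹ ∈ SOe p q := by
  have hmem : ∀ g ∈ SOpq p q ℝ, blockSignGL p ℝ d * g * (blockSignGL p ℝ d)⁻¹ ∈ SOpq p q ℝ := by
    rintro g ⟨h1, h2⟩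
    refine ⟨?_, ?_⟩
    · rw [blockSignGL_inv, Units.val_mul, Units.val_mul]
      change (blockSign p ℝ d * g.val * blockSign p ℝ d)ᵀ * signMatrix p q ℝ *
        (blockSign p ℝ d * g.val * blockSign p ℝ d) = _
      rw [transpose_mul, transpose_mul, transpose_blockSign]
      calc _ = blockSign p ℝ d * (g.valᵀ * ((blockSign p ℝ d)ᵀ * signMatrix p q ℝ *
            blockSign p ℝ d) * g.val) * blockSign p ℝ d := by
            rw [transpose_blockSign]; simp only [mul_assoc]
        _ = _ := by
            rw [blockSign_isometry, h1, blockSign_comm_signMatrix, mul_assoc, blockSign_mul_self,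
              mul_one]
    · rw [Units.val_mul, Units.val_mul, det_mul, det_mul, h2, mul_one, ← det_mul,
        Units.mul_inv, det_one]
  obtain ⟨hg1, hg2⟩ := (mem_SOe_iff g).1 hg
  let f : SOpq p q ℝ → SOpq p q ℝ := fun x => ⟨_, hmem x.1 x.2⟩
  have hf : Continuous f := ((continuous_const.mul continuous_subtype_val).mul
    continuous_const).subtype_mk _
  have hf1 : f 1 = 1 := Subtype.ext (by simp [f])
  refine (mem_SOe_iff _).2 ⟨hmem g hg1, ?_⟩
  have := hf.mapsTo_connectedComponent 1 hg2
  rwa [hf1] at this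

/-- Conjugation of `SO_e(p, q)` by a diagonal matrix of signs. -/
def conjBlockSign (p : ℕ) {q : ℕ} (d : Fin q → ℤˣ) : SOe p q ≃ₜ* SOe p q :=
  conjOfNormalizes (SOe p q) (blockSignGL p ℝ d) (fun _ hg => blockSign_conj_mem_SOe d hg)
    fun g hg => by
      have := blockSign_conj_mem_SOe d hg
      rwa [blockSignGL_inv] at this ⊢

theorem KCpq_conj_blockSign (d : Fin q → ℤˣ) {k k' : SOpq p q ℂ}
    (hk' : k'.val = blockSignGL p ℂ d * k.val * (blockSignGL p ℂ d)⁻¹) (hk : k ∈ KCpq p q) :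
    k' ∈ KCpq p q := by
  obtain ⟨A, D, hA, hD, e⟩ := hk
  refine ⟨A, diagonalSign ℂ d * D * diagonalSign ℂ d, hA, ?_, ?_⟩
  · rw [det_mul, det_mul, hD, mul_one, ← det_mul, diagonalSign_mul_self, det_one]
  · rw [hk', blockSignGL_inv, Units.val_mul, Units.val_mul, e]
    change blockSign p ℂ d * _ * blockSign p ℂ d = _
    rw [blockSign_apply, fromBlocks_multiply, fromBlocks_multiply]
    simp

theorem mem_stabilizerOf_boundaryPoint_iff (h : p ≤ q) (d : Fin q → ℤˣ) (g : SOe p q) :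
    g ∈ stabilizerOf (SOeToComplex p q) (boundaryPoint h 1 : SOpq p q ℂ ⧸ KCpq p q) ↔
      conjBlockSign p d g ∈
        stabilizerOf (SOeToComplex p q) (boundaryPoint h d : SOpq p q ℂ ⧸ KCpq p q) := by
  rw [mem_stabilizerOf_mk, mem_stabilizerOf_mk]
  set k := (boundaryPoint h 1)⁻¹ * SOeToComplex p q g * boundaryPoint h 1 with hk
  set k' := (boundaryPoint h d)⁻¹ * SOeToComplex p q (conjBlockSign p d g) * boundaryPoint h d
    with hk'
  have e : k'.val = blockSignGL p ℂ d * k.val * (blockSignGL p ℂ d)⁻¹ := by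
    have e1 : (SOeToComplex p q (conjBlockSign p d g)).val =
        blockSignGL p ℂ d * (SOeToComplex p q g).val * (blockSignGL p ℂ d)⁻¹ := by
      refine Units.ext ?_
      change (blockSign p ℝ d * g.val.val * blockSign p ℝ d).map (algebraMap ℝ ℂ) =
        blockSign p ℂ d * g.val.val.map (algebraMap ℝ ℂ) * blockSign p ℂ d
      rw [Matrix.map_mul, Matrix.map_mul, map_blockSign]
    have e2 := boundaryPoint_val_mul h d 1
    rw [mul_one] at e2
    rw [hk, hk', Subgroup.coe_mul, Subgroup.coe_mul, Subgroup.coe_mul, Subgroup.coe_mul,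
      Subgroup.coe_inv, Subgroup.coe_inv, e1, e2]
    group
  refine ⟨KCpq_conj_blockSign d e, KCpq_conj_blockSign d ?_⟩
  rw [e, blockSignGL_inv]
  have : blockSignGL p ℂ d * blockSignGL p ℂ d = 1 :=
    Units.ext (blockSign_mul_self d)
  calc k.val = (blockSignGL p ℂ d * blockSignGL p ℂ d) * k.val *
        (blockSignGL p ℂ d * blockSignGL p ℂ d) := by rw [this, one_mul, mul_one]
    _ = _ := by simp only [mul_assoc]

/-- For `d = -1` the matrix `diag(1, d)` is `I_{p,q}`, which anticommutes with `N`. The conjugate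
generator is thus `-N`, which is also the complex conjugate of `N`. -/
theorem boundaryPoint_neg_one (h : p ≤ q) : (boundaryPoint h (-1)).val.val =
    (boundaryPoint h 1).val.val.map (starRingEnd ℂ) := by
  have h1 : blockSign p ℂ (-1 : Fin q → ℤˣ) = signMatrix p q ℂ := by
    rw [blockSign_apply, signMatrix]
    congr 1
    ext i j
    rcases eq_or_ne i j with rfl | hij <;> simp [diagonalSign_apply, *]
  rw [coe_boundaryPoint_eq, coe_boundaryPoint_eq, Matrix.map_exp_conj, h1, map_one,
      one_mul, mul_one,
    signMatrix_mul_quarterPQ, neg_mul, mul_assoc, signMatrix_mul_self, mul_one]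
  congr 1
  rw [← map_conj_quarterPQ]
  ext i j
  simp only [Matrix.smul_apply, map_apply, Complex.real_smul, map_mul, Complex.conj_ofReal]

/-- The two base points are complex conjugates of each other, while `G` is real and `K_ℂ` is stable
under conjugation. -/
theorem stabilizerOf_boundaryPoint_neg_one (h : p ≤ q) :
    stabilizerOf (SOeToComplex p q) (boundaryPoint h (-1) : SOpq p q ℂ ⧸ KCpq p q) =
      stabilizerOf (SOeToComplex p q) (boundaryPoint h 1 : SOpq p q ℂ ⧸ KCpq p q) := by
  ext g
  rw [mem_stabilizerOf_mk, mem_stabilizerOf_mk]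
  set k := (boundaryPoint h 1)⁻¹ * SOeToComplex p q g * boundaryPoint h 1 with hk
  set k' := (boundaryPoint h (-1))⁻¹ * SOeToComplex p q g * boundaryPoint h (-1) with hk'
  have e : k'.val.val = k.val.val.map (starRingEnd ℂ) := by
    have e1 : (SOeToComplex p q g).val.val.map (starRingEnd ℂ) = (SOeToComplex p q g).val.val := by
      ext i j; exact Complex.conj_ofReal _
    have e2 : ∀ a b c : SOpq p q ℂ, (a⁻¹ * b * c).val.val = a⁻¹.val.val * b.val.val * c.val.val :=
      fun _ _ _ => rfl
    rw [hk, hk', e2, e2, Matrix.map_mul, Matrix.map_mul, e1, ← boundaryPoint_neg_one, SOpq_inv_eq,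
      SOpq_inv_eq, Matrix.map_mul, Matrix.map_mul, map_signMatrix, boundaryPoint_neg_one,
      transpose_map]
  have key : ∀ {k k' : SOpq p q ℂ}, k'.val.val = k.val.val.map (starRingEnd ℂ) → k ∈ KCpq p q →
      k' ∈ KCpq p q := by
    rintro k k' e ⟨A, D, hA, hD, hk⟩
    refine ⟨A.map (starRingEnd ℂ), D.map (starRingEnd ℂ), ?_, ?_, ?_⟩
    · have := (starRingEnd ℂ).map_det A
      rw [hA, map_one] at this
      exact this.symm
    · have := (starRingEnd ℂ).map_det D
      rw [hD, map_one] at this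
      exact this.symm
    · rw [e, hk, fromBlocks_map, Matrix.map_zero _ (map_zero _), Matrix.map_zero _ (map_zero _)]
  refine ⟨key ?_, key e⟩
  rw [e]
  ext i j
  simp

/-- For `p = q` one has `N² = -1`, and the symmetries at the two points are `J = N θ` and `S J S`
with `S = diag(1, r)`. An element `A` of `G` carrying the first point to the second gives `A J = S J
S A`, so the real matrix `S A` commutes with `J`. As `J² = 1` and the conjugate of `J` is `-J`, this
`J` defines a quaternionic structure, while `det (S A) = -1`. -/
theorem smul_boundaryPoint_ne {r : Fin n → ℤˣ} (hr : ∏ i, r i = -1) (g : SOe n n) :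
    SOeToComplex n n g • (boundaryPoint (le_refl n) 1 : SOpq n n ℂ ⧸ KCpq n n) ≠
      boundaryPoint (le_refl n) r := by
  intro hg
  have hW : (partnerMatrix (le_refl n) ℂ)ᵀ * partnerMatrix (le_refl n) ℂ = 1 :=
    mul_eq_one_comm.1 (partnerMatrix_mul_transpose (le_refl n))
  obtain ⟨J, hJ⟩ : ∃ J, J = quarterPQ (le_refl n) * signMatrix n n ℂ := ⟨_, rfl⟩
  have hNN : quarterPQ (le_refl n) * quarterPQ (le_refl n) = -1 := by
    rw [quarterPQ_mul_self, hW, fromBlocks_one]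
  obtain ⟨S, hS⟩ : ∃ S, S = blockSign n ℂ r := ⟨_, rfl⟩
  have hSS : S * S = 1 := by rw [hS, blockSign_mul_self]
  obtain ⟨A, hA⟩ : ∃ A, A = (SOeToComplex n n g).val.val := ⟨_, rfl⟩
  have hsymm : A * J = S * J * S * A := by
    open scoped Matrix.Norms.Operator in
    have e := (realizationPQ n n).symm_eq_of_mk_eq (g := SOeToComplex n n g * boundaryPoint (le_refl n) 1) hg
    open scoped Matrix.Norms.Operator in
    rw [LinearRealization.symm_mul,
      (realizationPQ n n).symm_of_isQuarterTurn (isQuarterTurn_boundaryPoint (le_refl n) 1),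
      (realizationPQ n n).symm_of_isQuarterTurn (isQuarterTurn_boundaryPoint (le_refl n) r), map_one,
      one_mul, mul_one, hNN, ← hS] at e
    have e1 : (1 + S * quarterPQ (le_refl n) * S + S * quarterPQ (le_refl n) * S * (S * quarterPQ (le_refl n) * S)) =
        S * quarterPQ (le_refl n) * S := by
      have : S * quarterPQ (le_refl n) * S * (S * quarterPQ (le_refl n) * S) = -1 := by
        calc _ = S * (quarterPQ (le_refl n) * ((S * S) * quarterPQ (le_refl n))) * S := by
              simp only [mul_assoc]
          _ = -1 := by rw [hSS, one_mul, hNN, mul_neg, mul_one, neg_mul, hSS]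
      rw [this]; abel
    have e2 : (1 + quarterPQ (le_refl n) + -1) = quarterPQ (le_refl n) := by abel
    rw [e1, e2] at e
    have e3 : A * (quarterPQ (le_refl n) * signMatrix n n ℂ) * (SOeToComplex n n g)⁻¹.val.val =
        S * quarterPQ (le_refl n) * S * signMatrix n n ℂ := by rw [hA]; exact e
    have e4 : (SOeToComplex n n g)⁻¹.val.val * A = 1 := by
      rw [hA]; exact (SOeToComplex n n g).val.inv_mul
    calc A * J = A * (quarterPQ (le_refl n) * signMatrix n n ℂ) *
          ((SOeToComplex n n g)⁻¹.val.val * A) := by rw [e4, mul_one, hJ]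
      _ = S * quarterPQ (le_refl n) * (S * signMatrix n n ℂ) * A := by
          rw [← mul_assoc, e3]; simp only [mul_assoc]
      _ = _ := by rw [hS, blockSign_comm_signMatrix, hJ]; simp only [mul_assoc]
  have hJc : J.map (starRingEnd ℂ) = -J := by
    rw [hJ, Matrix.map_mul, map_signMatrix, map_conj_quarterPQ, neg_mul]
  have hAc : A.map (starRingEnd ℂ) = A := by
    rw [hA]; ext i j; exact Complex.conj_ofReal _
  have hSc : S.map (starRingEnd ℂ) = S := by rw [hS, map_blockSign]
  refine Matrix.det_ne_neg_one_of_quaternionic (M := S * A) (N := J) ?_ ?_ ?_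
  · rw [hJc, hJ, mul_neg]
    congr 1
    calc _ = quarterPQ (le_refl n) * (signMatrix n n ℂ * quarterPQ (le_refl n)) * signMatrix n n ℂ := by
          simp only [mul_assoc]
      _ = -(quarterPQ (le_refl n) * quarterPQ (le_refl n)) * (signMatrix n n ℂ * signMatrix n n ℂ) := by
          rw [signMatrix_mul_quarterPQ]; simp only [mul_assoc, mul_neg, neg_mul]
      _ = 1 := by rw [hNN, signMatrix_mul_self, neg_neg, mul_one]
  · rw [Matrix.map_mul, hSc, hAc, mul_assoc, hsymm]
    calc _ = (S * S) * J * S * A := by simp only [mul_assoc]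
      _ = _ := by rw [hSS, one_mul, mul_assoc]
  · rw [det_mul, hS, det_blockSign, hr, hA, (SOeToComplex n n g).2.2]
    simp

end BoundaryPQ

/-! ### The centralizer of the symmetry in `𝔰𝔬(p,q)`. -/

section LieAlgebraPQ

variable {p q : ℕ} (h : p ≤ q)

/-- The matrix of the inclusion of the indices of the second block which are not coupled to the
first block. -/
def extraMatrix (p q : ℕ) : Matrix (Fin (q - p)) (Fin q) ℝ :=
  of fun k l => if l = Fin.castLE (Nat.sub_le q p) k then 1 else 0

theorem extra_ne_partner (k : Fin (q - p)) (j : Fin p) :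
    Fin.castLE (Nat.sub_le q p) k ≠ partner h j := by
  intro e
  have h1 := congrArg Fin.val e
  simp only [partner, Fin.val_rev, Fin.val_castLE] at h1
  omega

theorem extraMatrix_mul_transpose : extraMatrix p q * (extraMatrix p q)ᵀ = 1 := by
  ext i j
  simp [extraMatrix, mul_apply, one_apply, (Fin.castLE_injective (Nat.sub_le q p)).eq_iff, eq_comm]

theorem partnerMatrix_mul_extraMatrix : partnerMatrix h ℝ * (extraMatrix p q)ᵀ = 0 := by
  ext i j
  simp [extraMatrix, partnerMatrix, mul_apply, extra_ne_partner]

theorem extraMatrix_mul_partnerMatrix : extraMatrix p q * (partnerMatrix h ℝ)ᵀ = 0 := by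
  have := congrArg transpose (partnerMatrix_mul_extraMatrix h)
  rwa [transpose_mul, transpose_transpose, transpose_zero] at this

theorem partner_add_extra :
    (partnerMatrix h ℝ)ᵀ * partnerMatrix h ℝ + (extraMatrix p q)ᵀ * extraMatrix p q = 1 := by
  ext i j
  by_cases hi : i.val < q - p
  · obtain ⟨k, rfl⟩ : ∃ k : Fin (q - p), i = Fin.castLE (Nat.sub_le q p) k := ⟨⟨i, hi⟩, rfl⟩
    have h1 : ∀ l, partnerMatrix h ℝ l (Fin.castLE (Nat.sub_le q p) k) = 0 := fun l => by
      simp [partnerMatrix, extra_ne_partner]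
    have h2 : ∀ l, extraMatrix p q l (Fin.castLE (Nat.sub_le q p) k) = if k = l then 1 else 0 :=
      fun l => by simp [extraMatrix, (Fin.castLE_injective (Nat.sub_le q p)).eq_iff]
    simp only [Matrix.add_apply, mul_apply, transpose_apply, h1, h2, zero_mul,
      Finset.sum_const_zero, zero_add, ite_mul, one_mul, Finset.sum_ite_eq, Finset.mem_univ,
      if_true]
    simp [extraMatrix, one_apply, eq_comm]
  · obtain ⟨k, rfl⟩ : ∃ k : Fin p, i = partner h k := by
      refine ⟨⟨q - 1 - i, by omega⟩, Fin.ext ?_⟩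
      simp only [partner, Fin.val_rev, Fin.val_castLE]
      omega
    have h1 : ∀ l, extraMatrix p q l (partner h k) = 0 := fun l => by
      simp [extraMatrix, (extra_ne_partner h _ _).symm]
    have h2 : ∀ l, partnerMatrix h ℝ l (partner h k) = if k = l then 1 else 0 :=
      fun l => by simp [partnerMatrix, (partner_injective h).eq_iff]
    simp only [Matrix.add_apply, mul_apply, transpose_apply, h1, h2, zero_mul,
      Finset.sum_const_zero, add_zero, ite_mul, one_mul, Finset.sum_ite_eq, Finset.mem_univ,
      if_true]
    simp [partnerMatrix, one_apply, eq_comm]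

/-- The embedding of `M_p(ℂ) × M_{q-p}(ℝ)` in the centralizer of the symmetry at the base point. -/
def blockEmbedding (Z : Matrix (Fin p) (Fin p) ℂ) (D : Matrix (Fin (q - p)) (Fin (q - p)) ℝ) :
    Matrix (Fin p ⊕ Fin q) (Fin p ⊕ Fin q) ℝ :=
  fromBlocks (Z.map Complex.re) (Z.map Complex.im * partnerMatrix h ℝ)
    (-((partnerMatrix h ℝ)ᵀ * Z.map Complex.im))
    ((partnerMatrix h ℝ)ᵀ * Z.map Complex.re * partnerMatrix h ℝ +
      (extraMatrix p q)ᵀ * D * extraMatrix p q)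

theorem map_re_mul {m : Type*} [Fintype m] (Z Z' : Matrix m m ℂ) : (Z * Z').map Complex.re =
    Z.map Complex.re * Z'.map Complex.re - Z.map Complex.im * Z'.map Complex.im := by
  ext i j
  simp [mul_apply, Finset.sum_sub_distrib]

theorem map_im_mul {m : Type*} [Fintype m] (Z Z' : Matrix m m ℂ) : (Z * Z').map Complex.im =
    Z.map Complex.re * Z'.map Complex.im + Z.map Complex.im * Z'.map Complex.re := by
  ext i j
  simp [mul_apply, Finset.sum_add_distrib]

/-- On the `2p` coupled coordinates this is the realification of complex matrices. The uncoupled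
coordinates are orthogonal to them and carry the real factor. -/
theorem blockEmbedding_mul (Z Z' : Matrix (Fin p) (Fin p) ℂ)
    (D D' : Matrix (Fin (q - p)) (Fin (q - p)) ℝ) :
    blockEmbedding h (Z * Z') (D * D') = blockEmbedding h Z D * blockEmbedding h Z' D' := by
  have w1 : ∀ {l : Type} [Fintype l] (X : Matrix (Fin p) l ℝ),
      partnerMatrix h ℝ * ((partnerMatrix h ℝ)ᵀ * X) = X := fun X => by
    rw [← Matrix.mul_assoc, partnerMatrix_mul_transpose, Matrix.one_mul]
  have w2 : ∀ {l : Type} [Fintype l] (X : Matrix (Fin (q - p)) l ℝ),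
      partnerMatrix h ℝ * ((extraMatrix p q)ᵀ * X) = 0 := fun X => by
    rw [← Matrix.mul_assoc, partnerMatrix_mul_extraMatrix, Matrix.zero_mul]
  have w3 : ∀ {l : Type} [Fintype l] (X : Matrix (Fin p) l ℝ),
      extraMatrix p q * ((partnerMatrix h ℝ)ᵀ * X) = 0 := fun X => by
    rw [← Matrix.mul_assoc, extraMatrix_mul_partnerMatrix, Matrix.zero_mul]
  have w4 : ∀ {l : Type} [Fintype l] (X : Matrix (Fin (q - p)) l ℝ),
      extraMatrix p q * ((extraMatrix p q)ᵀ * X) = X := fun X => by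
    rw [← Matrix.mul_assoc, extraMatrix_mul_transpose, Matrix.one_mul]
  rw [blockEmbedding, blockEmbedding, blockEmbedding, fromBlocks_multiply, map_re_mul, map_im_mul]
  congr 1
  · simp only [Matrix.mul_assoc, Matrix.mul_neg, w1, sub_eq_add_neg]
  · simp only [Matrix.mul_assoc, Matrix.mul_add, Matrix.add_mul, w1, w2, Matrix.mul_zero, add_zero]
  · simp only [Matrix.mul_assoc, Matrix.mul_neg, Matrix.neg_mul, Matrix.mul_add, Matrix.add_mul, w1,
      w3, Matrix.mul_zero, add_zero, neg_add]
    rw [add_comm]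
  · simp only [Matrix.mul_assoc, Matrix.neg_mul, Matrix.mul_add, Matrix.add_mul, Matrix.sub_mul,
      Matrix.mul_sub, w1, w2, w3, w4, Matrix.mul_zero, add_zero, zero_add]
    abel

/-- `𝔰𝔬(p, ℂ) ⊕ 𝔰𝔬(q - p)` as a Lie algebra of real matrices. -/
def blockLieHom : (soAlg ℂ p × soAlg ℝ (q - p)) →ₗ⁅ℝ⁆ Matrix (Fin p ⊕ Fin q) (Fin p ⊕ Fin q) ℝ where
  toFun x := blockEmbedding h x.1.val x.2.val
  map_add' x y := by
    have e1 : (x + y).1.val = x.1.val + y.1.val := rfl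
    have e2 : (x + y).2.val = x.2.val + y.2.val := rfl
    rw [e1, e2, blockEmbedding, blockEmbedding, blockEmbedding, fromBlocks_add,
      Matrix.map_add _ Complex.add_re, Matrix.map_add _ Complex.add_im]
    congr 1
    · rw [Matrix.add_mul]
    · rw [Matrix.mul_add, neg_add]
    · simp only [Matrix.mul_add, Matrix.add_mul]; abel
  map_smul' c x := by
    have e1 : (c • x).1.val = c • x.1.val := rfl
    have e2 : (c • x).2.val = c • x.2.val := rfl
    have r1 : (c • x.1.val).map Complex.re = c • x.1.val.map Complex.re := by ext; simp
    have r2 : (c • x.1.val).map Complex.im = c • x.1.val.map Complex.im := by ext; simp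
    rw [e1, e2, RingHom.id_apply, blockEmbedding, blockEmbedding, fromBlocks_smul, r1, r2]
    simp only [Matrix.smul_mul, Matrix.mul_smul, smul_add, smul_neg]
  map_lie' {x y} := by
    have e1 : ⁅x, y⁆.1.val = x.1.val * y.1.val - y.1.val * x.1.val := rfl
    have e2 : ⁅x, y⁆.2.val = x.2.val * y.2.val - y.2.val * x.2.val := rfl
    have hsub : ∀ (Z Z' : Matrix (Fin p) (Fin p) ℂ) (D D' : Matrix (Fin (q - p)) (Fin (q - p)) ℝ),
        blockEmbedding h (Z - Z') (D - D') = blockEmbedding h Z D - blockEmbedding h Z' D' := by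
      intro Z Z' D D'
      rw [blockEmbedding, blockEmbedding, blockEmbedding, sub_eq_add_neg (fromBlocks _ _ _ _),
        fromBlocks_neg, fromBlocks_add,
        Matrix.map_sub _ Complex.sub_re, Matrix.map_sub _ Complex.sub_im]
      congr 1
      · rw [Matrix.sub_mul, sub_eq_add_neg]
      · rw [Matrix.mul_sub]; abel
      · simp only [Matrix.mul_sub, Matrix.sub_mul]; abel
    rw [e1, e2, hsub, blockEmbedding_mul, blockEmbedding_mul, Ring.lie_def]

theorem blockLieHom_apply (x : soAlg ℂ p × soAlg ℝ (q - p)) :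
    blockLieHom h x = blockEmbedding h x.1.val x.2.val := rfl

theorem blockLieHom_injective : Function.Injective (blockLieHom h) := by
  intro x y hxy
  rw [blockLieHom_apply, blockLieHom_apply, blockEmbedding, blockEmbedding, fromBlocks_inj] at hxy
  obtain ⟨h1, h2, -, h4⟩ := hxy
  have h3 : x.1.val.map Complex.im = y.1.val.map Complex.im := by
    have := congrArg (· * (partnerMatrix h ℝ)ᵀ) h2
    simpa only [Matrix.mul_assoc, partnerMatrix_mul_transpose, Matrix.mul_one] using this
  rw [h1, add_right_inj] at h4
  have h5 : x.2.val = y.2.val := by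
    have := congrArg (fun M => extraMatrix p q * M * (extraMatrix p q)ᵀ) h4
    simp only [Matrix.mul_assoc, extraMatrix_mul_transpose, Matrix.mul_one] at this
    simpa only [← Matrix.mul_assoc, extraMatrix_mul_transpose, Matrix.one_mul] using this
  refine Prod.ext (Subtype.ext ?_) (Subtype.ext h5)
  ext i j
  exact Complex.ext (congrFun (congrFun h1 i) j) (congrFun (congrFun h3 i) j)

theorem commute_complexification_iff {ι : Type*} [Fintype ι] [DecidableEq ι]
    (X P Q : Matrix ι ι ℝ) :
    X.map (algebraMap ℝ ℂ) * (P.map (algebraMap ℝ ℂ) + Complex.I • Q.map (algebraMap ℝ ℂ)) =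
      (P.map (algebraMap ℝ ℂ) + Complex.I • Q.map (algebraMap ℝ ℂ)) * X.map (algebraMap ℝ ℂ) ↔
    X * P = P * X ∧ X * Q = Q * X := by
  have e1 : X.map (algebraMap ℝ ℂ) * (P.map (algebraMap ℝ ℂ) + Complex.I • Q.map (algebraMap ℝ ℂ)) =
      (X * P).map (algebraMap ℝ ℂ) + Complex.I • (X * Q).map (algebraMap ℝ ℂ) := by
    rw [mul_add, mul_smul_comm, Matrix.map_mul, Matrix.map_mul]
  have e2 : (P.map (algebraMap ℝ ℂ) + Complex.I • Q.map (algebraMap ℝ ℂ)) * X.map (algebraMap ℝ ℂ) =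
      (P * X).map (algebraMap ℝ ℂ) + Complex.I • (Q * X).map (algebraMap ℝ ℂ) := by
    rw [add_mul, smul_mul_assoc, Matrix.map_mul, Matrix.map_mul]
  rw [e1, e2]
  constructor
  · intro e
    constructor
    · ext i j
      simpa using congrArg Complex.re (congrFun (congrFun e i) j)
    · ext i j
      simpa using congrArg Complex.im (congrFun (congrFun e i) j)
  · rintro ⟨h1, h2⟩
    rw [h1, h2]

theorem isSkewFor_signMatrix_iff (A : Matrix (Fin p) (Fin p) ℝ) (B : Matrix (Fin p) (Fin q) ℝ)
    (C : Matrix (Fin q) (Fin p) ℝ) (D : Matrix (Fin q) (Fin q) ℝ) :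
    IsSkewFor (signMatrix p q ℝ) (fromBlocks A B C D) ↔ Aᵀ = -A ∧ C = Bᵀ ∧ Dᵀ = -D := by
  rw [IsSkewFor, signMatrix, fromBlocks_transpose, fromBlocks_multiply, fromBlocks_multiply,
    fromBlocks_add, ← fromBlocks_zero, fromBlocks_inj]
  simp only [Matrix.mul_one, Matrix.mul_zero, Matrix.one_mul, Matrix.zero_mul, add_zero, zero_add,
    Matrix.mul_neg, Matrix.neg_mul]
  constructor
  · rintro ⟨h1, -, h3, h4⟩
    refine ⟨eq_neg_of_add_eq_zero_left h1, (add_neg_eq_zero.1 h3).symm, ?_⟩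
    rw [← neg_eq_iff_eq_neg]
    exact eq_of_sub_eq_zero (by rw [← h4]; abel)
  · rintro ⟨h1, h2, h3⟩
    refine ⟨by rw [h1, neg_add_cancel], ?_, by rw [h2, add_neg_cancel], by rw [h3]; abel⟩
    rw [h2, transpose_transpose, neg_add_cancel]

/-- The two commutation relations are the real and imaginary parts of commuting with the symmetry.
The first involves the projection to the uncoupled coordinates and forces `X` to preserve the
splitting. The second says that on the coupled coordinates `X` is linear for a complex structure. -/
theorem mem_range_blockLieHom_iff (X : Matrix (Fin p ⊕ Fin q) (Fin p ⊕ Fin q) ℝ) :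
    X ∈ (blockLieHom h).range ↔ IsSkewFor (signMatrix p q ℝ) X ∧
      X * fromBlocks 0 0 0 (-(1 - (partnerMatrix h ℝ)ᵀ * partnerMatrix h ℝ)) =
        fromBlocks 0 0 0 (-(1 - (partnerMatrix h ℝ)ᵀ * partnerMatrix h ℝ)) * X ∧
      X * fromBlocks 0 (-partnerMatrix h ℝ) (partnerMatrix h ℝ)ᵀ 0 =
        fromBlocks 0 (-partnerMatrix h ℝ) (partnerMatrix h ℝ)ᵀ 0 * X := by
  have hR : 1 - (partnerMatrix h ℝ)ᵀ * partnerMatrix h ℝ = (extraMatrix p q)ᵀ * extraMatrix p q := by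
    rw [← partner_add_extra h, add_sub_cancel_left]
  have hsum := partner_add_extra h
  have w0 := partnerMatrix_mul_transpose (𝕜 := ℝ) h
  have uw := extraMatrix_mul_partnerMatrix h
  have w1 : ∀ {l : Type} [Fintype l] (X : Matrix (Fin p) l ℝ),
      partnerMatrix h ℝ * ((partnerMatrix h ℝ)ᵀ * X) = X := fun X => by
    rw [← Matrix.mul_assoc, partnerMatrix_mul_transpose, Matrix.one_mul]
  have w2 : ∀ {l : Type} [Fintype l] (X : Matrix (Fin (q - p)) l ℝ),
      partnerMatrix h ℝ * ((extraMatrix p q)ᵀ * X) = 0 := fun X => by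
    rw [← Matrix.mul_assoc, partnerMatrix_mul_extraMatrix, Matrix.zero_mul]
  have w3 : ∀ {l : Type} [Fintype l] (X : Matrix (Fin p) l ℝ),
      extraMatrix p q * ((partnerMatrix h ℝ)ᵀ * X) = 0 := fun X => by
    rw [← Matrix.mul_assoc, extraMatrix_mul_partnerMatrix, Matrix.zero_mul]
  have w4 : ∀ {l : Type} [Fintype l] (X : Matrix (Fin (q - p)) l ℝ),
      extraMatrix p q * ((extraMatrix p q)ᵀ * X) = X := fun X => by
    rw [← Matrix.mul_assoc, extraMatrix_mul_transpose, Matrix.one_mul]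
  rw [hR]
  constructor
  · rintro ⟨x, rfl⟩
    have hx1 : x.1.valᵀ = -x.1.val := x.1.2
    have hx2 : x.2.valᵀ = -x.2.val := x.2.2
    have a1 : (x.1.val.map Complex.re)ᵀ = -x.1.val.map Complex.re := by
      rw [← transpose_map, hx1]; ext; simp
    have a2 : (x.1.val.map Complex.im)ᵀ = -x.1.val.map Complex.im := by
      rw [← transpose_map, hx1]; ext; simp
    change IsSkewFor _ (blockEmbedding h x.1.val x.2.val) ∧
      blockEmbedding h x.1.val x.2.val * _ = _ * blockEmbedding h x.1.val x.2.val ∧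
      blockEmbedding h x.1.val x.2.val * _ = _ * blockEmbedding h x.1.val x.2.val
    rw [blockEmbedding, isSkewFor_signMatrix_iff, fromBlocks_multiply, fromBlocks_multiply,
      fromBlocks_multiply, fromBlocks_multiply, fromBlocks_inj, fromBlocks_inj]
    simp only [Matrix.mul_zero, Matrix.zero_mul, add_zero, zero_add, Matrix.mul_neg, Matrix.neg_mul,
      Matrix.mul_add, Matrix.add_mul, Matrix.mul_assoc, w0, w1, w2, w3, w4, uw, neg_zero,
      transpose_mul, transpose_add, transpose_transpose, a1, a2, hx2, neg_neg, Matrix.mul_one,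
      neg_add, and_self]
  · rw [← fromBlocks_toBlocks X]
    generalize X.toBlocks₁₁ = A
    generalize X.toBlocks₁₂ = B
    generalize X.toBlocks₂₁ = C
    generalize X.toBlocks₂₂ = D
    rw [isSkewFor_signMatrix_iff, fromBlocks_multiply, fromBlocks_multiply,
      fromBlocks_multiply, fromBlocks_multiply, fromBlocks_inj, fromBlocks_inj]
    simp only [Matrix.mul_zero, Matrix.zero_mul, add_zero, zero_add, Matrix.mul_neg, Matrix.neg_mul,
      neg_inj, neg_eq_zero, zero_eq_neg]
    rintro ⟨⟨hA, rfl, hD⟩, ⟨-, hBR, -, hDR⟩, ⟨h1, h2, h3, h4⟩⟩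
    have hBW : (B * (partnerMatrix h ℝ)ᵀ)ᵀ = -(B * (partnerMatrix h ℝ)ᵀ) := by
      rw [transpose_mul, transpose_transpose, h1, neg_neg]
    have hB : B * (partnerMatrix h ℝ)ᵀ * partnerMatrix h ℝ = B := by
      rw [Matrix.mul_assoc, eq_sub_of_add_eq hsum, Matrix.mul_sub, hBR, Matrix.mul_one, sub_zero]
    -- The complex matrix is recovered with real part the upper left block and imaginary part the
    -- upper right block, read through the coupling.
    let Z : Matrix (Fin p) (Fin p) ℂ := of fun i j => ⟨A i j, (B * (partnerMatrix h ℝ)ᵀ) i j⟩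
    have hZ : Zᵀ = -Z := by
      ext i j
      exact Complex.ext (congrFun (congrFun hA i) j) (congrFun (congrFun hBW i) j)
    have hD' : (extraMatrix p q * D * (extraMatrix p q)ᵀ)ᵀ =
        -(extraMatrix p q * D * (extraMatrix p q)ᵀ) := by
      rw [transpose_mul, transpose_mul, transpose_transpose, hD]
      simp only [Matrix.mul_neg, Matrix.neg_mul, Matrix.mul_assoc]
    refine ⟨(⟨Z, hZ⟩, ⟨_, hD'⟩), ?_⟩
    change blockEmbedding h Z _ = _
    have z1 : Z.map Complex.re = A := rfl
    have z2 : Z.map Complex.im = B * (partnerMatrix h ℝ)ᵀ := rfl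
    rw [blockEmbedding, z1, z2]
    congr 1
    · rw [← Matrix.mul_neg, ← hBW, transpose_mul, transpose_transpose, ← Matrix.mul_assoc]
      have := congrArg transpose hB
      rwa [transpose_mul, transpose_mul, transpose_transpose, ← Matrix.mul_assoc] at this
    · calc _ = (partnerMatrix h ℝ)ᵀ * (A * partnerMatrix h ℝ) +
            ((extraMatrix p q)ᵀ * extraMatrix p q) * (D * ((extraMatrix p q)ᵀ * extraMatrix p q)) := by
            simp only [Matrix.mul_assoc]
        _ = (partnerMatrix h ℝ)ᵀ * (partnerMatrix h ℝ * D) +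
            ((extraMatrix p q)ᵀ * extraMatrix p q) *
              (((extraMatrix p q)ᵀ * extraMatrix p q) * D) := by rw [hDR, h2]
        _ = ((partnerMatrix h ℝ)ᵀ * partnerMatrix h ℝ + (extraMatrix p q)ᵀ * extraMatrix p q) *
            D := by simp only [Matrix.mul_assoc, w4, Matrix.add_mul]
        _ = D := by rw [hsum, Matrix.one_mul]

end LieAlgebraPQ

/-! ### The Lie algebra of the stabilizer, and the theorem for `SO_e(p,q)`. -/

section LieAlgebraPQ

variable {p q : ℕ}

/-- One-parameter subgroups of the stabilizer are generated by the elements of `𝔰𝔬(p,q)` that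
commute with the symmetry. The symmetry is `P + i Q` with `P`, `Q` real and `X` is real, so this
amounts to two real equations. -/
theorem mem_stabilizerOf_boundaryPoint_exp_iff (h : p ≤ q)
    (X : Matrix (Fin p ⊕ Fin q) (Fin p ⊕ Fin q) ℝ) :
    (∀ t : ℝ, ∃ g : SOe p q, g ∈ stabilizerOf (SOeToComplex p q)
      (boundaryPoint h 1 : SOpq p q ℂ ⧸ KCpq p q) ∧ g.val.val = NormedSpace.exp (t • X)) ↔
    X ∈ (blockLieHom h).range := by
  have hsymm : open scoped Matrix.Norms.Operator in (realizationPQ p q).symm (boundaryPoint h 1) =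
      (fromBlocks 0 0 0 (-(1 - (partnerMatrix h ℝ)ᵀ * partnerMatrix h ℝ))).map (algebraMap ℝ ℂ) +
        Complex.I • (fromBlocks 0 (-partnerMatrix h ℝ) (partnerMatrix h ℝ)ᵀ 0).map
          (algebraMap ℝ ℂ) := by
    have hW := map_partnerMatrix h (algebraMap ℝ ℂ)
    have h0 : ∀ m n : Type, (0 : Matrix m n ℝ).map (algebraMap ℝ ℂ) = 0 := fun m n =>
      Matrix.map_zero _ (map_zero _)
    have h1 : (1 : Matrix (Fin q) (Fin q) ℝ).map (algebraMap ℝ ℂ) = 1 :=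
      Matrix.map_one _ (map_zero _) (map_one _)
    have hn : ∀ {m n : Type} (M : Matrix m n ℝ),
        (-M).map (algebraMap ℝ ℂ) = -M.map (algebraMap ℝ ℂ) := fun M => by ext; simp
    rw [symm_boundaryPoint_one, fromBlocks_map, fromBlocks_map, h0, h0, h0, h0, hn, hn,
      Matrix.map_sub _ (map_sub _), Matrix.map_mul, transpose_map, hW, h1, fromBlocks_smul,
      fromBlocks_add]
    simp
  have hmap : ∀ t : ℝ, (t • X).map (algebraMap ℝ ℂ) = t • X.map (algebraMap ℝ ℂ) := fun t => by
    ext; simp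
  have hexp : ∀ t : ℝ, (NormedSpace.exp (t • X)).map (algebraMap ℝ ℂ) =
      NormedSpace.exp (t • X.map (algebraMap ℝ ℂ)) := fun t => by
    rw [← hmap, ← Matrix.map_exp_ofReal]
  rw [mem_range_blockLieHom_iff, ← commute_complexification_iff, ← hsymm]
  constructor
  · intro H
    refine ⟨isSkewFor_of_exp fun t => ?_, ?_⟩
    · obtain ⟨g, -, hg⟩ := H t
      rw [← hg]
      exact ((mem_SOe_iff _).1 g.2).1.1
    · open scoped Matrix.Norms.Operator in
      refine (realizationPQ p q).commute_of_mem_stabilizerOf fun t => ?_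
      obtain ⟨g, hg, e⟩ := H t
      exact ⟨g, hg, (congrArg (fun M => M.map (algebraMap ℝ ℂ)) e).trans (hexp t)⟩
  · rintro ⟨hX, hc⟩ t
    let γ : ℝ → SOe p q := fun t => ⟨expGL (t • X), (hX.smul t).expGL_mem_SOe⟩
    have hγ : Continuous γ :=
      (continuous_expGL.comp (continuous_id.smul continuous_const)).subtype_mk _
    refine ⟨γ t, ?_, rfl⟩
    open scoped Matrix.Norms.Operator in
    refine (realizationPQ p q).mem_stabilizerOf_of_commute hc hγ (fun s t => Subtype.ext ?_)
      hexp t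
    exact expGL_add_smul X s t

theorem hasLieAlgebra_stabilizerOf_boundaryPoint (h : p ≤ q) :
    HasLieAlgebra (stabilizerOf (SOeToComplex p q) (boundaryPoint h 1 : SOpq p q ℂ ⧸ KCpq p q))
      (soAlg ℂ p × soAlg ℝ (q - p)) :=
  ⟨(blockLieHom h).range, fun X => (mem_stabilizerOf_boundaryPoint_exp_iff h X).symm,
    ⟨(LieEquiv.ofInjective _ (blockLieHom_injective h)).symm⟩⟩

/-- For `p = q` the factor `𝔰𝔬(q - p)` is zero and is dropped. -/
theorem HasLieAlgebra.fst {ι 𝕜 : Type*} [Fintype ι] [DecidableEq ι] [RCLike 𝕜]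
    {G : Subgroup (GL ι 𝕜)} {H : Subgroup G} {L M : Type*} [LieRing L] [LieAlgebra ℝ L]
    [LieRing M] [LieAlgebra ℝ M] [Subsingleton M] (hL : HasLieAlgebra H (L × M)) :
    HasLieAlgebra H L := by
  obtain ⟨𝔥, h𝔥, ⟨e⟩⟩ := hL
  let f : (L × M) ≃ₗ⁅ℝ⁆ L :=
    { toFun := Prod.fst
      map_add' := fun _ _ => rfl
      map_smul' := fun _ _ => rfl
      map_lie' := rfl
      invFun := fun x => (x, 0)
      left_inv := fun x => Prod.ext rfl (Subsingleton.elim _ _)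
      right_inv := fun _ => rfl }
  exact ⟨𝔥, h𝔥, ⟨e.trans f⟩⟩

end LieAlgebraPQ

theorem isoHomogeneous_boundaryPQ {p q : ℕ} (hpq : p < q) : ∃ H : Subgroup (SOe p q),
    IsoHomogeneous (SOeToComplex p q) (boundaryPQ p q hpq.le) H ∧
    HasLieAlgebra H (soAlg ℂ p × soAlg ℝ (q - p)) :=
  ⟨_, isoHomogeneous_of_locallyTransitive continuous_SOeToComplex (boundaryPQ_eq_orbit hpq)
    (locallyTransitiveAt_boundaryPQ hpq.le 1), hasLieAlgebra_stabilizerOf_boundaryPoint hpq.le⟩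

theorem isoHomogeneousSum_boundaryPQ {n : ℕ} (hn : 1 ≤ n) : ∃ H₁ H₂ : Subgroup (SOe n n),
    IsoHomogeneousSum (SOeToComplex n n) (boundaryPQ n n le_rfl) H₁ H₂ ∧
    (∃ κ : SOe n n ≃ₜ* SOe n n, H₁.map κ.toMulEquiv.toMonoidHom = H₂) ∧
    (Odd n → H₁ = H₂) ∧
    HasLieAlgebra H₁ (soAlg ℂ n) ∧ HasLieAlgebra H₂ (soAlg ℂ n) := by
  -- Any `r` with product `-1` represents the second orbit. For odd `n` the choice `r = -1` makes
  -- the second base point the complex conjugate of the first, so the stabilizers agree.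
  obtain ⟨r, hr, hodd⟩ : ∃ r : Fin n → ℤˣ, ∏ i, r i = -1 ∧ (Odd n → r = -1) := by
    by_cases ho : Odd n
    · exact ⟨-1, by simp [ho.neg_one_pow], fun _ => rfl⟩
    · exact ⟨Pi.mulSingle ⟨0, hn⟩ (-1), by rw [Fintype.prod_pi_mulSingle'], fun h => absurd h ho⟩
  have hL : HasLieAlgebra (stabilizerOf (SOeToComplex n n)
      (boundaryPoint (le_refl n) 1 : SOpq n n ℂ ⧸ KCpq n n)) (soAlg ℂ n) := by
    have : Subsingleton (soAlg ℝ (n - n)) := by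
      rw [Nat.sub_self]
      infer_instance
    exact (hasLieAlgebra_stabilizerOf_boundaryPoint (le_refl n)).fst
  have hκ := mem_stabilizerOf_boundaryPoint_iff (le_refl n) r
  refine ⟨_, _, isoHomogeneousSum_of_locallyTransitive continuous_SOeToComplex
    (boundaryPQ_eq_orbits hr) (smul_boundaryPoint_ne hr)
    (locallyTransitiveAt_boundaryPQ (le_refl n) 1) (locallyTransitiveAt_boundaryPQ (le_refl n) r),
    ⟨conjBlockSign n r, map_eq_of_mem_iff _ hκ⟩, fun ho => ?_, hL,
    hL.conj (blockSignGL n ℝ r) (conjBlockSign n r) (fun _ => rfl) hκ⟩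
  rw [hodd ho, stabilizerOf_boundaryPoint_neg_one]

/-! ### The subspace `𝔞` of `𝔰𝔬(m,ℂ)` in block form, and its root vectors in `𝔰𝔬*(2m)`. -/

section Pairs

attribute [-instance] LieRing.ofAssociativeRing

variable {m : ℕ}

/-- The grouping of the coordinates `0, …, 2 ⌊m / 2⌋ - 1` of `ℂ ^ m` in pairs. -/
def pairIndex (m : ℕ) : Fin (m / 2) ⊕ Fin (m / 2) → Fin m :=
  Sum.elim (fun j => ⟨2 * j, by omega⟩) fun j => ⟨2 * j + 1, by omega⟩

theorem pairIndex_injective (m : ℕ) : Function.Injective (pairIndex m) := by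
  rintro (i | i) (j | j) e <;> have e' := congrArg Fin.val e <;>
    simp only [pairIndex, Sum.elim_inl, Sum.elim_inr] at e'
  · exact congrArg _ (Fin.ext (by omega))
  · omega
  · omega
  · exact congrArg _ (Fin.ext (by omega))

theorem mem_range_pairIndex_iff (k : Fin m) :
    k ∈ Set.range (pairIndex m) ↔ k.val < 2 * (m / 2) := by
  constructor
  · rintro ⟨i | i, rfl⟩ <;> simp only [pairIndex, Sum.elim_inl, Sum.elim_inr] <;> omega
  · intro hk
    rcases Nat.even_or_odd' k.val with ⟨c, hc | hc⟩
    · exact ⟨.inl ⟨c, by omega⟩, Fin.ext hc.symm⟩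
    · exact ⟨.inr ⟨c, by omega⟩, Fin.ext hc.symm⟩

/-- The matrix of the coordinate embedding given by `pairIndex`. -/
def pairMatrix (m : ℕ) : Matrix (Fin (m / 2) ⊕ Fin (m / 2)) (Fin m) ℂ :=
  of fun i k => if k = pairIndex m i then 1 else 0

theorem pairMatrix_mul_transpose (m : ℕ) : pairMatrix m * (pairMatrix m)ᵀ = 1 := by
  ext i j
  simp [pairMatrix, mul_apply, one_apply, (pairIndex_injective m).eq_iff, eq_comm]

theorem map_pairMatrix (m : ℕ) : (pairMatrix m).map (starRingEnd ℂ) = pairMatrix m := by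
  ext i j
  simp [pairMatrix, apply_ite (starRingEnd ℂ)]

theorem transpose_pairMatrix_mul_single (a b : Fin (m / 2) ⊕ Fin (m / 2)) (c : ℂ) :
    (pairMatrix m)ᵀ * single a b c * pairMatrix m = single (pairIndex m a) (pairIndex m b) c := by
  ext i k
  rw [mul_apply, Finset.sum_eq_single b]
  · rw [mul_single_apply_same]
    simp only [transpose_apply, pairMatrix, of_apply, single_apply]
    split_ifs <;> simp_all
  · intro l _ hl
    rw [mul_single_apply_of_ne _ _ _ _ _ hl, zero_mul]
  · simp

theorem pairMatrix_conj_apply (M : Matrix (Fin (m / 2) ⊕ Fin (m / 2)) (Fin (m / 2) ⊕ Fin (m / 2)) ℂ)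
    (a b : Fin (m / 2) ⊕ Fin (m / 2)) :
    ((pairMatrix m)ᵀ * M * pairMatrix m) (pairIndex m a) (pairIndex m b) = M a b := by
  simp [mul_apply, pairMatrix, (pairIndex_injective m).eq_iff]

theorem pairMatrix_conj_apply_of_notMem
    (M : Matrix (Fin (m / 2) ⊕ Fin (m / 2)) (Fin (m / 2) ⊕ Fin (m / 2)) ℂ) {i k : Fin m}
    (h : i ∉ Set.range (pairIndex m) ∨ k ∉ Set.range (pairIndex m)) :
    ((pairMatrix m)ᵀ * M * pairMatrix m) i k = 0 := by
  have h0 : ∀ k ∉ Set.range (pairIndex m), ∀ b, k ≠ pairIndex m b := fun k hk b e => hk ⟨b, e.symm⟩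
  rcases h with h | h
  · simp [mul_apply, pairMatrix, h0 _ h]
  · simp [mul_apply, pairMatrix, h0 _ h]

theorem pairMatrix_mul_diagonalSign (d : Fin m → ℤˣ) : pairMatrix m * diagonalSign ℂ d =
    diagonalSign ℂ (d ∘ pairIndex m) * pairMatrix m := by
  ext i k
  rw [diagonalSign_apply, diagonalSign_apply, mul_diagonal, diagonal_mul]
  by_cases h : k = pairIndex m i <;> simp [pairMatrix, h]

theorem aC_eq (t : Fin (m / 2) → ℝ) : aC m t = (pairMatrix m)ᵀ *
    fromBlocks 0 (diagonal fun j => Complex.I * t j) (-diagonal fun j => Complex.I * t j) 0 *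
      pairMatrix m := by
  have h : fromBlocks 0 (diagonal fun j => Complex.I * t j) (-diagonal fun j => Complex.I * t j) 0 =
      ∑ j : Fin (m / 2), t j • (single (Sum.inl j) (Sum.inr j) Complex.I -
        single (Sum.inr j) (Sum.inl j) Complex.I) := by
    ext (i | i) (k | k)
    · simp [Matrix.sum_apply]
    · simp only [fromBlocks_apply₁₂, Matrix.sum_apply, Matrix.smul_apply, Matrix.sub_apply]
      rw [Finset.sum_eq_single i] <;> simp +contextual [single_apply, diagonal_apply, eq_comm,
          mul_comm]
    · simp only [fromBlocks_apply₂₁, Matrix.sum_apply, Matrix.smul_apply, Matrix.sub_apply]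
      rw [Finset.sum_eq_single i] <;>
        simp +contextual [single_apply, diagonal_apply, eq_comm, mul_comm]
    · simp [Matrix.sum_apply]
  rw [h, aC, Fintype.linearCombination_apply, Matrix.mul_sum, Matrix.sum_mul]
  refine Finset.sum_congr rfl fun j _ => ?_
  rw [Matrix.mul_smul, Matrix.smul_mul, Matrix.mul_sub, Matrix.sub_mul,
    transpose_pairMatrix_mul_single, transpose_pairMatrix_mul_single]
  rfl

theorem map_conj_aC (t : Fin (m / 2) → ℝ) : (aC m t).map (starRingEnd ℂ) = -aC m t := by
  have h : (diagonal fun j => Complex.I * (t j : ℂ)).map (starRingEnd ℂ) =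
      -(diagonal fun j => Complex.I * (t j : ℂ)) := by
    ext i k
    rcases eq_or_ne i k with rfl | hik <;> simp [*]
  have h' : (-(diagonal fun j => Complex.I * (t j : ℂ))).map (starRingEnd ℂ) =
      (diagonal fun j => Complex.I * (t j : ℂ)) := by
    rw [Matrix.map_neg _ (map_neg _), h, neg_neg]
  rw [aC_eq, Matrix.map_mul, Matrix.map_mul, transpose_map, map_pairMatrix, fromBlocks_map, h, h',
    ← Matrix.neg_mul, ← Matrix.mul_neg, fromBlocks_neg]
  simp

theorem transpose_aC (t : Fin (m / 2) → ℝ) : (aC m t)ᵀ = -aC m t := by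
  rw [aC_eq, transpose_mul, transpose_mul, transpose_transpose, fromBlocks_transpose,
    ← Matrix.neg_mul, ← Matrix.mul_neg, fromBlocks_neg]
  simp [Matrix.mul_assoc]

theorem sum_norm_aC_lt (t : Fin (m / 2) → ℝ) (c : ℝ) (hc : 0 < c) (ht : ∀ j, |t j| < c)
    (i : Fin m) : ∑ k, ‖aC m t i k‖ < c := by
  rw [aC_eq]
  by_cases hi : i ∈ Set.range (pairIndex m)
  · obtain ⟨a, rfl⟩ := hi
    rw [← Fintype.sum_of_injective (pairIndex m) (pairIndex_injective m) _ _
      (fun k hk => by rw [pairMatrix_conj_apply_of_notMem _ (.inr hk), norm_zero])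
      (fun b => by rw [pairMatrix_conj_apply]), Fintype.sum_sum_type]
    rcases a with a | a
    · simp only [fromBlocks_apply₁₁, fromBlocks_apply₁₂]
      rw [Finset.sum_eq_single_of_mem (f := fun x => ‖diagonal _ a x‖) a (Finset.mem_univ _)
        (fun b _ hb => by rw [diagonal_apply_ne _ hb.symm, norm_zero])]
      simpa using ht a
    · simp only [fromBlocks_apply₂₁, fromBlocks_apply₂₂, Matrix.neg_apply, norm_neg]
      rw [Finset.sum_eq_single_of_mem (f := fun x => ‖diagonal _ a x‖) a (Finset.mem_univ _)
        (fun b _ hb => by rw [diagonal_apply_ne _ hb.symm, norm_zero])]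
      simpa using ht a
  · simpa [pairMatrix_conj_apply_of_notMem _ (.inl hi)] using hc

theorem sum_norm_toSoStar_aC_lt (t : Fin (m / 2) → ℝ) (c : ℝ) (hc : 0 < c) (ht : ∀ j, |t j| < c)
    (i : Fin m ⊕ Fin m) : ∑ k, ‖(toSoStar m ∘ₗ aC m) t i k‖ < c := by
  change ∑ k, ‖fromBlocks (aC m t) 0 0 ((aC m t).map (starRingEnd ℂ)) i k‖ < c
  rw [Fintype.sum_sum_type]
  rcases i with i | i
  · simpa using sum_norm_aC_lt t c hc ht i
  · simpa using sum_norm_aC_lt t c hc ht i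

/-- The vector `u = e_{2j} - i e_{2j+1}` is an eigenvector of the Hermitian matrix `a t` for `t j`,
so `M = u u*` satisfies `a M = M a = t_j M`. Since the conjugate of `a t` is `-a t`, the bracket
with the matrix having off-diagonal blocks `M` and `-conj M` adds the two sides instead of
cancelling them, which gives `2 t j`. The matrix lies in `𝔰𝔬*(2m)` because `M` is Hermitian. -/
theorem exists_root_vector_soStarAlg (j : Fin (m / 2)) : ∃ Z ∈ soStarAlg m, Z ≠ 0 ∧ ∀ t,
    (toSoStar m ∘ₗ aC m) t * Z - Z * (toSoStar m ∘ₗ aC m) t = (2 * t j) • Z := by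
  let u' : Fin (m / 2) ⊕ Fin (m / 2) → ℂ := Sum.elim (Pi.single j 1) (Pi.single j (-Complex.I))
  let u : Fin m → ℂ := (pairMatrix m)ᵀ *ᵥ u'
  have hu : ∀ t, aC m t *ᵥ u = (t j : ℂ) • u := by
    intro t
    rw [aC_eq, mulVec_mulVec, Matrix.mul_assoc, pairMatrix_mul_transpose, Matrix.mul_one,
      ← mulVec_mulVec, ← mulVec_smul, fromBlocks_mulVec]
    congr 1
    ext (i | i)
    · rcases eq_or_ne i j with rfl | hij
      · simp [u', ← mul_assoc]
      · simp [u', hij]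
    · rcases eq_or_ne i j with rfl | hij
      · simp [u', mul_comm]
      · simp [u', hij]
  have hu' : ∀ t, star u ᵥ* aC m t = (t j : ℂ) • star u := by
    intro t
    have hh : (aC m t)ᴴ = aC m t := by
      change (aC m t)ᵀ.map (starRingEnd ℂ) = _
      rw [transpose_aC, Matrix.map_neg _ (map_neg _), map_conj_aC, neg_neg]
    have := congrArg star (hu t)
    rw [star_mulVec, hh] at this
    rw [this, star_smul]
    simp
  have hMc : (vecMulVec u (star u)).map (starRingEnd ℂ) = vecMulVec (star u) u := by
    ext a b
    simp [vecMulVec_apply]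
  have hMt : (vecMulVec u (star u))ᵀ = vecMulVec (star u) u := by
    ext a b
    simp [vecMulVec_apply, mul_comm]
  have hMt' : (vecMulVec (star u) u)ᵀ = vecMulVec u (star u) := by
    rw [← hMt, transpose_transpose]
  have hMh : (vecMulVec u (star u))ᴴ = vecMulVec u (star u) := by
    rw [conjTranspose_vecMulVec, star_star]
  have hMh' : (vecMulVec (star u) u)ᴴ = vecMulVec (star u) u := by
    rw [conjTranspose_vecMulVec, star_star]
  have e1 : ∀ t, aC m t * vecMulVec u (star u) = (t j) • vecMulVec u (star u) := fun t => by
    rw [mul_vecMulVec, hu, smul_vecMulVec]; rfl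
  have e2 : ∀ t, vecMulVec u (star u) * aC m t = (t j) • vecMulVec u (star u) := fun t => by
    rw [vecMulVec_mul, hu', vecMulVec_smul]; rfl
  have e3 : ∀ t, aC m t * vecMulVec (star u) u = -((t j) • vecMulVec (star u) u) := fun t => by
    have := congrArg transpose (e2 t)
    rwa [transpose_mul, transpose_aC, hMt, transpose_smul, hMt, neg_mul, neg_eq_iff_eq_neg] at this
  have e4 : ∀ t, vecMulVec (star u) u * aC m t = -((t j) • vecMulVec (star u) u) := fun t => by
    have := congrArg transpose (e1 t)
    rwa [transpose_mul, transpose_aC, hMt, transpose_smul, hMt, mul_neg, neg_eq_iff_eq_neg] at this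
  refine ⟨fromBlocks 0 (vecMulVec u (star u)) (-vecMulVec (star u) u) 0, ⟨?_, ?_⟩, ?_, ?_⟩
  · rw [fromBlocks_transpose, fromBlocks_neg, transpose_neg, hMt, hMt']
    simp
  · rw [fromBlocks_conjTranspose, conjTranspose_neg, hMh, hMh', J, fromBlocks_multiply,
      fromBlocks_multiply, fromBlocks_add]
    simp
  · intro h0
    have h1 := congrFun (congrFun h0 (.inl (pairIndex m (.inl j)))) (.inr (pairIndex m (.inl j)))
    have h2 : u (pairIndex m (.inl j)) = 1 := by
      simp [u, u', mulVec, dotProduct, pairMatrix, (pairIndex_injective m).eq_iff]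
    simp [vecMulVec_apply, h2] at h1
  · intro t
    change fromBlocks (aC m t) 0 0 ((aC m t).map (starRingEnd ℂ)) * _ -
      _ * fromBlocks (aC m t) 0 0 ((aC m t).map (starRingEnd ℂ)) = _
    rw [map_conj_aC, fromBlocks_multiply, fromBlocks_multiply, fromBlocks_smul, sub_eq_add_neg,
      fromBlocks_neg, fromBlocks_add]
    simp only [Matrix.mul_zero, Matrix.zero_mul, add_zero, zero_add, Matrix.mul_neg, Matrix.neg_mul,
      e1, e2, e3, e4, neg_neg, neg_zero, smul_zero, smul_neg, two_mul, add_smul, neg_add]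

theorem OmegaC_eq (m : ℕ) : OmegaC m = Set.univ.pi fun _ => Set.Ioo (-(Real.pi / 4)) (Real.pi / 4) :=
  crownPolytope_eq_cube sum_norm_toSoStar_aC_lt exists_root_vector_soStarAlg

end Pairs

/-! ### The realization of `(SO(m,ℂ) × SO(m,ℂ)) / Δ` by symmetries. -/

section RealizationC

attribute [-instance] LieRing.ofAssociativeRing

variable {m : ℕ}

theorem Matrix.exp_fromBlocks_diagonal {ι : Type*} [Fintype ι] [DecidableEq ι]
    (A B : Matrix ι ι ℂ) : NormedSpace.exp (fromBlocks A 0 0 B) =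
      fromBlocks (NormedSpace.exp A) 0 0 (NormedSpace.exp B) := by
  open scoped Matrix.Norms.Operator in
  let f : Matrix ι ι ℂ × Matrix ι ι ℂ →+* Matrix (ι ⊕ ι) (ι ⊕ ι) ℂ :=
    { toFun := fun X => fromBlocks X.1 0 0 X.2
      map_one' := fromBlocks_one
      map_mul' := fun X Y => by rw [fromBlocks_multiply]; simp
      map_zero' := fromBlocks_zero
      map_add' := fun X Y => by rw [fromBlocks_add]; simp }
  have hf : Continuous f :=
    continuous_fst.matrix_fromBlocks continuous_const continuous_const continuous_snd
  have h := NormedSpace.map_exp f hf (A, B)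
  have h1 : NormedSpace.exp (A, B) = (NormedSpace.exp A, NormedSpace.exp B) :=
    Prod.ext (Prod.fst_exp _) (Prod.snd_exp _)
  exact h.symm.trans (congrArg f h1)

theorem SOC_inv_eq (g : SOC m) : (g⁻¹).val.val = g.val.valᵀ := by
  have h : g.val.val * (g⁻¹).val.val = 1 := g.val.mul_inv
  calc (g⁻¹).val.val = (g.val.valᵀ * g.val.val) * (g⁻¹).val.val := by rw [g.2.1, one_mul]
    _ = _ := by rw [mul_assoc, h, mul_one]

theorem expGL_mem_SOC {X : Matrix (Fin m) (Fin m) ℂ} (h : Xᵀ = -X) : expGL X ∈ SOC m := by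
  have h1 : IsSkewFor 1 X := by rw [IsSkewFor, h, mul_one, one_mul, neg_add_cancel]
  refine ⟨?_, h1.det_exp (by simp)⟩
  have := h1.exp_isometry
  rwa [mul_one] at this

/-- The exchange of the two summands of `ℂ ^ m ⊕ ℂ ^ m`. -/
def swapMatrix (m : ℕ) : Matrix (Fin m ⊕ Fin m) (Fin m ⊕ Fin m) ℂ := fromBlocks 0 1 1 0

theorem swapMatrix_mul_self (m : ℕ) : swapMatrix m * swapMatrix m = 1 := by
  simp [swapMatrix, fromBlocks_multiply]

theorem map_conj_swapMatrix (m : ℕ) : (swapMatrix m).map (starRingEnd ℂ) = swapMatrix m := by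
  rw [swapMatrix, fromBlocks_map, Matrix.map_one _ (map_zero _) (map_one _),
    Matrix.map_zero _ (map_zero _)]

theorem swapMatrix_conj (A B C D : Matrix (Fin m) (Fin m) ℂ) :
    swapMatrix m * fromBlocks A B C D * swapMatrix m = fromBlocks D C B A := by
  simp [swapMatrix, fromBlocks_multiply]

theorem signMatrix_conj (A B C D : Matrix (Fin m) (Fin m) ℂ) :
    signMatrix m m ℂ * fromBlocks A B C D * signMatrix m m ℂ = fromBlocks A (-B) (-C) D := by
  simp [signMatrix, fromBlocks_multiply]

/-- Conjugation by an involution, as an algebra homomorphism. -/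
def conjAlgHom {𝒜 : Type*} [Ring 𝒜] [Algebra ℝ 𝒜] (S : 𝒜) (hS : S * S = 1) : 𝒜 →ₐ[ℝ] 𝒜 where
  toFun X := S * X * S
  map_one' := by rw [mul_one, hS]
  map_mul' X Y := by
    calc _ = S * X * 1 * Y * S := by rw [mul_one]; simp only [mul_assoc]
      _ = _ := by rw [← hS]; simp only [mul_assoc]
  map_zero' := by rw [mul_zero, zero_mul]
  map_add' X Y := by rw [mul_add, add_mul]
  commutes' t := by rw [← Algebra.commutes, mul_assoc, hS, mul_one]

open scoped Matrix.Norms.Operator in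
/-- The symmetry data of `SO(m, ℂ) × SO(m, ℂ)` with its real form `{(g, conj g)}`. -/
def symmetryDataC (m : ℕ) : SymmetryData (Matrix (Fin m ⊕ Fin m) (Fin m ⊕ Fin m) ℂ) where
  σ := (conjAlgHom (swapMatrix m) (swapMatrix_mul_self m)).comp
    (Complex.conjAe : ℂ →ₐ[ℝ] ℂ).mapMatrix
  δ := conjAlgHom (signMatrix m m ℂ) (signMatrix_mul_self m m ℂ)
  τ := (transposeLinearEquiv _ _ ℝ ℂ).toLinearMap
  -- The pair `(a, b)` is realized as `diag(a, b)`, fixed by the grading, and the base symmetry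
  -- exchanges the two summands. So the symmetries are block antidiagonal, of odd degree.
  c := -1
  continuous_σ := (continuous_const.matrix_mul
    (continuous_id.matrix_map Complex.continuous_conj)).matrix_mul continuous_const
  continuous_δ := (continuous_const.matrix_mul continuous_id).matrix_mul continuous_const
  continuous_τ := continuous_id.matrix_transpose
  σ_σ X := by
    change swapMatrix m * (swapMatrix m * X.map (starRingEnd ℂ) * swapMatrix m).map (starRingEnd ℂ) *
      swapMatrix m = X
    rw [← fromBlocks_toBlocks X, fromBlocks_map, swapMatrix_conj, fromBlocks_map, swapMatrix_conj]
    simp [Matrix.map_map, Function.comp_def]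
  τ_σ X := by
    change (swapMatrix m * X.map (starRingEnd ℂ) * swapMatrix m)ᵀ =
      swapMatrix m * Xᵀ.map (starRingEnd ℂ) * swapMatrix m
    rw [← fromBlocks_toBlocks X, fromBlocks_map, swapMatrix_conj, fromBlocks_transpose,
      fromBlocks_transpose, fromBlocks_map, swapMatrix_conj]
    rfl
  δ_σ X := by
    change signMatrix m m ℂ * (swapMatrix m * X.map (starRingEnd ℂ) * swapMatrix m) *
      signMatrix m m ℂ = swapMatrix m *
        (signMatrix m m ℂ * X * signMatrix m m ℂ).map (starRingEnd ℂ) * swapMatrix m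
    rw [← fromBlocks_toBlocks X, fromBlocks_map, swapMatrix_conj, signMatrix_conj, signMatrix_conj,
      fromBlocks_map, swapMatrix_conj, Matrix.map_neg _ (map_neg _), Matrix.map_neg _ (map_neg _)]
  τ_one := transpose_one
  τ_mul X Y := transpose_mul X Y
  c_mul_c := by norm_num

open scoped Matrix.Norms.Operator in
theorem symmetryDataC_σ (X : Matrix (Fin m ⊕ Fin m) (Fin m ⊕ Fin m) ℂ) :
    (symmetryDataC m).σ X = swapMatrix m * X.map (starRingEnd ℂ) * swapMatrix m := rfl

open scoped Matrix.Norms.Operator in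
theorem symmetryDataC_τ (X : Matrix (Fin m ⊕ Fin m) (Fin m ⊕ Fin m) ℂ) :
    (symmetryDataC m).τ X = Xᵀ := rfl

open scoped Matrix.Norms.Operator in
theorem symmetryDataC_δ (X : Matrix (Fin m ⊕ Fin m) (Fin m ⊕ Fin m) ℂ) :
    (symmetryDataC m).δ X = signMatrix m m ℂ * X * signMatrix m m ℂ := rfl

open scoped Matrix.Norms.Operator in
theorem symmetryDataC_c : (symmetryDataC m).c = -1 := rfl

theorem continuous_SOCconj : Continuous (SOCconj m) := by
  refine Continuous.subtype_mk ?_ _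
  have hc : Continuous fun X : Matrix (Fin m) (Fin m) ℂ => X.map (starRingEnd ℂ) :=
    continuous_id.matrix_map Complex.continuous_conj
  exact Units.continuous_iff.2 ⟨hc.comp (Units.continuous_val.comp continuous_subtype_val),
    hc.comp (Units.continuous_coe_inv.comp continuous_subtype_val)⟩

theorem continuous_SOCToComplex : Continuous (SOCToComplex m) :=
  continuous_id.prodMk continuous_SOCconj

theorem mem_KCdiag (k : SOC m × SOC m) : k ∈ KCdiag m ↔ k.1 = k.2 := by
  constructor
  · rintro ⟨g, rfl⟩
    rfl
  · intro h
    exact ⟨k.1, Prod.ext rfl h⟩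

theorem SOC_ext {g h : SOC m} (e : g.val.val = h.val.val) : g = h := Subtype.ext (Units.ext e)

open scoped Matrix.Norms.Operator in
/-- The realization of `(SO(m, ℂ) × SO(m, ℂ)) / Δ` by symmetries. -/
def realizationC (m : ℕ) : LinearRealization (symmetryDataC m) (SOCToComplex m) (KCdiag m) where
  ρ :=
    { toFun := fun g => fromBlocks g.1.val.val 0 0 g.2.val.val
      map_one' := fromBlocks_one
      map_mul' := fun g h => by rw [fromBlocks_multiply]; simp }
  θ := swapMatrix m
  continuous_ρ := Continuous.matrix_fromBlocks
    (Units.continuous_val.comp (continuous_subtype_val.comp continuous_fst)) continuous_const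
    continuous_const (Units.continuous_val.comp (continuous_subtype_val.comp continuous_snd))
  continuous_φ := continuous_SOCToComplex
  θ_mul_θ := swapMatrix_mul_self m
  τ_θ := by
    rw [symmetryDataC_τ, swapMatrix, fromBlocks_transpose]
    simp
  σ_θ := by
    rw [symmetryDataC_σ, map_conj_swapMatrix, swapMatrix_mul_self, one_mul]
  δ_θ := by
    rw [symmetryDataC_δ, symmetryDataC_c, swapMatrix, signMatrix_conj, neg_smul, one_smul,
      fromBlocks_neg, neg_zero]
  τ_ρ g := by
    rw [symmetryDataC_τ]
    change (fromBlocks g.1.val.val 0 0 g.2.val.val)ᵀ = fromBlocks g.1⁻¹.val.val 0 0 g.2⁻¹.val.val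
    rw [SOC_inv_eq, SOC_inv_eq, fromBlocks_transpose, transpose_zero]
  δ_ρ g := by
    rw [symmetryDataC_δ]
    change signMatrix m m ℂ * fromBlocks g.1.val.val 0 0 g.2.val.val * signMatrix m m ℂ = _
    rw [signMatrix_conj, neg_zero]
    rfl
  σ_φ g := by
    rw [symmetryDataC_σ]
    change swapMatrix m * (fromBlocks g.val.val 0 0 (g.val.val.map (starRingEnd ℂ))).map
      (starRingEnd ℂ) * swapMatrix m = fromBlocks g.val.val 0 0 (g.val.val.map (starRingEnd ℂ))
    rw [fromBlocks_map, swapMatrix_conj]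
    simp [Matrix.map_map, Function.comp_def]
  ρ_comm k hk := by
    change fromBlocks k.1.val.val 0 0 k.2.val.val * swapMatrix m =
      swapMatrix m * fromBlocks k.1.val.val 0 0 k.2.val.val
    rw [(mem_KCdiag k).1 hk, swapMatrix, fromBlocks_multiply, fromBlocks_multiply]
    simp
  eventually_mem := Eventually.of_forall fun k hk => by
    change fromBlocks k.1.val.val 0 0 k.2.val.val * swapMatrix m =
      swapMatrix m * fromBlocks k.1.val.val 0 0 k.2.val.val at hk
    rw [swapMatrix, fromBlocks_multiply, fromBlocks_multiply, fromBlocks_inj] at hk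
    exact (mem_KCdiag k).2 (SOC_ext (by simpa using hk.2.1))
  exists_exp U hU := by
    let E : {X : Matrix (Fin m) (Fin m) ℂ // Xᵀ = -X} → SOC m :=
      fun X => ⟨expGL X.1, expGL_mem_SOC X.2⟩
    have hE : Continuous E := (continuous_expGL.comp continuous_subtype_val).subtype_mk _
    have h0 : (0 : Matrix (Fin m) (Fin m) ℂ)ᵀ = -0 := by simp
    have hE0 : E ⟨0, h0⟩ = 1 := Subtype.ext expGL_zero
    have h1 : E ⁻¹' U ∈ 𝓝 (⟨0, h0⟩ : {X : Matrix (Fin m) (Fin m) ℂ // Xᵀ = -X}) :=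
      hE.continuousAt.preimage_mem_nhds (by rwa [hE0])
    rw [nhds_subtype_eq_comap, mem_comap] at h1
    obtain ⟨W, hW, hWU⟩ := h1
    have hb : Continuous fun X : Matrix (Fin m ⊕ Fin m) (Fin m ⊕ Fin m) ℂ => X.toBlocks₁₁ :=
      continuous_id.matrix_submatrix _ _
    refine ⟨(fun X => X.toBlocks₁₁) ⁻¹' W, hb.continuousAt.preimage_mem_nhds hW, ?_⟩
    rintro Y hY ⟨hσ, hτ, hδ⟩
    rw [symmetryDataC_σ] at hσ
    rw [symmetryDataC_τ] at hτ
    rw [symmetryDataC_δ] at hδ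
    obtain ⟨A, B, C, D, rfl⟩ : ∃ A B C D, Y = fromBlocks A B C D :=
      ⟨_, _, _, _, (fromBlocks_toBlocks _).symm⟩
    rw [signMatrix_conj, fromBlocks_inj] at hδ
    obtain ⟨-, hB, hC, -⟩ := hδ
    obtain rfl := Matrix.eq_zero_of_eq_neg hB.symm
    obtain rfl := Matrix.eq_zero_of_eq_neg hC.symm
    rw [fromBlocks_map, swapMatrix_conj, fromBlocks_inj] at hσ
    obtain ⟨-, -, -, rfl⟩ := hσ
    rw [fromBlocks_transpose, fromBlocks_neg, fromBlocks_inj] at hτ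
    refine ⟨E ⟨A, hτ.1⟩, hWU hY, ?_⟩
    refine Eq.trans ?_ (Matrix.exp_fromBlocks_diagonal _ _).symm
    rw [← Matrix.map_exp_conj]
    rfl

end RealizationC

/-! ### The distinguished boundary for `SO(m,ℂ)`: orbits, stabilizers, and distinctness of the two
orbits. -/

section BoundaryC

attribute [-instance] LieRing.ofAssociativeRing

variable {m : ℕ}

/-- The generator `N` with `i a(π/4, …, π/4) = π/4 N`. -/
def quarterC (m : ℕ) : Matrix (Fin m) (Fin m) ℂ :=
  (pairMatrix m)ᵀ * J (Fin (m / 2)) ℂ * pairMatrix m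

theorem pairMatrix_mul_transpose_mul {l : Type*} [Fintype l]
    (X : Matrix (Fin (m / 2) ⊕ Fin (m / 2)) l ℂ) : pairMatrix m * ((pairMatrix m)ᵀ * X) = X := by
  rw [← Matrix.mul_assoc, pairMatrix_mul_transpose, Matrix.one_mul]

theorem quarterC_mul_self : quarterC m * quarterC m = -((pairMatrix m)ᵀ * pairMatrix m) := by
  simp only [quarterC, Matrix.mul_assoc, pairMatrix_mul_transpose_mul]
  rw [← Matrix.mul_assoc (J (Fin (m / 2)) ℂ), J_squared, Matrix.neg_mul, Matrix.one_mul,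
    Matrix.mul_neg]

theorem quarterC_cube : quarterC m * quarterC m * quarterC m = -quarterC m := by
  rw [quarterC_mul_self, quarterC]
  simp only [Matrix.mul_assoc, Matrix.neg_mul, pairMatrix_mul_transpose_mul]

theorem map_conj_J (l : Type*) [DecidableEq l] : (J l ℂ).map (starRingEnd ℂ) = J l ℂ := by
  rw [J, fromBlocks_map, Matrix.map_neg _ (map_neg _), Matrix.map_one _ (map_zero _) (map_one _),
    Matrix.map_zero _ (map_zero _)]

theorem map_conj_quarterC : (quarterC m).map (starRingEnd ℂ) = quarterC m := by
  rw [quarterC, Matrix.map_mul, Matrix.map_mul, transpose_map, map_pairMatrix, map_conj_J]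

theorem transpose_quarterC : (quarterC m)ᵀ = -quarterC m := by
  rw [quarterC, transpose_mul, transpose_mul, transpose_transpose, J_transpose, Matrix.neg_mul,
    Matrix.mul_neg, Matrix.mul_assoc]

/-- The conjugates of `quarterC m` by diagonal matrices of signs. -/
def signedQuarterC (d : Fin m → ℤˣ) : Matrix (Fin m) (Fin m) ℂ :=
  diagonalSign ℂ d * quarterC m * diagonalSign ℂ d

theorem signedQuarterC_one : signedQuarterC (1 : Fin m → ℤˣ) = quarterC m := by
  rw [signedQuarterC, map_one, one_mul, mul_one]

theorem signedQuarterC_mul (e d : Fin m → ℤˣ) : signedQuarterC (e * d) =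
    diagonalSign ℂ e * signedQuarterC d * diagonalSign ℂ e := by
  have hc : diagonalSign ℂ e * diagonalSign ℂ d = diagonalSign ℂ d * diagonalSign ℂ e := by
    rw [← map_mul, mul_comm, map_mul]
  rw [signedQuarterC, map_mul]
  nth_rewrite 2 [hc]
  simp only [signedQuarterC, mul_assoc]

theorem signedQuarterC_cube (d : Fin m → ℤˣ) :
    signedQuarterC d * signedQuarterC d * signedQuarterC d = -signedQuarterC d := by
  have hs := diagonalSign_mul_self (𝕜 := ℂ) d
  calc _ = diagonalSign ℂ d * quarterC m * (diagonalSign ℂ d * diagonalSign ℂ d) * quarterC m *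
        (diagonalSign ℂ d * diagonalSign ℂ d) * quarterC m * diagonalSign ℂ d := by
        simp only [signedQuarterC, mul_assoc]
    _ = diagonalSign ℂ d * (quarterC m * quarterC m * quarterC m) * diagonalSign ℂ d := by
        rw [hs]; simp only [mul_assoc, one_mul]
    _ = _ := by rw [quarterC_cube, mul_neg, neg_mul, signedQuarterC]

theorem map_conj_signedQuarterC (d : Fin m → ℤˣ) :
    (signedQuarterC d).map (starRingEnd ℂ) = signedQuarterC d := by
  rw [signedQuarterC, Matrix.map_mul, Matrix.map_mul, map_conj_quarterC, map_diagonalSign]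

theorem transpose_signedQuarterC (d : Fin m → ℤˣ) : (signedQuarterC d)ᵀ = -signedQuarterC d := by
  rw [signedQuarterC, transpose_mul, transpose_mul, transpose_quarterC, transpose_diagonalSign,
    neg_mul, mul_neg, mul_assoc]

theorem signedQuarterC_eq (d : Fin m → ℤˣ) : signedQuarterC d = (pairMatrix m)ᵀ *
    (diagonalSign ℂ (d ∘ pairIndex m) * J (Fin (m / 2)) ℂ * diagonalSign ℂ (d ∘ pairIndex m)) *
      pairMatrix m := by
  have h1 := pairMatrix_mul_diagonalSign d
  have h2 := congrArg transpose h1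
  rw [transpose_mul, transpose_mul, transpose_diagonalSign, transpose_diagonalSign] at h2
  calc _ = (diagonalSign ℂ d * (pairMatrix m)ᵀ) * J (Fin (m / 2)) ℂ *
        (pairMatrix m * diagonalSign ℂ d) := by
        simp only [signedQuarterC, quarterC, Matrix.mul_assoc]
    _ = _ := by rw [h1, h2]; simp only [Matrix.mul_assoc]

/-- The vertices of the cube. -/
def vertexC (d : Fin m → ℤˣ) (j : Fin (m / 2)) : ℝ :=
  ((d (pairIndex m (.inl j)) * d (pairIndex m (.inr j)) : ℤˣ) : ℤ) * (Real.pi / 4)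

theorem I_smul_aC_vertex (d : Fin m → ℤˣ) :
    Complex.I • aC m (vertexC d) = (Real.pi / 4) • signedQuarterC d := by
  rw [aC_eq, signedQuarterC_eq]
  have h : ∀ {S : Type} [Monoid S] [DistribMulAction S ℂ] [IsScalarTower S ℂ ℂ] [SMulCommClass S ℂ ℂ]
      (c : S) (M : Matrix (Fin (m / 2) ⊕ Fin (m / 2)) (Fin (m / 2) ⊕ Fin (m / 2)) ℂ),
      c • ((pairMatrix m)ᵀ * M * pairMatrix m) = (pairMatrix m)ᵀ * (c • M) * pairMatrix m :=
    fun c M => by rw [Matrix.mul_smul, Matrix.smul_mul]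
  rw [h, h]
  congr 2
  ext (i | i) (j | j)
  · simp [J, diagonalSign_apply]
  · rcases eq_or_ne i j with rfl | hij
    · simp [J, diagonalSign_apply, vertexC, ← mul_assoc]; ring
    · simp [J, diagonalSign_apply, vertexC, hij]
  · rcases eq_or_ne i j with rfl | hij
    · simp [J, diagonalSign_apply, vertexC, ← mul_assoc]; ring
    · simp [J, diagonalSign_apply, vertexC, hij]
  · simp [J, diagonalSign_apply]

theorem mem_extremePoints_OmegaC (t : Fin (m / 2) → ℝ) :
    t ∈ (closure (OmegaC m)).extremePoints ℝ ↔ ∃ d : Fin m → ℤˣ, t = vertexC d := by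
  rw [OmegaC_eq, extremePoints_closure_cube]
  constructor
  · rintro ⟨ε, rfl⟩
    -- A vertex coordinate is the product of the two signs of its pair. The sign is put on the first
    -- member; all other signs are `1`.
    refine ⟨Function.extend (pairIndex m) (Sum.elim ε 1) 1, funext fun j => ?_⟩
    rw [vertexC, (pairIndex_injective m).extend_apply, (pairIndex_injective m).extend_apply]
    simp
  · rintro ⟨d, rfl⟩
    exact ⟨fun j => d (pairIndex m (.inl j)) * d (pairIndex m (.inr j)), rfl⟩

theorem transpose_smul_signedQuarterC (d : Fin m → ℤˣ) :
    ((Real.pi / 4) • signedQuarterC d)ᵀ = -((Real.pi / 4) • signedQuarterC d) := by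
  rw [transpose_smul, transpose_signedQuarterC, smul_neg]

/-- The elements `exp(π/4 N)` for the conjugates `N` of `quarterC m`. -/
def quarterTurn (d : Fin m → ℤˣ) : SOC m :=
  ⟨expGL ((Real.pi / 4) • signedQuarterC d), expGL_mem_SOC (transpose_smul_signedQuarterC d)⟩

theorem coe_quarterTurn (d : Fin m → ℤˣ) : (quarterTurn d).val.val =
    NormedSpace.exp ((Real.pi / 4) • signedQuarterC d) := rfl

theorem coe_quarterTurn_inv (d : Fin m → ℤˣ) : (quarterTurn d)⁻¹.val.val =
    NormedSpace.exp (-((Real.pi / 4) • signedQuarterC d)) := rfl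

theorem SOCconj_quarterTurn (d : Fin m → ℤˣ) : SOCconj m (quarterTurn d) = quarterTurn d := by
  refine SOC_ext ?_
  change (NormedSpace.exp ((Real.pi / 4) • signedQuarterC d)).map (starRingEnd ℂ) = _
  have h : ((Real.pi / 4) • signedQuarterC d).map (starRingEnd ℂ) =
      (Real.pi / 4) • signedQuarterC d := by
    conv_rhs => rw [← map_conj_signedQuarterC]
    ext i j
    simp only [Matrix.smul_apply, map_apply, Complex.real_smul, map_mul, Complex.conj_ofReal]
  rw [Matrix.map_exp_conj, h, coe_quarterTurn]

/-- Diagonal matrices of signs as elements of the general linear group. -/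
def diagonalSignGL (d : Fin m → ℤˣ) : GL (Fin m) ℂ :=
  ⟨diagonalSign ℂ d, diagonalSign ℂ d, diagonalSign_mul_self d, diagonalSign_mul_self d⟩

theorem diagonalSignGL_inv (d : Fin m → ℤˣ) : (diagonalSignGL d)⁻¹ = diagonalSignGL d :=
  rfl

theorem diagonalSign_conj_mem_SOC (d : Fin m → ℤˣ) {g : GL (Fin m) ℂ} (hg : g ∈ SOC m) :
    diagonalSignGL d * g * (diagonalSignGL d)⁻¹ ∈ SOC m := by
  obtain ⟨h1, h2⟩ := hg
  refine ⟨?_, ?_⟩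
  · rw [diagonalSignGL_inv, Units.val_mul, Units.val_mul]
    change (diagonalSign ℂ d * g.val * diagonalSign ℂ d)ᵀ *
      (diagonalSign ℂ d * g.val * diagonalSign ℂ d) = _
    rw [transpose_mul, transpose_mul, transpose_diagonalSign]
    calc _ = diagonalSign ℂ d * (g.valᵀ * (diagonalSign ℂ d * diagonalSign ℂ d) * g.val) *
          diagonalSign ℂ d := by simp only [mul_assoc]
      _ = _ := by rw [diagonalSign_mul_self, mul_one, h1, mul_one, diagonalSign_mul_self]
  · rw [Units.val_mul, Units.val_mul, det_mul, det_mul, h2, mul_one, ← det_mul, Units.mul_inv,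
      det_one]

/-- Conjugation of `SO(m, ℂ)` by a diagonal matrix of signs. -/
def conjDiagonalSign (d : Fin m → ℤˣ) : SOC m ≃ₜ* SOC m :=
  conjOfNormalizes (SOC m) (diagonalSignGL d) (fun _ hg => diagonalSign_conj_mem_SOC d hg)
    fun g hg => by
      have := diagonalSign_conj_mem_SOC d hg
      rwa [diagonalSignGL_inv] at this ⊢

theorem coe_conjDiagonalSign (d : Fin m → ℤˣ) (g : SOC m) : (conjDiagonalSign d g).val.val =
    diagonalSign ℂ d * g.val.val * diagonalSign ℂ d := rfl

theorem conjDiagonalSign_quarterTurn (e d : Fin m → ℤˣ) :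
    conjDiagonalSign e (quarterTurn d) = quarterTurn (e * d) := by
  refine SOC_ext ?_
  rw [coe_conjDiagonalSign, coe_quarterTurn, coe_quarterTurn,
    Matrix.exp_semiconj (Y := (Real.pi / 4) • signedQuarterC (e * d)), mul_assoc,
    diagonalSign_mul_self, mul_one]
  rw [signedQuarterC_mul, mul_smul_comm, smul_mul_assoc, mul_assoc (_ * _), diagonalSign_mul_self,
    mul_one]

theorem SOCconj_conjDiagonalSign (d : Fin m → ℤˣ) (g : SOC m) :
    SOCconj m (conjDiagonalSign d g) = conjDiagonalSign d (SOCconj m g) := by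
  refine SOC_ext ?_
  change (diagonalSign ℂ d * g.val.val * diagonalSign ℂ d).map (starRingEnd ℂ) =
    diagonalSign ℂ d * g.val.val.map (starRingEnd ℂ) * diagonalSign ℂ d
  rw [Matrix.map_mul, Matrix.map_mul, map_diagonalSign]

/-- The points `exp(i Y)`, for `Y` a vertex of the cube. -/
def boundaryPointC (d : Fin m → ℤˣ) : SOC m × SOC m := (quarterTurn d, (quarterTurn d)⁻¹)

open scoped Matrix.Norms.Operator in
theorem isQuarterTurn_boundaryPointC (d : Fin m → ℤˣ) :
    (realizationC m).IsQuarterTurn (boundaryPointC d)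
      (fromBlocks (signedQuarterC d) 0 0 (-signedQuarterC d)) := by
  refine ⟨?_, ?_, ?_, ?_⟩
  · change fromBlocks (quarterTurn d).val.val 0 0 (quarterTurn d)⁻¹.val.val = _
    rw [fromBlocks_smul, smul_zero]
    refine Eq.trans ?_ (Matrix.exp_fromBlocks_diagonal _ _).symm
    rw [coe_quarterTurn, coe_quarterTurn_inv, smul_neg]
  · rw [fromBlocks_multiply, fromBlocks_multiply, fromBlocks_neg]
    simp [signedQuarterC_cube]
  · rw [symmetryDataC_σ, fromBlocks_map, swapMatrix_conj, fromBlocks_neg,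
      Matrix.map_neg _ (map_neg _), map_conj_signedQuarterC, Matrix.map_zero _ (map_zero _)]
    simp
  · change swapMatrix m * _ = -(_ * swapMatrix m)
    rw [swapMatrix, fromBlocks_multiply, fromBlocks_multiply, fromBlocks_neg]
    simp

theorem mem_boundaryC (y : (SOC m × SOC m) ⧸ KCdiag m) : y ∈ boundaryC m ↔
    ∃ (d : Fin m → ℤˣ) (g : SOC m),
      SOCToComplex m g • (boundaryPointC d : (SOC m × SOC m) ⧸ KCdiag m) = y := by
  have h2 : ∀ d : Fin m → ℤˣ, Complex.I • (aC m (vertexC d)).map (starRingEnd ℂ) =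
      -((Real.pi / 4) • signedQuarterC d) := fun d => by
    rw [map_conj_aC, smul_neg, I_smul_aC_vertex]
  constructor
  · rintro ⟨g, z, ⟨t, ht, hz1, hz2⟩, rfl⟩
    obtain ⟨d, rfl⟩ := (mem_extremePoints_OmegaC t).1 ht
    rw [I_smul_aC_vertex] at hz1
    rw [h2] at hz2
    obtain rfl : z = boundaryPointC d := Prod.ext (SOC_ext hz1) (SOC_ext hz2)
    exact ⟨d, g, rfl⟩
  · rintro ⟨d, g, rfl⟩
    refine ⟨g, boundaryPointC d, ⟨_, (mem_extremePoints_OmegaC _).2 ⟨d, rfl⟩, ?_, ?_⟩, rfl⟩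
    · rw [I_smul_aC_vertex]; rfl
    · rw [h2]; rfl

theorem locallyTransitiveAt_boundaryC (d : Fin m → ℤˣ) :
    LocallyTransitiveAt (SOCToComplex m) (boundaryC m)
      (boundaryPointC d : (SOC m × SOC m) ⧸ KCdiag m) := by
  open scoped Matrix.Norms.Operator in
  refine (realizationC m).locallyTransitiveAt ?_ _ ((mem_boundaryC _).2 ⟨d, 1, ?_⟩)
  · intro z hz
    obtain ⟨e, g, hg⟩ := (mem_boundaryC _).1 hz
    rw [← (realizationC m).symm_eq_of_mk_eq (g := SOCToComplex m g * boundaryPointC e) hg]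
    exact (realizationC m).isSymmetry_of_isQuarterTurn (isQuarterTurn_boundaryPointC e) g
  · rw [map_one, one_smul]

/-- The map `(a, b) ↦ a b⁻¹` identifies the quotient by the diagonal with `SO(m,ℂ)`. -/
theorem mk_eq_mk_KCdiag (a b c d : SOC m) :
    (((a, b) : SOC m × SOC m) : (SOC m × SOC m) ⧸ KCdiag m) = ((c, d) : SOC m × SOC m) ↔
      a * b⁻¹ = c * d⁻¹ := by
  rw [QuotientGroup.eq, mem_KCdiag]
  change a⁻¹ * c = b⁻¹ * d ↔ _
  rw [inv_mul_eq_iff_eq_mul, eq_mul_inv_iff_mul_eq, mul_assoc, eq_comm]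

theorem smul_boundaryPointC {e : Fin m → ℤˣ} (he : ∏ i, e i = 1) (d : Fin m → ℤˣ) :
    ∃ g : SOC m, SOCToComplex m g • (boundaryPointC d : (SOC m × SOC m) ⧸ KCdiag m) =
      boundaryPointC (e * d) := by
  have hmem : diagonalSignGL e ∈ SOC m := by
    refine ⟨?_, ?_⟩
    · change (diagonalSign ℂ e)ᵀ * diagonalSign ℂ e = 1
      rw [transpose_diagonalSign, diagonalSign_mul_self]
    · change (diagonalSign ℂ e).det = 1
      rw [det_diagonalSign, he]; simp
  let s : SOC m := ⟨diagonalSignGL e, hmem⟩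
  have hs : SOCconj m s = s := SOC_ext (map_diagonalSign (starRingEnd ℂ) e)
  refine ⟨s, (mk_eq_mk_KCdiag _ _ _ _).2 ?_⟩
  have hd : quarterTurn (e * d) = s * quarterTurn d * s⁻¹ := by
    rw [← conjDiagonalSign_quarterTurn]; rfl
  change s * quarterTurn d * (SOCconj m s * (quarterTurn d)⁻¹)⁻¹ = _
  rw [hs, hd]
  group

theorem mem_stabilizerOf_boundaryPointC (d : Fin m → ℤˣ) (g : SOC m) :
    g ∈ stabilizerOf (SOCToComplex m) (boundaryPointC d : (SOC m × SOC m) ⧸ KCdiag m) ↔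
      (quarterTurn d)⁻¹ * g * quarterTurn d = quarterTurn d * SOCconj m g * (quarterTurn d)⁻¹ := by
  rw [mem_stabilizerOf_mk, mem_KCdiag]
  change (quarterTurn d)⁻¹ * g * quarterTurn d =
    (quarterTurn d)⁻¹⁻¹ * SOCconj m g * (quarterTurn d)⁻¹ ↔ _
  rw [inv_inv]

theorem mem_stabilizerOf_boundaryPointC_iff (d : Fin m → ℤˣ) (g : SOC m) :
    g ∈ stabilizerOf (SOCToComplex m) (boundaryPointC (1 : Fin m → ℤˣ) : (SOC m × SOC m) ⧸ KCdiag m) ↔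
      conjDiagonalSign d g ∈
        stabilizerOf (SOCToComplex m) (boundaryPointC d : (SOC m × SOC m) ⧸ KCdiag m) := by
  have hd : quarterTurn d = conjDiagonalSign d (quarterTurn 1) := by
    rw [conjDiagonalSign_quarterTurn, mul_one]
  rw [mem_stabilizerOf_boundaryPointC, mem_stabilizerOf_boundaryPointC,
      SOCconj_conjDiagonalSign, hd]
  simp only [← map_mul, ← map_inv]
  exact (conjDiagonalSign d).injective.eq_iff.symm

/-- Replacing `N` by `-N` replaces the quarter turn `k` by `k⁻¹`. As `k` is real, complex
conjugation exchanges the stabilizer equation `k⁻¹ g k = k conj(g) k⁻¹` with the one for `k⁻¹`. -/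
theorem stabilizerOf_boundaryPointC_eq {d : Fin m → ℤˣ} (hd : signedQuarterC d = -quarterC m) :
    stabilizerOf (SOCToComplex m) (boundaryPointC d : (SOC m × SOC m) ⧸ KCdiag m) =
      stabilizerOf (SOCToComplex m) (boundaryPointC (1 : Fin m → ℤˣ) : (SOC m × SOC m) ⧸ KCdiag m) := by
  have h : quarterTurn d = (quarterTurn 1)⁻¹ := by
    refine SOC_ext ?_
    rw [coe_quarterTurn, coe_quarterTurn_inv, hd, signedQuarterC_one, smul_neg]
  have hinv : ∀ g : SOC m, SOCconj m (SOCconj m g) = g := fun g => SOC_ext (by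
    change (g.val.val.map (starRingEnd ℂ)).map (starRingEnd ℂ) = g.val.val
    simp [Matrix.map_map, Function.comp_def])
  have hinj : Function.Injective (SOCconj m) := Function.LeftInverse.injective hinv
  ext g
  rw [mem_stabilizerOf_boundaryPointC, mem_stabilizerOf_boundaryPointC, h, inv_inv,
    ← hinj.eq_iff]
  simp only [map_mul, map_inv, SOCconj_quarterTurn, hinv]
  exact eq_comm

theorem exists_notMem_range_pairIndex {n : ℕ} :
    ∃ k : Fin (2 * n + 1), k ∉ Set.range (pairIndex (2 * n + 1)) :=
  ⟨Fin.last _, by rw [mem_range_pairIndex_iff, Fin.val_last]; omega⟩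

theorem boundaryPointC_congr {d d' : Fin m → ℤˣ}
    (h : ∀ a, d (pairIndex m a) = d' (pairIndex m a)) : boundaryPointC d = boundaryPointC d' := by
  have h1 : signedQuarterC d = signedQuarterC d' := by
    rw [signedQuarterC_eq, signedQuarterC_eq, show d ∘ pairIndex m = d' ∘ pairIndex m from funext h]
  have h2 : quarterTurn d = quarterTurn d' := by
    refine SOC_ext ?_
    rw [coe_quarterTurn, coe_quarterTurn, h1]
  rw [boundaryPointC, boundaryPointC, h2]

/-- An index outside all pairs does not affect the boundary point, so its sign can be used to make
the product of the signs `1`. -/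
theorem boundaryC_eq_orbit {k : Fin m} (hk : k ∉ Set.range (pairIndex m))
    (y : (SOC m × SOC m) ⧸ KCdiag m) : y ∈ boundaryC m ↔ ∃ g : SOC m,
      SOCToComplex m g • (boundaryPointC (1 : Fin m → ℤˣ) : (SOC m × SOC m) ⧸ KCdiag m) = y := by
  rw [mem_boundaryC]
  refine ⟨?_, fun ⟨g, hg⟩ => ⟨1, g, hg⟩⟩
  rintro ⟨d, g, rfl⟩
  let e : Fin m → ℤˣ := d * Pi.mulSingle k (∏ i, d i)
  have he : ∏ i, e i = 1 := by
    simp only [e, Pi.mul_apply]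
    rw [Finset.prod_mul_distrib, Fintype.prod_pi_mulSingle', Int.units_mul_self]
  obtain ⟨g', hg'⟩ := smul_boundaryPointC he 1
  refine ⟨g * g', ?_⟩
  rw [map_mul, mul_smul, hg', mul_one, boundaryPointC_congr (d := e) (d' := d) fun a => by
    have : pairIndex m a ≠ k := fun h => hk ⟨a, h⟩
    simp [e, this]]

theorem boundaryC_eq_orbits {r : Fin m → ℤˣ} (hr : ∏ i, r i = -1)
    (y : (SOC m × SOC m) ⧸ KCdiag m) : y ∈ boundaryC m ↔ (∃ g : SOC m,
      SOCToComplex m g • (boundaryPointC (1 : Fin m → ℤˣ) : (SOC m × SOC m) ⧸ KCdiag m) = y) ∨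
      ∃ g : SOC m, SOCToComplex m g • (boundaryPointC r : (SOC m × SOC m) ⧸ KCdiag m) = y := by
  rw [mem_boundaryC]
  constructor
  · rintro ⟨d, g, rfl⟩
    rcases Int.units_eq_one_or (∏ i, d i) with hd | hd
    · obtain ⟨g', hg'⟩ := smul_boundaryPointC hd 1
      exact .inl ⟨g * g', by rw [map_mul, mul_smul, hg', mul_one]⟩
    · have hdr : ∏ i, (d * r) i = 1 := by
        simp only [Pi.mul_apply]
        rw [Finset.prod_mul_distrib, hd, hr, Int.units_mul_self]
      obtain ⟨g', hg'⟩ := smul_boundaryPointC hdr r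
      refine .inr ⟨g * g', ?_⟩
      rw [map_mul, mul_smul, hg', mul_assoc,
        show r * r = 1 from funext fun i => Int.units_mul_self (r i), mul_one]
  · rintro (⟨g, hg⟩ | ⟨g, hg⟩)
    · exact ⟨1, g, hg⟩
    · exact ⟨r, g, hg⟩

/-- Under `(a, b) ↦ a b⁻¹` the two base points become `N = quarterC m`, with `N² = -1`, and `S N S`.
An element `g` carrying the first to the second gives `g N = S N S conj(g)`, so `S g` commutes with
the quaternionic structure `v ↦ N conj(v)` although its determinant is `-1`. -/
theorem smul_boundaryPointC_ne (hV : (pairMatrix m)ᵀ * pairMatrix m = 1) {r : Fin m → ℤˣ}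
    (hr : ∏ i, r i = -1) (g : SOC m) :
    SOCToComplex m g • (boundaryPointC (1 : Fin m → ℤˣ) : (SOC m × SOC m) ⧸ KCdiag m) ≠
        boundaryPointC r := by
  intro hg
  have hN : quarterC m * quarterC m = -1 := by rw [quarterC_mul_self, hV]
  have hsq : (quarterTurn (1 : Fin m → ℤˣ) * quarterTurn 1).val.val = quarterC m := by
    change NormedSpace.exp _ * NormedSpace.exp _ = _
    rw [signedQuarterC_one, ← Matrix.exp_add_smul,
        show Real.pi / 4 + Real.pi / 4 = Real.pi / 2 by ring,
      Matrix.exp_smul_of_cube_eq_neg quarterC_cube, hN]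
    simp
  have e : g * quarterTurn 1 * (SOCconj m g * (quarterTurn 1)⁻¹)⁻¹ =
      quarterTurn r * (quarterTurn r)⁻¹⁻¹ := (mk_eq_mk_KCdiag _ _ _ _).1 hg
  have hr1 : quarterTurn r = conjDiagonalSign r (quarterTurn 1) := by
    rw [conjDiagonalSign_quarterTurn, mul_one]
  have e1 : g * (quarterTurn 1 * quarterTurn 1) =
      conjDiagonalSign r (quarterTurn 1 * quarterTurn 1) * SOCconj m g := by
    rw [map_mul, ← hr1]
    rw [inv_inv] at e
    rw [← e]
    group
  have e2 : g.val.val * quarterC m = diagonalSign ℂ r * quarterC m * diagonalSign ℂ r *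
      g.val.val.map (starRingEnd ℂ) := by
    have := congrArg (fun x : SOC m => x.val.val) e1
    rw [← hsq]
    exact this
  refine Matrix.det_ne_neg_one_of_quaternionic (M := diagonalSign ℂ r * g.val.val)
    (N := quarterC m) ?_ ?_ ?_
  · rw [map_conj_quarterC, hN]
  · rw [Matrix.map_mul, map_diagonalSign, mul_assoc, e2]
    simp only [← mul_assoc]
    rw [diagonalSign_mul_self, one_mul]
  · rw [det_mul, g.2.2, det_diagonalSign, hr]
    simp

end BoundaryC

/-! ### The Lie algebra of the stabilizer for `SO(m,ℂ)`. -/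

section LieAlgebraC

variable {m : ℕ}

theorem transpose_pairMatrix_mul_self : (pairMatrix m)ᵀ * pairMatrix m =
    diagonal fun i : Fin m => if i.val < 2 * (m / 2) then 1 else 0 := by
  have h := @pairMatrix_conj_apply_of_notMem m 1
  have h' := pairMatrix_conj_apply (m := m) 1
  rw [Matrix.mul_one] at h h'
  ext i k
  by_cases hi : i ∈ Set.range (pairIndex m)
  · have hi' := (mem_range_pairIndex_iff i).1 hi
    by_cases hk : k ∈ Set.range (pairIndex m)
    · obtain ⟨a, rfl⟩ := hi
      obtain ⟨b, rfl⟩ := hk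
      rw [h', one_apply, diagonal_apply, if_pos hi']
      simp only [(pairIndex_injective m).eq_iff]
    · rw [h (.inr hk), diagonal_apply_ne]
      rintro rfl
      exact hk hi
  · have hi' := (mem_range_pairIndex_iff i).not.1 hi
    rw [h (.inl hi), diagonal_apply, if_neg hi', ite_self]

theorem map_conj_map_conj {ι : Type*} (X : Matrix ι ι ℂ) :
    (X.map (starRingEnd ℂ)).map (starRingEnd ℂ) = X := by
  simp [Matrix.map_map, Function.comp_def]

theorem map_conj_eq_iff {ι : Type*} [Fintype ι] {X N : Matrix ι ι ℂ}
    (hN : N.map (starRingEnd ℂ) = N) : X * N = N * X.map (starRingEnd ℂ) ↔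
      X.map (starRingEnd ℂ) * N = N * X := by
  rw [← (Matrix.map_injective (starRingEnd ℂ).injective).eq_iff, Matrix.map_mul, Matrix.map_mul,
    map_conj_map_conj, hN]

/-- The symmetry has off-diagonal blocks `R + N` and `R - N`, with `R` the projection to the
unpaired coordinates. Conjugating the second block equation and forming the sum and the difference
with the first separates `R` from `N`. -/
theorem commute_symm_boundaryPointC_iff (X : Matrix (Fin m) (Fin m) ℂ) :
    open scoped Matrix.Norms.Operator in
    fromBlocks X 0 0 (X.map (starRingEnd ℂ)) * (realizationC m).symm (boundaryPointC 1) =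
      (realizationC m).symm (boundaryPointC 1) * fromBlocks X 0 0 (X.map (starRingEnd ℂ)) ↔
    X * quarterC m = quarterC m * X.map (starRingEnd ℂ) ∧
      X * (1 - (pairMatrix m)ᵀ * pairMatrix m) =
        (1 - (pairMatrix m)ᵀ * pairMatrix m) * X.map (starRingEnd ℂ) := by
  open scoped Matrix.Norms.Operator in
  rw [(realizationC m).symm_of_isQuarterTurn (isQuarterTurn_boundaryPointC 1)]
  change _ * (_ * swapMatrix m) = _ * swapMatrix m * _ ↔ _
  obtain ⟨R, hR⟩ : ∃ R, R = 1 - (pairMatrix m)ᵀ * pairMatrix m := ⟨_, rfl⟩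
  have hRc : R.map (starRingEnd ℂ) = R := by
    rw [hR, Matrix.map_sub _ (map_sub _), Matrix.map_mul, transpose_map, map_pairMatrix,
      Matrix.map_one _ (map_zero _) (map_one _)]
  have hJ : (1 + fromBlocks (signedQuarterC 1) 0 0 (-signedQuarterC 1) +
      fromBlocks (signedQuarterC 1) 0 0 (-signedQuarterC 1) *
        fromBlocks (signedQuarterC 1) 0 0 (-signedQuarterC 1)) * swapMatrix m =
      fromBlocks 0 (R + quarterC m) (R - quarterC m) 0 := by
    rw [signedQuarterC_one, fromBlocks_multiply, ← fromBlocks_one, fromBlocks_add, fromBlocks_add,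
      swapMatrix, fromBlocks_multiply, neg_mul_neg, quarterC_mul_self, hR]
    congr 1 <;> simp <;> abel
  rw [hJ, ← hR, fromBlocks_multiply, fromBlocks_multiply, fromBlocks_inj]
  simp only [Matrix.mul_zero, Matrix.zero_mul, add_zero, zero_add, sub_self, true_and,
    and_true, Matrix.mul_add, Matrix.add_mul, Matrix.mul_sub, Matrix.sub_mul]
  have hN := map_conj_eq_iff (X := X) (map_conj_quarterC (m := m))
  have hR' := map_conj_eq_iff (X := X) hRc
  constructor
  · rintro ⟨h1, h2⟩
    have h3 := congrArg (fun M => M.map (starRingEnd ℂ)) h2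
    simp only [Matrix.map_sub _ (map_sub _), Matrix.map_mul, map_conj_map_conj, hRc,
      map_conj_quarterC] at h3
    have two : ∀ {A B : Matrix (Fin m) (Fin m) ℂ}, A + A = B + B → A = B := fun {A B} e => by
      rw [← two_smul ℂ, ← two_smul ℂ B] at e
      exact smul_right_injective _ (two_ne_zero : (2 : ℂ) ≠ 0) e
    refine ⟨two ?_, two ?_⟩
    · calc _ = (X * R + X * quarterC m) - (X * R - X * quarterC m) := by abel
        _ = _ := by rw [h1, h3]; abel
    · calc _ = (X * R + X * quarterC m) + (X * R - X * quarterC m) := by abel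
        _ = _ := by rw [h1, h3]; abel
  · rintro ⟨h1, h2⟩
    exact ⟨by rw [h1, h2], by rw [hN.1 h1, hR'.1 h2]⟩

/-- The inclusion of `𝔰𝔬*(2n)` in `𝔰𝔬(m, ℂ)` for `n = ⌊m / 2⌋`. -/
def pairLieHom (m : ℕ) : soStarAlg (m / 2) →ₗ⁅ℝ⁆ Matrix (Fin m) (Fin m) ℂ where
  toFun Z := (pairMatrix m)ᵀ * Z.val * pairMatrix m
  map_add' Z Z' := by
    rw [← Matrix.add_mul, ← Matrix.mul_add]; rfl
  map_smul' c Z := by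
    rw [RingHom.id_apply, ← Matrix.smul_mul, ← Matrix.mul_smul]; rfl
  map_lie' {Z Z'} := by
    have e : ⁅Z, Z'⁆.val = Z.val * Z'.val - Z'.val * Z.val := rfl
    rw [e, Ring.lie_def]
    simp only [Matrix.mul_sub, Matrix.sub_mul, Matrix.mul_assoc, pairMatrix_mul_transpose_mul]

theorem pairLieHom_apply (Z : soStarAlg (m / 2)) :
    pairLieHom m Z = (pairMatrix m)ᵀ * Z.val * pairMatrix m := rfl

theorem pairLieHom_injective (m : ℕ) : Function.Injective (pairLieHom m) := by
  intro Z Z' h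
  have := congrArg (fun M => pairMatrix m * (M * (pairMatrix m)ᵀ)) h
  simp only [pairLieHom_apply, Matrix.mul_assoc, pairMatrix_mul_transpose_mul,
    pairMatrix_mul_transpose, Matrix.mul_one] at this
  exact Subtype.ext this

theorem mem_soStarAlg_iff {n : ℕ} {Z : Matrix (Fin n ⊕ Fin n) (Fin n ⊕ Fin n) ℂ} :
    Z ∈ soStarAlg n ↔ Zᵀ = -Z ∧ Z * J (Fin n) ℂ = J (Fin n) ℂ * Z.map (starRingEnd ℂ) := by
  rw [map_conj_eq_iff (map_conj_J (Fin n))]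
  refine and_congr_right fun hZ => ?_
  have : Zᴴ = -Z.map (starRingEnd ℂ) := by
    change Zᵀ.map (starRingEnd ℂ) = _
    rw [hZ, Matrix.map_neg _ (map_neg _)]
  rw [this, neg_mul, neg_add_eq_zero]

theorem mem_range_pairLieHom_iff (X : Matrix (Fin m) (Fin m) ℂ) :
    X ∈ (pairLieHom m).range ↔ Xᵀ = -X ∧ X * quarterC m = quarterC m * X.map (starRingEnd ℂ) ∧
      X * (1 - (pairMatrix m)ᵀ * pairMatrix m) =
        (1 - (pairMatrix m)ᵀ * pairMatrix m) * X.map (starRingEnd ℂ) := by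
  have w := pairMatrix_mul_transpose m
  have w' : ∀ {l : Type} [Fintype l] (X : Matrix (Fin (m / 2) ⊕ Fin (m / 2)) l ℂ),
    pairMatrix m * ((pairMatrix m)ᵀ * X) = X := pairMatrix_mul_transpose_mul
  constructor
  · rintro ⟨Z, rfl⟩
    obtain ⟨h1, h2⟩ := mem_soStarAlg_iff.1 Z.2
    change ((pairMatrix m)ᵀ * Z.val * pairMatrix m)ᵀ = -((pairMatrix m)ᵀ * Z.val * pairMatrix m) ∧
      (pairMatrix m)ᵀ * Z.val * pairMatrix m * _ =
        _ * ((pairMatrix m)ᵀ * Z.val * pairMatrix m).map (starRingEnd ℂ) ∧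
      (pairMatrix m)ᵀ * Z.val * pairMatrix m * _ =
        _ * ((pairMatrix m)ᵀ * Z.val * pairMatrix m).map (starRingEnd ℂ)
    rw [Matrix.map_mul, Matrix.map_mul, transpose_map, map_pairMatrix]
    refine ⟨?_, ?_, ?_⟩
    · simp only [transpose_mul, transpose_transpose, h1, Matrix.mul_neg, Matrix.neg_mul,
        Matrix.mul_assoc]
    · simp only [quarterC, Matrix.mul_assoc, w']
      rw [← Matrix.mul_assoc Z.val, h2, Matrix.mul_assoc]
    · simp only [Matrix.mul_sub, Matrix.sub_mul, Matrix.mul_assoc, w', Matrix.mul_one,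
        Matrix.one_mul, sub_self]
  · rintro ⟨h1, h2, h3⟩
    obtain ⟨R, hR⟩ : ∃ R, R = 1 - (pairMatrix m)ᵀ * pairMatrix m := ⟨_, rfl⟩
    have hRR : R * R = R := by
      rw [hR]
      simp only [Matrix.mul_sub, Matrix.sub_mul, Matrix.mul_assoc, w', Matrix.mul_one,
        Matrix.one_mul, sub_self, sub_zero]
    have hRt : Rᵀ = R := by
      rw [hR, transpose_sub, transpose_mul, transpose_transpose, transpose_one]
    rw [← hR] at h3
    -- At most one coordinate is unpaired, so `R X R` has at most one entry, and it is a diagonal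
    -- entry of a skew-symmetric matrix.
    have hRX : R * X * R = 0 := by
      have hRd : R = diagonal fun i : Fin m => if i.val < 2 * (m / 2) then 0 else 1 := by
        rw [hR, transpose_pairMatrix_mul_self, ← diagonal_one, diagonal_sub]
        congr 1
        funext i
        split_ifs <;> simp
      rw [hRd]
      ext i k
      rw [mul_diagonal, diagonal_mul]
      by_cases hi : i.val < 2 * (m / 2)
      · simp [hi]
      · by_cases hk : k.val < 2 * (m / 2)
        · simp [hk]
        · obtain rfl : i = k := Fin.ext (by omega)
          have : X i i = 0 := self_eq_neg.1 (congrFun (congrFun h1 i) i)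
          simp [this]
    -- The relation `X R = R conj(X)` and `R² = R` give `X R = R X R`. So `X` lives on the paired
    -- coordinates, where the remaining relation defines `𝔰𝔬*`.
    have hXR : X * R = 0 := by
      rw [h3, ← hRR, mul_assoc, ← h3, ← mul_assoc, hRX]
    have hRX' : R * X = 0 := by
      have := congrArg transpose hXR
      rwa [transpose_mul, hRt, h1, mul_neg, transpose_zero, neg_eq_zero] at this
    have e1 : X * ((pairMatrix m)ᵀ * pairMatrix m) = X := by
      rw [hR, mul_sub, mul_one, sub_eq_zero] at hXR
      exact hXR.symm
    have e2 : (pairMatrix m)ᵀ * pairMatrix m * X = X := by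
      rw [hR, sub_mul, one_mul, sub_eq_zero] at hRX'
      exact hRX'.symm
    refine ⟨⟨pairMatrix m * X * (pairMatrix m)ᵀ, mem_soStarAlg_iff.2 ⟨?_, ?_⟩⟩, ?_⟩
    · simp only [transpose_mul, transpose_transpose, h1, Matrix.mul_neg, Matrix.neg_mul,
        Matrix.mul_assoc]
    · have := congrArg (fun M => pairMatrix m * (M * (pairMatrix m)ᵀ)) h2
      simp only [quarterC, Matrix.mul_assoc, w', w, Matrix.mul_one] at this
      rw [Matrix.map_mul, Matrix.map_mul, transpose_map, map_pairMatrix]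
      simpa only [Matrix.mul_assoc] using this
    · change (pairMatrix m)ᵀ * (pairMatrix m * X * (pairMatrix m)ᵀ) * pairMatrix m = X
      calc _ = (pairMatrix m)ᵀ * pairMatrix m * (X * ((pairMatrix m)ᵀ * pairMatrix m)) := by
            simp only [Matrix.mul_assoc]
        _ = X := by rw [e1, e2]

theorem mem_stabilizerOf_boundaryPointC_exp_iff (X : Matrix (Fin m) (Fin m) ℂ) :
    (∀ t : ℝ, ∃ g : SOC m, g ∈ stabilizerOf (SOCToComplex m)
      (boundaryPointC (1 : Fin m → ℤˣ) : (SOC m × SOC m) ⧸ KCdiag m) ∧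
        g.val.val = NormedSpace.exp (t • X)) ↔ X ∈ (pairLieHom m).range := by
  have hexp : ∀ t : ℝ, fromBlocks (NormedSpace.exp (t • X)) 0 0
      ((NormedSpace.exp (t • X)).map (starRingEnd ℂ)) =
      NormedSpace.exp (t • fromBlocks X 0 0 (X.map (starRingEnd ℂ))) := fun t => by
    rw [fromBlocks_smul, smul_zero, Matrix.exp_fromBlocks_diagonal, Matrix.map_exp_conj]
    congr 2
    ext i j
    simp only [Matrix.smul_apply, map_apply, Complex.real_smul, map_mul, Complex.conj_ofReal]
  rw [mem_range_pairLieHom_iff, ← commute_symm_boundaryPointC_iff]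
  constructor
  · intro H
    refine ⟨?_, ?_⟩
    · have : IsSkewFor 1 X := isSkewFor_of_exp fun t => by
        obtain ⟨g, -, hg⟩ := H t
        rw [← hg, mul_one, g.2.1]
      rw [IsSkewFor, mul_one, one_mul] at this
      exact eq_neg_of_add_eq_zero_left this
    · open scoped Matrix.Norms.Operator in
      refine (realizationC m).commute_of_mem_stabilizerOf fun t => ?_
      obtain ⟨g, hg, e⟩ := H t
      exact ⟨g, hg, (congrArg (fun M => fromBlocks M 0 0 (M.map (starRingEnd ℂ))) e).trans (hexp t)⟩
  · rintro ⟨hX, hc⟩ t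
    let γ : ℝ → SOC m := fun t => ⟨expGL (t • X), expGL_mem_SOC (by rw [transpose_smul, hX, smul_neg])⟩
    have hγ : Continuous γ :=
      (continuous_expGL.comp (continuous_id.smul continuous_const)).subtype_mk _
    refine ⟨γ t, ?_, rfl⟩
    open scoped Matrix.Norms.Operator in
    refine (realizationC m).mem_stabilizerOf_of_commute hc hγ (fun s t => Subtype.ext ?_) hexp t
    exact expGL_add_smul X s t

theorem hasLieAlgebra_stabilizerOf_boundaryPointC (m : ℕ) :
    HasLieAlgebra (stabilizerOf (SOCToComplex m)
      (boundaryPointC (1 : Fin m → ℤˣ) : (SOC m × SOC m) ⧸ KCdiag m)) (soStarAlg (m / 2)) :=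
  ⟨(pairLieHom m).range, fun X => (mem_stabilizerOf_boundaryPointC_exp_iff X).symm,
    ⟨(LieEquiv.ofInjective _ (pairLieHom_injective m)).symm⟩⟩

end LieAlgebraC

/-! ### The theorem for `SO(m,ℂ)`, and the four cases together. -/

theorem isoHomogeneous_boundaryC {m : ℕ} (hm : Odd m) : ∃ H : Subgroup (SOC m),
    IsoHomogeneous (SOCToComplex m) (boundaryC m) H ∧ HasLieAlgebra H (soStarAlg (m / 2)) := by
  obtain ⟨n, rfl⟩ := hm
  obtain ⟨k, hk⟩ := exists_notMem_range_pairIndex (n := n)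
  exact ⟨_, isoHomogeneous_of_locallyTransitive continuous_SOCToComplex (boundaryC_eq_orbit hk)
    (locallyTransitiveAt_boundaryC 1), hasLieAlgebra_stabilizerOf_boundaryPointC _⟩

theorem isoHomogeneousSum_boundaryC {m : ℕ} (hm : Even m) (hm0 : m ≠ 0) :
    ∃ H₁ H₂ : Subgroup (SOC m),
      IsoHomogeneousSum (SOCToComplex m) (boundaryC m) H₁ H₂ ∧
      (∃ κ : SOC m ≃ₜ* SOC m, H₁.map κ.toMulEquiv.toMonoidHom = H₂) ∧
      (Odd (m / 2) → H₁ = H₂) ∧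
      HasLieAlgebra H₁ (soStarAlg (m / 2)) ∧ HasLieAlgebra H₂ (soStarAlg (m / 2)) := by
  have hm2 : 2 * (m / 2) = m := Nat.two_mul_div_two_of_even hm
  have hbij : Function.Bijective (pairIndex m) :=
    ⟨pairIndex_injective m, fun k => (mem_range_pairIndex_iff k).2 (by omega)⟩
  obtain ⟨r, hr, hodd⟩ : ∃ r : Fin m → ℤˣ, ∏ i, r i = -1 ∧
      (Odd (m / 2) → signedQuarterC r = -quarterC m) := by
    by_cases ho : Odd (m / 2)
    -- Changing the sign of the second member of every pair turns `N` into `-N`. The product of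
    -- these signs is `(-1) ^ (m / 2)`, which is `-1` exactly when `m / 2` is odd.
    · let s : Fin (m / 2) ⊕ Fin (m / 2) → ℤˣ := Sum.elim 1 (-1)
      let e := Equiv.ofBijective _ hbij
      have hs : (s ∘ e.symm) ∘ pairIndex m = s := funext fun a =>
        congrArg s (e.symm_apply_apply a)
      refine ⟨s ∘ e.symm, ?_, fun _ => ?_⟩
      · rw [← hbij.prod_comp]
        change ∏ a, ((s ∘ e.symm) ∘ pairIndex m) a = -1
        rw [hs, Fintype.prod_sum_type]
        simp [s, ho.neg_one_pow]
      · rw [signedQuarterC_eq, hs, quarterC, ← Matrix.neg_mul, ← Matrix.mul_neg]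
        congr 2
        ext (i | i) (j | j)
        · simp [J, diagonalSign_apply]
        · rcases eq_or_ne i j with rfl | hij <;> simp [J, diagonalSign_apply, s, *]
        · rcases eq_or_ne i j with rfl | hij <;> simp [J, diagonalSign_apply, s, *]
        · simp [J, diagonalSign_apply]
    · exact ⟨Pi.mulSingle ⟨0, by omega⟩ (-1), by rw [Fintype.prod_pi_mulSingle'],
        fun h => absurd h ho⟩
  have hV : (pairMatrix m)ᵀ * pairMatrix m = 1 := by
    rw [transpose_pairMatrix_mul_self, ← diagonal_one]
    congr 1
    funext i
    exact if_pos (by omega)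
  have hL := hasLieAlgebra_stabilizerOf_boundaryPointC m
  have hκ := mem_stabilizerOf_boundaryPointC_iff r
  exact ⟨_, _, isoHomogeneousSum_of_locallyTransitive continuous_SOCToComplex
    (boundaryC_eq_orbits hr) (smul_boundaryPointC_ne hV hr) (locallyTransitiveAt_boundaryC 1)
    (locallyTransitiveAt_boundaryC r), ⟨conjDiagonalSign r, map_eq_of_mem_iff _ hκ⟩,
    fun ho => (stabilizerOf_boundaryPointC_eq (hodd ho)).symm, hL,
    hL.conj (diagonalSignGL r) (conjDiagonalSign r) (fun _ => rfl) hκ⟩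

theorem theorem5p1 :
    -- `G = SO_e(n, n)`
    (∀ n : ℕ, 1 ≤ n → ∃ H₁ H₂ : Subgroup (SOe n n),
      IsoHomogeneousSum (SOeToComplex n n) (boundaryPQ n n le_rfl) H₁ H₂ ∧
      (∃ κ : SOe n n ≃ₜ* SOe n n, H₁.map κ.toMulEquiv.toMonoidHom = H₂) ∧
      (Odd n → H₁ = H₂) ∧
      HasLieAlgebra H₁ (soAlg ℂ n) ∧ HasLieAlgebra H₂ (soAlg ℂ n)) ∧
    -- `G = SO(2n, ℂ)`
    (∀ n : ℕ, 1 ≤ n → ∃ H₁ H₂ : Subgroup (SOC (2 * n)),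
      IsoHomogeneousSum (SOCToComplex (2 * n)) (boundaryC (2 * n)) H₁ H₂ ∧
      (∃ κ : SOC (2 * n) ≃ₜ* SOC (2 * n), H₁.map κ.toMulEquiv.toMonoidHom = H₂) ∧
      (Odd n → H₁ = H₂) ∧
      HasLieAlgebra H₁ (soStarAlg n) ∧ HasLieAlgebra H₂ (soStarAlg n)) ∧
    -- `G = SO_e(p, q)` with `p < q`
    (∀ (p q : ℕ) (hpq : p < q), 1 ≤ p → ∃ H : Subgroup (SOe p q),
      IsoHomogeneous (SOeToComplex p q) (boundaryPQ p q hpq.le) H ∧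
      HasLieAlgebra H (soAlg ℂ p × soAlg ℝ (q - p))) ∧
    -- `G = SO(2n + 1, ℂ)`
    (∀ n : ℕ, 1 ≤ n → ∃ H : Subgroup (SOC (2 * n + 1)),
      IsoHomogeneous (SOCToComplex (2 * n + 1)) (boundaryC (2 * n + 1)) H ∧
      HasLieAlgebra H (soStarAlg n)) := by
  refine ⟨fun n hn => isoHomogeneousSum_boundaryPQ hn, fun n hn => ?_,
    fun p q hpq _ => isoHomogeneous_boundaryPQ hpq, fun n _ => ?_⟩
  · have h := isoHomogeneousSum_boundaryC (even_two_mul n) (by omega)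
    rwa [Nat.mul_div_cancel_left n two_pos] at h
  · have h := isoHomogeneous_boundaryC (odd_two_mul_add_one n)
    rwa [show (2 * n + 1) / 2 = n by omega] at h

end
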